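/- Consider a finite set $\mathcal C$ of sources, one server and one sink. Source $j\in\mathcal C$ generates packets according to a Poisson process of rate $\lambda_j>0$ (started at time $0$), the service times of the packets are i.i.d. nonnegative random variables with an arbitrary distribution, and all Poisson processes and service times are mutually independent. The system holds at most one packet and is empty at time $0$. Under the source-aware preemptive policy, a packet arriving to an idle server enters service, an arriving packet replaces a packet of its own source in service, and it is blocked and cleared if a packet of another source is in service. Fix a source $c$. Let $t_{c,i}$ and $t'_{c,i}$ ($i\ge 1$) be the generation and delivery times of the $i$th delivered packet of source $c$, and put $Y_{c,i}=t'_{c,i+1}-t'_{c,i}$ (interdeparture time), $T_{c,i}=t'_{c,i}-t_{c,i}$ (system time) and $A_{c,i+1}=Y_{c,i}+T_{c,i}$ (peak AoI, the AoI just before the delivery of packet $i+1$). The AoI at time $t$ is $\delta_c(t)=t-U_c(t)$, where $U_c(t)$ is the generation time of the most recently delivered packet of source $c$. Write $S$ for a generic service time, $\lambda=\sum_{j\in\mathcal C}\lambda_j$, $M_S(u)=\mathbb E[e^{uS}]$, $L_{\lambda_c}=\mathbb E[e^{-\lambda_c S}]$, $a_j=\dfrac{\lambda_j}{\lambda-s}$,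 $a'_j=\dfrac{\lambda_j(1-M_S(s-\lambda_j))}{\lambda_j-s}$, and $$\bar M_{Y_c}(s)=\dfrac{a_cM_S(s-\lambda_c)}{(1-a'_c)\Big(1-\sum_{j\in\mathcal C\setminus\{c\}}\dfrac{a_jM_S(s-\lambda_j)}{1-a'_j}\Big)} .$$ Then the AoI of source $c$ has a stationary distribution, i.e. there is a probability measure $\pi_c$ on $\mathbb R$ such that, for every Borel set $B$, the long-run fraction of time during which $\delta_c(t)\in B$ is almost surely equal to $\pi_c(B)$. The function $\bar M_{Y_c}$ is differentiable at $0$, and for every $i\ge1$ the MGF $\mathbb E[e^{sY_{c,i}}]$ is finite for all $s$ in a neighbourhood of $0$. For every $i\ge 1$ and every real $s\notin\{\lambda_j: j\in\mathcal C\}$ (at these points $a'_j$ is not defined) for which $\mathbb E[e^{sY_{c,i}}]<\infty$: 1. $\mathbb E[e^{sY_{c,i}}]=\bar M_{Y_c}(s)$; 2. the MGF of the peak AoI is finite at $s$ and $\displaystyle \bar M_{A_c}(s)=\mathbb E[e^{sA_{c,i+1}}]=\frac{M_S(s-\lambda_c)\,\bar M_{Y_c}(s)}{L_{\lambda_c}}$;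 3. if $s\ne0$, the MGF of the stationary AoI is finite at $s$ and $\displaystyle \bar M_{\delta_c}(s)=\int e^{sx}\,\pi_c(dx)=\frac{M_S(s-\lambda_c)\,(\bar M_{Y_c}(s)-1)}{s\,L_{\lambda_c}\,\bar M'_{Y_c}(0)}$. -/

import Mathlib

open MeasureTheory ProbabilityTheory Filter Topology

noncomputable section

namespace MG11

/-! ### One realization of the system

`x j n` is the interarrival time preceding the `n`-th packet of source `j` (`n = 0, 1, …`), and
`s j n` is the service time of that packet.  The system starts empty at time `0`. -/

/-- A packet: its source, its generation (= arrival) time, and the time at which its service ends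
provided that it is not preempted. -/
structure Packet (ι : Type*) where
  source : ι
  gen : ℝ
  done : ℝ

section Path

variable {ι : Type*} [Finite ι] [Nonempty ι] [DecidableEq ι]

/-- Generation time of the `n`-th packet of source `j`. -/
def arrivalTime (x : ι → ℕ → ℝ) (j : ι) (n : ℕ) : ℝ :=
  ∑ k ∈ Finset.range (n + 1), x j k

/-- If source `j` has generated `k j` packets so far, the source which generates the next packet
of the system, i.e. a source whose next packet has the least generation time (ties have
probability zero). -/
def nextSource (x : ι → ℕ → ℝ) (k : ι → ℕ) : ι :=
  Classical.choose (Finite.exists_min fun j => arrivalTime x j (k j))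

/-- `counts x n j` is the number of packets of source `j` among the first `n` packets generated in
the system. -/
def counts (x : ι → ℕ → ℝ) : ℕ → ι → ℕ
  | 0 => fun _ => 0
  | n + 1 =>
    let k := counts x n
    let j := nextSource x k
    Function.update k j (k j + 1)

/-- The `n`-th packet generated in the system (all sources merged in order of generation). -/
def packet (x s : ι → ℕ → ℝ) (n : ℕ) : Packet ι :=
  let k := counts x n
  let j := nextSource x k
  { source := j
    gen := arrivalTime x j (k j)
    done := arrivalTime x j (k j) + s j (k j) }

/-- The source-aware preemptive policy.  Let `p` be the packet most recently taken into service,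
if any.  An arriving packet `q` is taken into service if the server is idle (there is no `p`, or
`p` has completed service) or if `p` comes from the source of `q`, in which case `p` is preempted.
Otherwise `q` is blocked and cleared. -/
def accept : Option (Packet ι) → Packet ι → Option (Packet ι)
  | none, q => some q
  | some p, q => if p.done ≤ q.gen ∨ p.source = q.source then some q else some p

/-- The packet most recently taken into service just before the `n`-th arrival. -/
def server (x s : ι → ℕ → ℝ) : ℕ → Option (Packet ι)
  | 0 => none
  | n + 1 => accept (server x s n) (packet x s n)

/-- The packet most recently taken into service just before the `n`-th arrival is a packet of
source `c`, and it has completed service by the time of the `n`-th arrival.  (The `n`-th packet is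
then taken into service, so every delivered packet is counted for exactly one `n`.) -/
def Delivers (x s : ι → ℕ → ℝ) (c : ι) (n : ℕ) : Prop :=
  ∃ p, server x s n = some p ∧ p.source = c ∧ p.done ≤ (packet x s n).gen

/-- The `i`-th delivered packet of source `c`, `i = 0, 1, …` (there are infinitely many almost
surely). -/
def deliveredPacket (x s : ι → ℕ → ℝ) (c : ι) (i : ℕ) : Option (Packet ι) :=
  server x s (Nat.nth (Delivers x s c) i)

/-- Generation time of the `i`-th delivered packet of source `c`. -/
def genTime (x s : ι → ℕ → ℝ) (c : ι) (i : ℕ) : ℝ :=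
  (deliveredPacket x s c i).elim 0 Packet.gen

/-- Time at which the `i`-th delivered packet of source `c` arrives at the sink. -/
def deliveryTime (x s : ι → ℕ → ℝ) (c : ι) (i : ℕ) : ℝ :=
  (deliveredPacket x s c i).elim 0 Packet.done

/-- The `i`-th interdeparture time of source `c`. -/
def interdepartureTime (x s : ι → ℕ → ℝ) (c : ι) (i : ℕ) : ℝ :=
  deliveryTime x s c (i + 1) - deliveryTime x s c i

/-- System time of the `i`-th delivered packet of source `c`. -/
def systemTime (x s : ι → ℕ → ℝ) (c : ι) (i : ℕ) : ℝ :=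
  deliveryTime x s c i - genTime x s c i

/-- Peak AoI of source `c`: the AoI immediately before the delivery of packet `i + 1`. -/
def peakAoI (x s : ι → ℕ → ℝ) (c : ι) (i : ℕ) : ℝ :=
  interdepartureTime x s c i + systemTime x s c i

open Classical in
/-- Time stamp of the most recently received packet of source `c` at time `t` (by convention `0`
before the first delivery). -/
def timeStamp (x s : ι → ℕ → ℝ) (c : ι) (t : ℝ) : ℝ :=
  if {i | deliveryTime x s c i ≤ t}.Nonempty then
    genTime x s c (sSup {i | deliveryTime x s c i ≤ t})
  else 0

/-- The AoI of source `c` at time `t`. -/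
def aoi (x s : ι → ℕ → ℝ) (c : ι) (t : ℝ) : ℝ :=
  t - timeStamp x s c t

end Path

/-! ### The probabilistic model -/

/-- The multi-source M/G/1/1 input: source `j` generates packets according to a Poisson process of
rate `lam j` (the interarrival times `X j n` are i.i.d. exponential), the service times `S j n` are
i.i.d. with law `ν` on `[0, ∞)`, and all these variables are independent. -/
structure IsInput {ι Ω : Type*} [MeasurableSpace Ω] (P : Measure Ω) (lam : ι → ℝ) (ν : Measure ℝ)
    (X S : ι → ℕ → Ω → ℝ) : Prop where
  rate_pos : ∀ j, 0 < lam j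
  service_nonneg : ∀ᵐ u ∂ν, 0 ≤ u
  measurable_X : ∀ j n, Measurable (X j n)
  measurable_S : ∀ j n, Measurable (S j n)
  law_X : ∀ j n, P.map (X j n) = expMeasure (lam j)
  law_S : ∀ j n, P.map (S j n) = ν
  indep : iIndepFun
    (Sum.elim (fun p : ι × ℕ => X p.1 p.2) (fun p : ι × ℕ => S p.1 p.2)) P

/-- `law` is the stationary distribution of the (ergodic) process `δ` on `[0, ∞)`: for every Borel
set `B`, the long-run fraction of time which the process spends in `B` is almost surely `law B`. -/
def IsStationaryLaw {Ω : Type*} [MeasurableSpace Ω] (P : Measure Ω) (δ : ℝ → Ω → ℝ)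
    (law : Measure ℝ) : Prop :=
  ∀ B : Set ℝ, MeasurableSet B → ∀ᵐ ω ∂P,
    Tendsto (fun τ : ℝ => volume.real {t : ℝ | t ∈ Set.Icc 0 τ ∧ δ t ω ∈ B} / τ) atTop
      (𝓝 (law.real B))

/-! ### The closed forms -/

section ClosedForms

variable {ι : Type*} [Fintype ι] [DecidableEq ι]

/-- The MGF `M_S(u) = E[exp (u S)]` of the service time. -/
def MS (ν : Measure ℝ) (u : ℝ) : ℝ := ∫ y, Real.exp (u * y) ∂ν

/-- `L_r = E[exp (-r S)]`. -/
def LS (ν : Measure ℝ) (r : ℝ) : ℝ := ∫ y, Real.exp (-r * y) ∂ν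

/-- `a_j = λ_j / (λ - s)`, where `λ` is the sum of all rates. -/
def coefA (lam : ι → ℝ) (j : ι) (s : ℝ) : ℝ := lam j / ((∑ i, lam i) - s)

/-- `a'_j = λ_j (1 - M_S(s - λ_j)) / (λ_j - s)`. -/
def coefA' (lam : ι → ℝ) (ν : Measure ℝ) (j : ι) (s : ℝ) : ℝ :=
  lam j * (1 - MS ν (s - lam j)) / (lam j - s)

/-- The closed form of the MGF of the interdeparture time of source `c`. -/
def MY (lam : ι → ℝ) (ν : Measure ℝ) (c : ι) (s : ℝ) : ℝ :=
  coefA lam c s * MS ν (s - lam c) /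
    ((1 - coefA' lam ν c s) *
      (1 - ∑ j ∈ Finset.univ.erase c,
        coefA lam j s * MS ν (s - lam j) / (1 - coefA' lam ν j s)))

end ClosedForms

end MG11

end

noncomputable section

namespace MG11

open scoped ENNReal

/-! ### Regenerative steps -/

/-! The system regenerates at every delivery: the server is then empty and, the interarrival times
being memoryless, the packets still to come are a fresh copy of the whole input, exactly as at time
0. Between two deliveries of the system (a cycle) the source `j` whose packet comes first seizes the
server; the idle time before it contributes `a_j` to the transform of the cycle length. The source
keeps the server until a packet of its own is delivered: each packet in service is either preempted
by the next packet of the source (transform `a'_j`) or survives (transform `M_S(s - λ_j)`), and all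
other sources are blocked. Summing over the number of preemptions gives `C_j = a_j M_S(s - λ_j) / (1
- a'_j)`. An interdeparture time of source `c` is a number of cycles of other sources followed by
one of `c`, so a second geometric series gives `C_c / (1 - ∑_{j ≠ c} C_j)`, which is `MY`.

The pairs (interdeparture time, system time at its end) are therefore i.i.d. The peak age adds an
interdeparture time to the system time at its beginning, which belongs to the preceding, independent
pair. The system time has the law of `S` reweighted by the survival probability `exp (-λ_c y)`,
whence the factor `M_S(s - λ_c) / L`. The age starts each interdeparture period at the preceding
system time `T` and grows at unit rate, so by renewal-reward its stationary MGF is `E[exp (sT)]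
E[(exp (sY) - 1) / s] / E[Y]`, and `E[Y]` is the derivative of `MY` at 0.

The probabilistic work is an abstract strong Markov property for regenerative steps, stated in
`StoppingRule.IsFresh.lintegral_stopsAt` and used for the packets of a source (`residualRule`,
`trialRule`) and for sequences of cycles (`sourceRule`); `lintegral_isFirst` couples the sources.
The link with the recursive definition of the policy is made path by path in
`IsRegular.firstDelivery` and `exists_delivers_count`, on the almost sure event that there are no
ties.

All transforms are first computed in `ℝ≥0∞`, where the geometric series need no convergence
hypothesis. A product of nonzero factors is finite only if every factor is, so finiteness of the MGF
of `Y` alone yields all the inequalities which validate the closed forms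
(`of_inv_otherWeight_mul_ne_top`). -/

/-- A step `θ` of a stochastic system with output `o` is regenerative if it preserves the law of the
system and the state after the step is independent of the output. -/
structure IsRegenerative {Ξ O : Type*} [MeasurableSpace Ξ] [MeasurableSpace O] (μ : Measure Ξ)
    (o : Ξ → O) (θ : Ξ → Ξ) : Prop where
  measurable_out : Measurable o
  preserving : MeasurePreserving θ μ μ
  indep : IndepFun o θ μ

namespace IsRegenerative

variable {Ξ O : Type*} [MeasurableSpace Ξ] [MeasurableSpace O] {μ : Measure Ξ}
  [IsProbabilityMeasure μ] {o : Ξ → O} {θ : Ξ → Ξ}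

theorem lintegral_eq (h : IsRegenerative μ o θ) {F : O × Ξ → ℝ≥0∞} (hF : Measurable F) :
    ∫⁻ x, F (o x, θ x) ∂μ = ∫⁻ a, ∫⁻ y, F (a, y) ∂μ ∂(μ.map o) := by
  have ho := h.measurable_out
  have hθ := h.preserving.measurable
  have hmap := (indepFun_iff_map_prod_eq_prod_map_map ho.aemeasurable hθ.aemeasurable).1 h.indep
  rw [h.preserving.map_eq] at hmap
  have := Measure.isProbabilityMeasure_map (μ := μ) ho.aemeasurable
  rw [← lintegral_prod _ hF.aemeasurable, ← hmap, lintegral_map hF (ho.prodMk hθ)]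

/-- The choice `A = univ` shows that `θ` preserves `μ`, so one product formula with `μ B` on the
right carries both the invariance and the independence. -/
theorem of_measure_inter {o : Ξ → O} {θ : Ξ → Ξ} (ho : Measurable o) (hθ : Measurable θ)
    (h : ∀ A B, MeasurableSet A → MeasurableSet B →
      μ (o ⁻¹' A ∩ θ ⁻¹' B) = μ (o ⁻¹' A) * μ B) : IsRegenerative μ o θ := by
  have hp : MeasurePreserving θ μ μ := by
    refine ⟨hθ, Measure.ext fun B hB => ?_⟩
    have := h Set.univ B .univ hB
    rw [Measure.map_apply hθ hB]
    simpa using this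
  refine ⟨ho, hp, indepFun_iff_measure_inter_preimage_eq_mul.2 fun A B hA hB => ?_⟩
  rw [h A B hA hB, hp.measure_preimage hB.nullMeasurableSet]

end IsRegenerative

/-- A rule for running a regenerative system until a stopping condition is met: in state `σ`, after
having read the output `a`, either halt with the output `out (σ, a)` and the residual system
`res (σ, a, x)`, or continue in state `next (σ, a)`. -/
structure StoppingRule (St O Ξ E : Type*) [MeasurableSpace St] [MeasurableSpace O]
    [MeasurableSpace Ξ] [MeasurableSpace E] where
  halt : Set (St × O)
  next : St × O → St
  out : St × O → E
  res : St × O × Ξ → Ξ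
  measurableSet_halt : MeasurableSet halt
  measurable_next : Measurable next
  measurable_out : Measurable out
  measurable_res : Measurable res

namespace StoppingRule

variable {St O Ξ E : Type*} [MeasurableSpace St] [MeasurableSpace O]
    [MeasurableSpace Ξ] [MeasurableSpace E] (R : StoppingRule St O Ξ E) (o : Ξ → O) (θ : Ξ → Ξ)

/-- The rule stops after having read exactly `n + 1` outputs. -/
def StopsAt : ℕ → St × Ξ → Prop
  | 0, p => (p.1, o p.2) ∈ R.halt
  | n + 1, p => (p.1, o p.2) ∉ R.halt ∧ StopsAt n (R.next (p.1, o p.2), θ p.2)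

/-- Output and residual system if the rule stops after having read `n + 1` outputs. -/
def value : ℕ → St × Ξ → E × Ξ
  | 0, p => (R.out (p.1, o p.2), R.res (p.1, o p.2, θ p.2))
  | n + 1, p => value n (R.next (p.1, o p.2), θ p.2)

/-- The number of outputs which are read before the last one. -/
def index (p : St × Ξ) : ℕ := sInf {n | R.StopsAt o θ n p}

/-- Output and residual system when the rule stops. -/
def final (p : St × Ξ) : E × Ξ := R.value o θ (R.index o θ p) p

open Classical in
/-- The integral of `f` of the output over the event that the rule stops after having read `n + 1`
outputs with law `κ`. -/
def weight (κ : Measure O) (f : E → ℝ≥0∞) : ℕ → St → ℝ≥0∞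
  | 0, σ => ∫⁻ a, if (σ, a) ∈ R.halt then f (R.out (σ, a)) else 0 ∂κ
  | n + 1, σ => ∫⁻ a, if (σ, a) ∈ R.halt then 0 else weight κ f n (R.next (σ, a)) ∂κ

variable {R o θ}

theorem StopsAt.unique {n m : ℕ} {p : St × Ξ} (hn : R.StopsAt o θ n p) (hm : R.StopsAt o θ m p) :
    n = m := by
  induction n generalizing m p with
  | zero =>
    cases m with
    | zero => rfl
    | succ m => exact absurd hn hm.1
  | succ n ih =>
    cases m with
    | zero => exact absurd hm hn.1
    | succ m => rw [ih hn.2 hm.2]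

theorem StopsAt.index_eq {n : ℕ} {p : St × Ξ} (hn : R.StopsAt o θ n p) : R.index o θ p = n := by
  have : {n | R.StopsAt o θ n p} = {n} := by
    ext m; exact ⟨fun h => h.unique hn, fun h => h ▸ hn⟩
  rw [index, this, csInf_singleton]

theorem StopsAt.final_eq {n : ℕ} {p : St × Ξ} (hn : R.StopsAt o θ n p) :
    R.final o θ p = R.value o θ n p := by rw [final, hn.index_eq]

theorem measurableSet_stopsAt (ho : Measurable o) (hθ : Measurable θ) (n : ℕ) :
    MeasurableSet {p | R.StopsAt o θ n p} := by
  have h1 : Measurable fun p : St × Ξ => (p.1, o p.2) :=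
    measurable_fst.prodMk (ho.comp measurable_snd)
  induction n with
  | zero => exact h1 R.measurableSet_halt
  | succ n ih =>
    exact (h1 R.measurableSet_halt).compl.inter
      (((R.measurable_next.comp h1).prodMk (hθ.comp measurable_snd)) ih)

theorem measurable_value (ho : Measurable o) (hθ : Measurable θ) (n : ℕ) :
    Measurable (R.value o θ n) := by
  have h1 : Measurable fun p : St × Ξ => (p.1, o p.2) :=
    measurable_fst.prodMk (ho.comp measurable_snd)
  have h2 : Measurable fun p : St × Ξ => θ p.2 := hθ.comp measurable_snd
  induction n with
  | zero =>
    exact (R.measurable_out.comp h1).prodMk (R.measurable_res.comp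
      (measurable_fst.prodMk ((ho.comp measurable_snd).prodMk h2)))
  | succ n ih => exact ih.comp ((R.measurable_next.comp h1).prodMk h2)

theorem measurable_index (ho : Measurable o) (hθ : Measurable θ) :
    Measurable (R.index o θ) := by
  refine measurable_to_countable' fun n => ?_
  have hm := measurableSet_stopsAt (R := R) ho hθ
  rcases n with _ | n
  -- The infimum of the empty set is 0, so index 0 also collects the realizations on which the rule
  -- never stops.
  · have : R.index o θ ⁻¹' {0} = {p | R.StopsAt o θ 0 p} ∪ ⋂ m, {p | R.StopsAt o θ m p}ᶜ := by
      ext p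
      simp only [Set.mem_preimage, Set.mem_singleton_iff, index, Nat.sInf_eq_zero, Set.mem_union,
        Set.mem_ofPred_eq, Set.mem_iInter, Set.mem_compl_iff, Set.eq_empty_iff_forall_notMem]
    rw [this]
    exact (hm 0).union (.iInter fun m => (hm m).compl)
  · have : R.index o θ ⁻¹' {n + 1} = {p | R.StopsAt o θ (n + 1) p} := by
      ext p
      refine ⟨fun h => ?_, fun h => StopsAt.index_eq h⟩
      have h' : sInf {n | R.StopsAt o θ n p} = n + 1 := h
      have hne : {n | R.StopsAt o θ n p}.Nonempty :=
        Nat.nonempty_of_pos_sInf (by omega)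
      have := Nat.sInf_mem hne
      rw [h'] at this
      exact this
    rw [this]
    exact hm (n + 1)

theorem measurable_final (ho : Measurable o) (hθ : Measurable θ) :
    Measurable (R.final o θ) := by
  have : Measurable fun q : ℕ × (St × Ξ) => R.value o θ q.1 q.2 :=
    measurable_from_prod_countable_right fun n => measurable_value ho hθ n
  exact this.comp ((measurable_index ho hθ).prodMk measurable_id)

theorem measurable_weight {κ : Measure O} [SFinite κ] {f : E → ℝ≥0∞} (hf : Measurable f) (n : ℕ) :
    Measurable (R.weight κ f n) := by
  classical
  induction n with
  | zero =>
    have : Measurable fun p : St × O => if p ∈ R.halt then f (R.out p) else 0 :=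
      Measurable.ite R.measurableSet_halt (hf.comp R.measurable_out) measurable_const
    exact this.lintegral_prod_right'
  | succ n ih =>
    have : Measurable fun p : St × O => if p ∈ R.halt then 0 else R.weight κ f n (R.next p) :=
      Measurable.ite R.measurableSet_halt measurable_const (ih.comp R.measurable_next)
    exact this.lintegral_prod_right'

open Classical in
/-- When the rule stops in a state of `V`, the residual system is a fresh copy of the original
one, and the states stay in `V`. -/
structure IsFresh (R : StoppingRule St O Ξ E) (μ : Measure Ξ) (κ : Measure O) (V : Set St) :
    Prop where
  fresh : ∀ σ ∈ V, ∀ f : E → ℝ≥0∞, Measurable f → ∀ B, MeasurableSet B →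
    ∫⁻ a, ∫⁻ x, (if (σ, a) ∈ R.halt then
      f (R.out (σ, a)) * B.indicator 1 (R.res (σ, a, x)) else 0) ∂μ ∂κ =
    (∫⁻ a, if (σ, a) ∈ R.halt then f (R.out (σ, a)) else 0 ∂κ) * μ B
  next_mem : ∀ σ ∈ V, ∀ᵐ a ∂κ, (σ, a) ∉ R.halt → R.next (σ, a) ∈ V

-- Strong Markov property, one output at a time: given the first output, the rest of the run is the
-- same rule from the next state on the independent system `θ x`, so the induction hypothesis
-- applies. At the last output, freshness splits off the factor `μ B`.
open Classical in
theorem IsFresh.lintegral_stopsAt {μ : Measure Ξ} [IsProbabilityMeasure μ] {V : Set St}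
    (hR : R.IsFresh μ (μ.map o) V) (hreg : IsRegenerative μ o θ) {f : E → ℝ≥0∞}
    (hf : Measurable f) {B : Set Ξ} (hB : MeasurableSet B) (n : ℕ) {σ : St} (hσ : σ ∈ V) :
    ∫⁻ x, (if R.StopsAt o θ n (σ, x) then
      f (R.value o θ n (σ, x)).1 * B.indicator 1 (R.value o θ n (σ, x)).2 else 0) ∂μ =
    R.weight (μ.map o) f n σ * μ B := by
  have ho := hreg.measurable_out
  have hθ := hreg.preserving.measurable
  have hBm : Measurable (B.indicator (1 : Ξ → ℝ≥0∞)) := measurable_one.indicator hB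
  induction n generalizing σ with
  | zero =>
    have := hreg.lintegral_eq (F := fun p => if (σ, p.1) ∈ R.halt then
      f (R.out (σ, p.1)) * B.indicator 1 (R.res (σ, p.1, p.2)) else 0) (by
        refine Measurable.ite ?_ ?_ measurable_const
        · exact (measurable_const.prodMk measurable_fst) R.measurableSet_halt
        · exact (hf.comp (R.measurable_out.comp (measurable_const.prodMk measurable_fst))).mul
            (hBm.comp (R.measurable_res.comp (measurable_const.prodMk
              (measurable_fst.prodMk measurable_snd)))))
    exact ((lintegral_congr fun x => if_congr Iff.rfl rfl rfl).trans this).trans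
      (hR.fresh σ hσ f hf B hB)
  | succ n ih =>
    have := hreg.lintegral_eq (F := fun p => if (σ, p.1) ∉ R.halt ∧
        R.StopsAt o θ n (R.next (σ, p.1), p.2) then
      f (R.value o θ n (R.next (σ, p.1), p.2)).1 *
        B.indicator 1 (R.value o θ n (R.next (σ, p.1), p.2)).2 else 0) (by
        have h1 : Measurable fun p : O × Ξ => (σ, p.1) := measurable_const.prodMk measurable_fst
        have h2 : Measurable fun p : O × Ξ => (R.next (σ, p.1), p.2) :=
          (R.measurable_next.comp h1).prodMk measurable_snd
        refine Measurable.ite ?_ ?_ measurable_const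
        · exact (h1 R.measurableSet_halt).compl.inter (h2 (measurableSet_stopsAt ho hθ n))
        · have h3 := (measurable_value (R := R) ho hθ n).comp h2
          exact (hf.comp (measurable_fst.comp h3)).mul (hBm.comp (measurable_snd.comp h3)))
    refine (Eq.trans (lintegral_congr fun x => ?_) this).trans ?_
    · simp only [StopsAt, value]
      congr 1
    rw [weight, ← lintegral_mul_const']
    · refine lintegral_congr_ae ?_
      filter_upwards [hR.next_mem σ hσ] with a ha
      by_cases h : (σ, a) ∈ R.halt
      · simp [h]
      · simp only [h, not_false_eq_true, true_and, if_false]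
        rw [← ih (ha h)]
    · exact measure_ne_top _ _

/-- The events of stopping after exactly `n + 1` outputs are disjoint, so their weights add up.
Almost sure stopping is not assumed: the case `f = 1` is what proves it in `IsFresh.ae_stops`. -/
theorem IsFresh.tsum_weight {μ : Measure Ξ} [IsProbabilityMeasure μ] {V : Set St}
    (hR : R.IsFresh μ (μ.map o) V) (hreg : IsRegenerative μ o θ) {f : E → ℝ≥0∞}
    (hf : Measurable f) {B : Set Ξ} (hB : MeasurableSet B) {σ : St} (hσ : σ ∈ V) :
    ∫⁻ x in {x | ∃ n, R.StopsAt o θ n (σ, x)},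
      f (R.final o θ (σ, x)).1 * B.indicator 1 (R.final o θ (σ, x)).2 ∂μ =
    (∑' n, R.weight (μ.map o) f n σ) * μ B := by
  classical
  have ho := hreg.measurable_out
  have hθ := hreg.preserving.measurable
  have hm : ∀ n, MeasurableSet {x | R.StopsAt o θ n (σ, x)} := fun n =>
    (measurable_const.prodMk measurable_id) (measurableSet_stopsAt ho hθ n)
  have hU : {x | ∃ n, R.StopsAt o θ n (σ, x)} = ⋃ n, {x | R.StopsAt o θ n (σ, x)} := by
    ext; simp
  rw [hU, lintegral_iUnion hm, ← ENNReal.tsum_mul_right]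
  · congr 1
    funext n
    rw [← hR.lintegral_stopsAt hreg hf hB n hσ, ← lintegral_indicator (hm n)]
    refine lintegral_congr fun x => ?_
    by_cases h : R.StopsAt o θ n (σ, x)
    · rw [Set.indicator_of_mem (by exact h), if_pos h, h.final_eq]
    · rw [Set.indicator_of_notMem (by exact h), if_neg h]
  · intro n m hnm
    exact Set.disjoint_left.2 fun x hx hx' => hnm (StopsAt.unique hx hx')

theorem IsFresh.ae_stops {μ : Measure Ξ} [IsProbabilityMeasure μ] {V : Set St}
    (hR : R.IsFresh μ (μ.map o) V) (hreg : IsRegenerative μ o θ) {σ : St} (hσ : σ ∈ V)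
    (h1 : ∑' n, R.weight (μ.map o) (fun _ => 1) n σ = 1) :
    ∀ᵐ x ∂μ, ∃ n, R.StopsAt o θ n (σ, x) := by
  have := hR.tsum_weight hreg (f := fun _ => 1) measurable_const MeasurableSet.univ hσ
  rw [h1] at this
  simp only [Set.indicator_univ, Pi.one_apply, mul_one, lintegral_const,
    Measure.restrict_apply_univ, measure_univ, one_mul] at this
  have hm : MeasurableSet {x | ∃ n, R.StopsAt o θ n (σ, x)} := by
    have : {x | ∃ n, R.StopsAt o θ n (σ, x)} = ⋃ n, {x | R.StopsAt o θ n (σ, x)} := by ext; simp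
    rw [this]
    exact .iUnion fun n => (measurable_const.prodMk measurable_id)
      (measurableSet_stopsAt hreg.measurable_out hreg.preserving.measurable n)
  exact (prob_compl_eq_zero_iff hm).2 this

theorem IsFresh.lintegral_final {μ : Measure Ξ} [IsProbabilityMeasure μ] {V : Set St}
    (hR : R.IsFresh μ (μ.map o) V) (hreg : IsRegenerative μ o θ) {σ : St} (hσ : σ ∈ V)
    (h1 : ∀ᵐ x ∂μ, ∃ n, R.StopsAt o θ n (σ, x)) {f : E → ℝ≥0∞} (hf : Measurable f)
    {B : Set Ξ} (hB : MeasurableSet B) :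
    ∫⁻ x, f (R.final o θ (σ, x)).1 * B.indicator 1 (R.final o θ (σ, x)).2 ∂μ =
    (∑' n, R.weight (μ.map o) f n σ) * μ B := by
  have h2 : ∀ᵐ x ∂μ, x ∈ {x | ∃ n, R.StopsAt o θ n (σ, x)} := h1
  rw [← hR.tsum_weight hreg hf hB hσ, Measure.restrict_eq_self_of_ae_mem h2]

/-- The factor `μ B` separates from the weight of the output, and `B = univ` identifies this weight
with the probability of the output event. Thus the construction can be stacked: a run of a
regenerative step up to a fresh stopping is itself a regenerative step. -/
theorem IsFresh.isRegenerative_final {μ : Measure Ξ} [IsProbabilityMeasure μ] {V : Set St}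
    (hR : R.IsFresh μ (μ.map o) V) (hreg : IsRegenerative μ o θ) {σ : St} (hσ : σ ∈ V)
    (h1 : ∀ᵐ x ∂μ, ∃ n, R.StopsAt o θ n (σ, x)) :
    IsRegenerative μ (fun x => (R.final o θ (σ, x)).1) (fun x => (R.final o θ (σ, x)).2) := by
  have hfin := (measurable_final (R := R) hreg.measurable_out hreg.preserving.measurable).comp
    (measurable_const.prodMk measurable_id : Measurable fun x : Ξ => (σ, x))
  have m1 : Measurable fun x => (R.final o θ (σ, x)).1 := measurable_fst.comp hfin
  have m2 : Measurable fun x => (R.final o θ (σ, x)).2 := measurable_snd.comp hfin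
  refine .of_measure_inter m1 m2 fun A B hA hB => ?_
  have hAm : Measurable (A.indicator (1 : E → ℝ≥0∞)) := measurable_one.indicator hA
  have e1 := hR.lintegral_final hreg hσ h1 hAm hB
  have e2 := hR.lintegral_final hreg hσ h1 hAm .univ
  have e3 : ∫⁻ x, A.indicator 1 (R.final o θ (σ, x)).1 ∂μ =
      μ ((fun x => (R.final o θ (σ, x)).1) ⁻¹' A) := by
    rw [← lintegral_indicator_one (m1 hA)]; rfl
  have e4 : ∫⁻ x, A.indicator 1 (R.final o θ (σ, x)).1 * B.indicator 1 (R.final o θ (σ, x)).2 ∂μ =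
      μ ((fun x => (R.final o θ (σ, x)).1) ⁻¹' A ∩ (fun x => (R.final o θ (σ, x)).2) ⁻¹' B) := by
    rw [← lintegral_indicator_one ((m1 hA).inter (m2 hB)), Set.inter_indicator_one]; rfl
  simp only [Set.indicator_univ, Pi.one_apply, mul_one, measure_univ] at e2
  rw [e4] at e1
  rw [e1, ← e2, e3]

end StoppingRule

/-! ### Exponential distribution -/

theorem lintegral_expMeasure {r : ℝ} {f : ℝ → ℝ≥0∞} (hf : Measurable f) :
    ∫⁻ x, f x ∂(expMeasure r) = ∫⁻ x in Set.Ici 0, ENNReal.ofReal (r * Real.exp (-(r * x))) * f x := by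
  have h : expMeasure r = volume.withDensity (exponentialPDF r) := rfl
  rw [h, lintegral_withDensity_eq_lintegral_mul _
    (show Measurable (exponentialPDF r) from (measurable_exponentialPDFReal r).ennreal_ofReal) hf, ← lintegral_indicator measurableSet_Ici]
  refine lintegral_congr fun x => ?_
  by_cases hx : 0 ≤ x
  · rw [Set.indicator_of_mem (by exact hx), Pi.mul_apply, exponentialPDF_of_nonneg hx]
  · rw [Set.indicator_of_notMem (by exact hx), Pi.mul_apply, exponentialPDF_of_neg (not_le.1 hx),
      zero_mul]

/-- The density at `x + w` is `exp (-r w)` times the density at `x`, so translating the integral by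
`w` pulls this factor out. -/
theorem expMeasure_memoryless {r w : ℝ} (hw : 0 ≤ w) {G : ℝ → ℝ≥0∞} (hG : Measurable G) :
    ∫⁻ x, (if w < x then G (x - w) else 0) ∂(expMeasure r) =
      ENNReal.ofReal (Real.exp (-(r * w))) * ∫⁻ x, G x ∂(expMeasure r) := by
  have hm : Measurable fun x : ℝ => if w < x then G (x - w) else 0 :=
    Measurable.ite measurableSet_Ioi (by fun_prop) measurable_const
  rw [lintegral_expMeasure hm, lintegral_expMeasure hG, ← lintegral_const_mul' _ _ (by simp),
    ← lintegral_indicator measurableSet_Ici, ← lintegral_indicator measurableSet_Ici,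
    ← lintegral_add_right_eq_self _ w]
  refine lintegral_congr_ae ?_
  -- After the translation one side requires `0 < x` and the other `0 ≤ x`.
  have : ∀ᵐ x : ℝ, x ≠ 0 := by simp [ae_iff]
  filter_upwards [this] with x hx
  rcases lt_or_gt_of_ne hx with h | h
  · rw [Set.indicator_of_notMem (s := Set.Ici 0) (a := x) (by simpa using h)]
    by_cases h0 : 0 ≤ x + w
    · rw [Set.indicator_of_mem (by exact h0), if_neg (by linarith), mul_zero]
    · rw [Set.indicator_of_notMem (by exact h0)]
  · rw [Set.indicator_of_mem (by simp; linarith), Set.indicator_of_mem (by simp; linarith),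
      if_pos (by linarith), ← mul_assoc, ← ENNReal.ofReal_mul (Real.exp_nonneg _), add_sub_cancel_right]
    congr 2
    rw [show -(r * (x + w)) = -(r * w) + -(r * x) by ring, Real.exp_add]
    ring

theorem expMeasure_Ioi {r w : ℝ} (hr : 0 < r) (hw : 0 ≤ w) :
    expMeasure r (Set.Ioi w) = ENNReal.ofReal (Real.exp (-(r * w))) := by
  have := isProbabilityMeasure_expMeasure hr
  have h := expMeasure_memoryless (r := r) hw (G := fun _ => 1) measurable_const
  rw [lintegral_const, measure_univ, mul_one, mul_one] at h
  rw [← h, ← lintegral_indicator_one measurableSet_Ioi]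
  rfl

theorem ae_expMeasure_pos {r : ℝ} : ∀ᵐ x ∂(expMeasure r), 0 < x := by
  rw [ae_iff, ← lintegral_indicator_one (by measurability),
    lintegral_expMeasure (measurable_one.indicator (by measurability)),
    ← lintegral_indicator measurableSet_Ici]
  refine (lintegral_congr_ae ?_).trans lintegral_zero
  have : ∀ᵐ x : ℝ, x ≠ 0 := by simp [ae_iff]
  filter_upwards [this] with x hx
  by_cases h : 0 ≤ x
  · have : 0 < x := lt_of_le_of_ne h hx.symm
    simp [this]
  · simp [h]

instance {r : ℝ} : NullSingletonClass (expMeasure r) := by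
  have h : expMeasure r = volume.withDensity (exponentialPDF r) := rfl
  rw [h]; infer_instance

/-! ### Sequences of independent marks -/

section Sequences

variable {E : Type*}

/-- The sequence with head `a` and tail `z`. -/
def seqCons (a : E) (z : ℕ → E) : ℕ → E
  | 0 => a
  | n + 1 => z n

/-- The tail of a sequence. -/
def seqTail (z : ℕ → E) : ℕ → E := fun n => z (n + 1)

@[simp] theorem seqCons_zero (a : E) (z : ℕ → E) : seqCons a z 0 = a := rfl
@[simp] theorem seqCons_succ (a : E) (z : ℕ → E) (n : ℕ) : seqCons a z (n + 1) = z n := rfl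
@[simp] theorem seqTail_seqCons (a : E) (z : ℕ → E) : seqTail (seqCons a z) = z := rfl
@[simp] theorem seqTail_apply (z : ℕ → E) (n : ℕ) : seqTail z n = z (n + 1) := rfl
@[simp] theorem seqCons_seqTail (z : ℕ → E) : seqCons (z 0) (seqTail z) = z := by
  funext n; cases n <;> rfl

variable [MeasurableSpace E]

theorem measurable_seqTail : Measurable (seqTail : (ℕ → E) → ℕ → E) :=
  measurable_pi_lambda _ fun n => measurable_pi_apply (n + 1)

theorem measurable_seqCons : Measurable fun p : E × (ℕ → E) => seqCons p.1 p.2 := by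
  refine measurable_pi_lambda _ fun n => ?_
  cases n with
  | zero => exact measurable_fst
  | succ n => exact (measurable_pi_apply n).comp measurable_snd

variable (m : Measure E) [IsProbabilityMeasure m]

/-- The law of a sequence of independent random variables with law `m`. -/
abbrev iidLaw : Measure (ℕ → E) := Measure.infinitePi fun _ => m

/-- A product law is determined by finite boxes. Enlarging the index set to an initial segment, with
`univ` in the new coordinates, makes coordinate 0 split off and the others shift by one. -/
theorem map_seqCons : (m.prod (iidLaw m)).map (fun p => seqCons p.1 p.2) = iidLaw m := by
  classical
  refine Measure.eq_infinitePi _ fun s t ht => ?_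
  obtain ⟨N, hN⟩ : ∃ N, s ⊆ Finset.range (N + 1) :=
    ⟨s.sup id, fun i hi => Finset.mem_range_succ_iff.2 (Finset.le_sup (f := id) hi)⟩
  let u : ℕ → Set E := fun i => if i ∈ s then t i else Set.univ
  have hu : ∀ i, MeasurableSet (u i) := fun i => by
    by_cases h : i ∈ s
    · simpa [u, h] using ht i
    · simp [u, h]
  have h1 : Set.pi (s : Set ℕ) t = Set.pi (Finset.range (N + 1) : Set ℕ) u := by
    ext z
    simp only [Set.mem_pi, Finset.mem_coe]
    refine ⟨fun h i _ => ?_, fun h i hi => ?_⟩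
    · by_cases hi : i ∈ s
      · simpa [u, hi] using h i hi
      · simp [u, hi]
    · simpa [u, hi] using h i (hN hi)
  have h2 : ∏ i ∈ s, m (t i) = ∏ i ∈ Finset.range (N + 1), m (u i) := by
    rw [← Finset.prod_subset hN (f := fun i => m (u i))]
    · exact Finset.prod_congr rfl fun i hi => by simp [u, hi]
    · intro i _ hi; simp [u, hi]
  have h3 : (fun p : E × (ℕ → E) => seqCons p.1 p.2) ⁻¹'
      Set.pi (Finset.range (N + 1) : Set ℕ) u =
      u 0 ×ˢ Set.pi (Finset.range N : Set ℕ) (fun i => u (i + 1)) := by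
    ext ⟨a, z⟩
    simp only [Set.mem_preimage, Set.mem_pi, Finset.mem_coe, Finset.mem_range, Set.mem_prod]
    refine ⟨fun h => ⟨h 0 (by omega), fun i hi => h (i + 1) (by omega)⟩, fun h i hi => ?_⟩
    cases i with
    | zero => exact h.1
    | succ i => exact h.2 i (by omega)
  rw [h1, h2, Measure.map_apply measurable_seqCons
    (MeasurableSet.pi (Finset.countable_toSet _) fun i _ => hu i), h3, Measure.prod_prod,
    Measure.infinitePi_pi _ fun i _ => hu _, Finset.prod_range_succ', mul_comm]

theorem isRegenerative_seqTail :
    IsRegenerative (iidLaw m) (fun z => z 0) (seqTail : (ℕ → E) → ℕ → E) := by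
  refine .of_measure_inter (measurable_pi_apply 0) measurable_seqTail fun A B hA hB => ?_
  have h : ∀ B, MeasurableSet B → (iidLaw m) ((fun z : ℕ → E => z 0) ⁻¹' A ∩ seqTail ⁻¹' B) =
      m A * iidLaw m B := fun B hB => by
    conv_lhs => rw [← map_seqCons]
    rw [Measure.map_apply measurable_seqCons
      ((measurable_pi_apply 0 hA).inter (measurable_seqTail hB)), ← Measure.prod_prod]
    rfl
  have h2 := h _ .univ
  rw [Set.preimage_univ, Set.inter_univ, measure_univ, mul_one] at h2
  rw [h B hB, h2]

theorem map_head_iidLaw : (iidLaw m).map (fun z => z 0) = m :=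
  Measure.infinitePi_map_eval (fun _ => m) 0

theorem lintegral_seqCons {F : (ℕ → E) → ℝ≥0∞} (hF : Measurable F) :
    ∫⁻ a, ∫⁻ z, F (seqCons a z) ∂(iidLaw m) ∂m = ∫⁻ z, F z ∂(iidLaw m) := by
  conv_rhs => rw [← map_seqCons, lintegral_map hF measurable_seqCons]
  exact (lintegral_prod _ (hF.comp measurable_seqCons).aemeasurable).symm

end Sequences

/-! ### Threshold rules for the packets of one source -/

/-- Sequences of pairs (interarrival time, service time). -/
abbrev Marks := ℕ → ℝ × ℝ

/-- The law of a pair (interarrival time, service time). -/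
abbrev markLaw (r : ℝ) (ν : Measure ℝ) : Measure (ℝ × ℝ) := (expMeasure r).prod ν

/-- The rule which stops at the first interarrival time above the current threshold and leaves the
excess over the threshold as the next interarrival time. -/
def thresholdRule {St E : Type*} [MeasurableSpace St] [MeasurableSpace E] (thr : St → ℝ)
    (nxt : St × (ℝ × ℝ) → St) (out : St → E) (hthr : Measurable thr) (hnxt : Measurable nxt)
    (hout : Measurable out) : StoppingRule St (ℝ × ℝ) Marks E where
  halt := {p | thr p.1 < p.2.1}
  next := nxt
  out p := out p.1
  res p := seqCons (p.2.1.1 - thr p.1, p.2.1.2) p.2.2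
  measurableSet_halt := measurableSet_lt (by fun_prop) (by fun_prop)
  measurable_next := hnxt
  measurable_out := by fun_prop
  measurable_res := measurable_seqCons.comp
    (f := fun p : St × (ℝ × ℝ) × Marks => ((p.2.1.1 - thr p.1, p.2.1.2), p.2.2)) (by fun_prop)

section Threshold

variable {St E : Type*} [MeasurableSpace St] [MeasurableSpace E] {thr : St → ℝ}
    {nxt : St × (ℝ × ℝ) → St} {out : St → E} {hthr : Measurable thr} {hnxt : Measurable nxt}
    {hout : Measurable out} {r : ℝ} {ν : Measure ℝ} [IsProbabilityMeasure ν]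

/-- Memorylessness in the interarrival coordinate with the independent service time held fixed:
beyond the threshold, the pair (excess, service time) is distributed as a new mark. -/
theorem lintegral_markLaw_halt (hr : 0 < r) {w : ℝ} (hw : 0 ≤ w) {G : ℝ × ℝ → ℝ≥0∞}
    (hG : Measurable G) :
    ∫⁻ a, (if w < a.1 then G (a.1 - w, a.2) else 0) ∂(markLaw r ν) =
      ENNReal.ofReal (Real.exp (-(r * w))) * ∫⁻ a, G a ∂(markLaw r ν) := by
  have := isProbabilityMeasure_expMeasure hr
  have hm : Measurable fun a : ℝ × ℝ => if w < a.1 then G (a.1 - w, a.2) else 0 :=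
    Measurable.ite (measurableSet_lt measurable_const measurable_fst) (by fun_prop)
      measurable_const
  rw [lintegral_prod_symm' _ hm, lintegral_prod_symm' _ hG, ← lintegral_const_mul' _ _ (by simp)]
  refine lintegral_congr fun y => ?_
  exact expMeasure_memoryless hw (G := fun x => G (x, y)) (by fun_prop)

theorem thresholdRule_weight_zero (hr : 0 < r) (f : E → ℝ≥0∞) {σ : St} (hσ : 0 ≤ thr σ) :
    (thresholdRule thr nxt out hthr hnxt hout).weight (markLaw r ν) f 0 σ =
      ENNReal.ofReal (Real.exp (-(r * thr σ))) * f (out σ) := by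
  have := isProbabilityMeasure_expMeasure hr
  have := lintegral_markLaw_halt (ν := ν) hr hσ (G := fun _ => f (out σ)) measurable_const
  rw [lintegral_const, measure_univ, mul_one] at this
  rw [← this, StoppingRule.weight]
  refine lintegral_congr fun a => ?_
  by_cases h : thr σ < a.1
  · rw [if_pos (by exact h), if_pos h]
    rfl
  · rw [if_neg (by exact h), if_neg h]

theorem thresholdRule_weight_succ (hr : 0 < r) {f : E → ℝ≥0∞} (hf : Measurable f) (n : ℕ) (σ : St) :
    (thresholdRule thr nxt out hthr hnxt hout).weight (markLaw r ν) f (n + 1) σ =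
      ∫⁻ x, (if x ≤ thr σ then ∫⁻ y, (thresholdRule thr nxt out hthr hnxt hout).weight
        (markLaw r ν) f n (nxt (σ, (x, y))) ∂ν else 0) ∂(expMeasure r) := by
  classical
  have := isProbabilityMeasure_expMeasure hr
  have hw := (thresholdRule thr nxt out hthr hnxt hout).measurable_weight
    (κ := markLaw r ν) hf n
  rw [StoppingRule.weight, lintegral_prod]
  · refine lintegral_congr fun x => ?_
    by_cases h : x ≤ thr σ
    · rw [if_pos h]
      refine lintegral_congr fun y => ?_
      rw [if_neg]
      · rfl
      · simpa [thresholdRule] using h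
    · rw [if_neg h]
      refine (lintegral_congr fun y => ?_).trans lintegral_zero
      rw [if_pos]
      simpa [thresholdRule] using h
  · refine (Measurable.ite ?_ measurable_const ?_).aemeasurable
    · exact (measurable_const.prodMk measurable_id)
        (thresholdRule thr nxt out hthr hnxt hout).measurableSet_halt
    · exact hw.comp ((thresholdRule thr nxt out hthr hnxt hout).measurable_next.comp
        (measurable_const.prodMk measurable_id))

/-- On halting, the excess over the threshold together with the untouched service time is a new
mark, independent of the unread tail, and prepending it gives a fresh sequence. Memorylessness needs
nonnegative thresholds, which `hV` preserves along the run. -/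
theorem thresholdRule_isFresh (hr : 0 < r)
    (hV : ∀ σ, 0 ≤ thr σ → ∀ᵐ a ∂(markLaw r ν), a.1 ≤ thr σ → 0 ≤ thr (nxt (σ, a)))
    [IsProbabilityMeasure (markLaw r ν)] :
    (thresholdRule thr nxt out hthr hnxt hout).IsFresh (iidLaw (markLaw r ν)) (markLaw r ν)
      {σ | 0 ≤ thr σ} := by
  classical
  refine ⟨fun σ hσ f hf B hB => ?_, fun σ hσ => ?_⟩
  · have h0 := thresholdRule_weight_zero (nxt := nxt) (hthr := hthr) (hnxt := hnxt) (hout := hout)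
      (ν := ν) hr f hσ
    rw [StoppingRule.weight] at h0
    rw [h0]
    have hBm : Measurable (B.indicator (1 : Marks → ℝ≥0∞)) := measurable_one.indicator hB
    have hG : Measurable fun a : ℝ × ℝ => ∫⁻ z, f (out σ) * B.indicator 1 (seqCons a z)
        ∂(iidLaw (markLaw r ν)) :=
      ((hBm.comp measurable_seqCons).const_mul _).lintegral_prod_right'
    have h1 := lintegral_markLaw_halt (ν := ν) hr hσ hG
    have h2 := lintegral_seqCons (markLaw r ν) (hBm.const_mul (f (out σ)))
    rw [lintegral_const_mul _ hBm, lintegral_indicator_one hB] at h2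
    rw [h2] at h1
    rw [mul_assoc, ← h1]
    refine lintegral_congr fun a => ?_
    by_cases h : thr σ < a.1
    · rw [if_pos h]
      refine lintegral_congr fun z => ?_
      exact if_pos h
    · rw [if_neg h]
      refine (lintegral_congr fun z => ?_).trans lintegral_zero
      exact if_neg h
  · filter_upwards [hV σ hσ] with a ha h
    exact ha (not_lt.1 h)

end Threshold

/-! ### Residual packets of a source at a fixed time -/

/-- The rule which finds the first packet generated after time `t`, the state being the time left. -/
def residualRule : StoppingRule ℝ (ℝ × ℝ) Marks Unit :=
  thresholdRule id (fun p => p.1 - p.2.1) (fun _ => ()) measurable_id (by fun_prop) (by fun_prop)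

/-- Number of packets of the source generated up to time `t`. -/
def numBefore (t : ℝ) (z : Marks) : ℕ := residualRule.index (fun z => z 0) seqTail (t, z)

/-- The residual packets after time `t`. -/
def residual (t : ℝ) (z : Marks) : Marks := (residualRule.final (fun z => z 0) seqTail (t, z)).2

/-- Generation time of the packet `n`. -/
def genAt (z : Marks) (n : ℕ) : ℝ := ∑ k ∈ Finset.range (n + 1), (z k).1

theorem genAt_succ_eq (z : Marks) (n : ℕ) : genAt z (n + 1) = (z 0).1 + genAt (seqTail z) n := by
  simp only [genAt, seqTail]
  rw [Finset.sum_range_succ', add_comm]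

theorem genAt_succ (z : Marks) (n : ℕ) : genAt z (n + 1) = genAt z n + (z (n + 1)).1 := by
  simp only [genAt]
  rw [Finset.sum_range_succ]

@[simp] theorem genAt_zero (z : Marks) : genAt z 0 = (z 0).1 := by simp [genAt]

theorem measurable_genAt (n : ℕ) : Measurable fun z => genAt z n := by
  unfold genAt; fun_prop

theorem residualRule_stopsAt_iff {t : ℝ} {z : Marks} {n : ℕ} :
    residualRule.StopsAt (fun z => z 0) seqTail n (t, z) ↔
      (∀ k < n, genAt z k ≤ t) ∧ t < genAt z n := by
  induction n generalizing t z with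
  | zero => simp [StoppingRule.StopsAt, residualRule, thresholdRule]
  | succ n ih =>
    have : residualRule.StopsAt (fun z => z 0) seqTail (n + 1) (t, z) ↔
        (z 0).1 ≤ t ∧ residualRule.StopsAt (fun z => z 0) seqTail n (t - (z 0).1, seqTail z) := by
      simp [StoppingRule.StopsAt, residualRule, thresholdRule]
    rw [this, ih]
    constructor
    · rintro ⟨h0, h1, h2⟩
      refine ⟨fun k hk => ?_, by rw [genAt_succ_eq]; linarith⟩
      cases k with
      | zero => simpa using h0
      | succ k => rw [genAt_succ_eq]; linarith [h1 k (by omega)]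
    · rintro ⟨h1, h2⟩
      rw [genAt_succ_eq] at h2
      refine ⟨by simpa using h1 0 (by omega), fun k hk => ?_, by linarith⟩
      have := h1 (k + 1) (by omega)
      rw [genAt_succ_eq] at this
      linarith

theorem residualRule_value {t : ℝ} {z : Marks} (n : ℕ) :
    (residualRule.value (fun z => z 0) seqTail n (t, z)).2 =
      seqCons (genAt z n - t, (z n).2) (fun m => z (n + 1 + m)) := by
  induction n generalizing t z with
  | zero =>
    simp only [StoppingRule.value, residualRule, thresholdRule, genAt_zero, id]
    congr 1
    funext m; simp [seqTail, add_comm]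
  | succ n ih =>
    have : residualRule.value (fun z => z 0) seqTail (n + 1) (t, z) =
        residualRule.value (fun z => z 0) seqTail n (t - (z 0).1, seqTail z) := rfl
    rw [this, ih, genAt_succ_eq]
    congr 1
    · simp only [seqTail]; congr 1; ring
    · funext m; simp only [seqTail]; congr 1; ring

theorem numBefore_spec {t : ℝ} {z : Marks} (h : ∃ n, t < genAt z n) :
    (∀ k < numBefore t z, genAt z k ≤ t) ∧ t < genAt z (numBefore t z) := by
  classical
  have h1 : residualRule.StopsAt (fun z => z 0) seqTail (Nat.find h) (t, z) :=
    residualRule_stopsAt_iff.2 ⟨fun k hk => not_lt.1 (Nat.find_min h hk), Nat.find_spec h⟩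
  rw [numBefore, h1.index_eq]
  exact residualRule_stopsAt_iff.1 h1

theorem residual_eq (t : ℝ) (z : Marks) :
    residual t z = seqCons (genAt z (numBefore t z) - t, (z (numBefore t z)).2)
      (fun m => z (numBefore t z + 1 + m)) := residualRule_value _

theorem residual_of_le {t : ℝ} {z : Marks} (h : ∃ n, t < genAt z n) (h0 : (z 0).1 ≤ t) :
    residual t z = residual (t - (z 0).1) (seqTail z) := by
  classical
  have h1 := numBefore_spec h
  have h2 := residualRule_stopsAt_iff.2 h1
  obtain ⟨n, hn⟩ : ∃ n, numBefore t z = n + 1 := Nat.exists_eq_succ_of_ne_zero fun h' => by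
    rw [h', genAt_zero] at h1; linarith [h1.2]
  rw [hn] at h2
  have h3 : residualRule.StopsAt (fun z => z 0) seqTail n (t - (z 0).1, seqTail z) := h2.2
  rw [residual, residual, h2.final_eq, h3.final_eq]
  rfl

theorem residual_of_lt {t : ℝ} {z : Marks} (h0 : t < (z 0).1) :
    residual t z = seqCons ((z 0).1 - t, (z 0).2) (seqTail z) := by
  have h2 : residualRule.StopsAt (fun z => z 0) seqTail 0 (t, z) := h0
  rw [residual, h2.final_eq]
  rfl

theorem measurable_residual : Measurable fun p : ℝ × Marks => residual p.1 p.2 :=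
  measurable_snd.comp (StoppingRule.measurable_final (measurable_pi_apply 0) measurable_seqTail)

/-! ### Law of the residual packets -/

section

variable {r : ℝ} {ν : Measure ℝ} [IsProbabilityMeasure ν]

theorem isProbabilityMeasure_markLaw (hr : 0 < r) : IsProbabilityMeasure (markLaw r ν) := by
  have := isProbabilityMeasure_expMeasure hr
  infer_instance

/-- Arrivals do not accumulate: with `c = E[exp (-x)] < 1` for an interarrival time `x`, the
expectation of `exp (-genAt z n)` is `c ^ (n + 1)`, so the sum over `n` has finite expectation.
Almost surely its terms tend to 0, that is, the generation times are unbounded. -/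
theorem ae_exists_lt_genAt (hr : 0 < r) [IsProbabilityMeasure (markLaw r ν)] :
    ∀ᵐ z ∂(iidLaw (markLaw r ν)), ∀ t, ∃ n, t < genAt z n := by
  have hreg := isRegenerative_seqTail (markLaw r ν)
  have := isProbabilityMeasure_expMeasure hr
  set c : ℝ≥0∞ := ∫⁻ x, ENNReal.ofReal (Real.exp (-x)) ∂(expMeasure r) with hc
  have hc1 : c < 1 := by
    have h1 : ∀ᵐ x ∂(expMeasure r), ENNReal.ofReal (Real.exp (-x)) < 1 := by
      filter_upwards [ae_expMeasure_pos] with x hx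
      rw [← ENNReal.ofReal_one]
      exact (ENNReal.ofReal_lt_ofReal_iff one_pos).2 (Real.exp_zero ▸ Real.exp_lt_exp.2 (by linarith))
    have h2 := lintegral_strict_mono (μ := expMeasure r) (f := fun x => ENNReal.ofReal (Real.exp (-x)))
      (g := fun _ => 1) (IsProbabilityMeasure.ne_zero _) (by fun_prop) ?_ h1
    · simpa using h2
    · refine ne_of_lt (lt_of_le_of_lt (lintegral_mono_ae (h1.mono fun x hx => hx.le)) ?_)
      simp
  have hF : ∀ n, ∫⁻ z, ENNReal.ofReal (Real.exp (-genAt z n)) ∂(iidLaw (markLaw r ν)) =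
      c ^ (n + 1) := by
    intro n
    have hm : ∀ n, Measurable fun z : Marks => ENNReal.ofReal (Real.exp (-genAt z n)) := fun n =>
      (Real.measurable_exp.comp (measurable_genAt n).neg).ennreal_ofReal
    have h0 : ∫⁻ a : ℝ × ℝ, ENNReal.ofReal (Real.exp (-a.1)) ∂(markLaw r ν) = c := by
      rw [lintegral_prod _ (by fun_prop)]
      simp [hc]
    induction n with
    | zero =>
      simp only [genAt_zero, zero_add, pow_one]
      rw [← h0, ← lintegral_map (f := fun a : ℝ × ℝ => ENNReal.ofReal (Real.exp (-a.1)))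
        (g := fun z : Marks => z 0) (by fun_prop) (by fun_prop), map_head_iidLaw]
    | succ n ih =>
      have := hreg.lintegral_eq (F := fun p => ENNReal.ofReal (Real.exp (-p.1.1)) *
        ENNReal.ofReal (Real.exp (-genAt p.2 n))) (by
          exact (by fun_prop : Measurable fun p : (ℝ × ℝ) × Marks =>
            ENNReal.ofReal (Real.exp (-p.1.1))).mul ((hm n).comp measurable_snd))
      rw [map_head_iidLaw] at this
      simp only [lintegral_const_mul _ (hm n), ih] at this
      rw [lintegral_mul_const _ (by fun_prop), h0, ← pow_succ'] at this
      rw [← this]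
      refine lintegral_congr fun z => ?_
      rw [genAt_succ_eq, neg_add, Real.exp_add, ENNReal.ofReal_mul (Real.exp_nonneg _)]
  have hsum : ∫⁻ z, ∑' n, ENNReal.ofReal (Real.exp (-genAt z n)) ∂(iidLaw (markLaw r ν)) ≠ ∞ := by
    rw [lintegral_tsum]
    · simp only [hF, pow_succ]
      rw [ENNReal.tsum_mul_right, ENNReal.tsum_geometric]
      refine ENNReal.mul_ne_top ?_ (hc1.trans ENNReal.one_lt_top).ne
      rw [ne_eq, ENNReal.inv_eq_top, tsub_eq_zero_iff_le, not_le]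
      exact hc1
    · exact fun n => (Real.measurable_exp.comp (measurable_genAt n).neg).ennreal_ofReal.aemeasurable
  have hae := ae_lt_top (.tsum fun n =>
    (Real.measurable_exp.comp (measurable_genAt n).neg).ennreal_ofReal) hsum
  filter_upwards [hae] with z hz t
  have h1 := ENNReal.tendsto_atTop_zero_of_tsum_ne_top hz.ne
  have h2 : ∀ᶠ n in atTop, ENNReal.ofReal (Real.exp (-genAt z n)) < ENNReal.ofReal (Real.exp (-t)) :=
    h1.eventually (gt_mem_nhds (by simp [Real.exp_pos]))
  obtain ⟨n, hn⟩ := h2.exists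
  refine ⟨n, ?_⟩
  have := (ENNReal.ofReal_lt_ofReal_iff (Real.exp_pos _)).1 hn
  have := Real.exp_lt_exp.1 this
  linarith

theorem residualRule_isFresh (hr : 0 < r) [IsProbabilityMeasure (markLaw r ν)] :
    residualRule.IsFresh (iidLaw (markLaw r ν)) (markLaw r ν) {t | 0 ≤ t} :=
  thresholdRule_isFresh hr fun t _ => .of_forall fun a ha => by
    simp only [id] at ha ⊢; linarith

theorem map_residual (hr : 0 < r) [IsProbabilityMeasure (markLaw r ν)] {t : ℝ} (ht : 0 ≤ t) :
    MeasurePreserving (residual t) (iidLaw (markLaw r ν)) (iidLaw (markLaw r ν)) := by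
  have hreg := isRegenerative_seqTail (markLaw r ν)
  have hf : residualRule.IsFresh (iidLaw (markLaw r ν))
      ((iidLaw (markLaw r ν)).map (fun z => z 0)) {t | 0 ≤ t} := by
    rw [map_head_iidLaw]
    exact residualRule_isFresh hr
  have h1 : ∀ᵐ z ∂(iidLaw (markLaw r ν)),
      ∃ n, residualRule.StopsAt (fun z => z 0) seqTail n (t, z) := by
    filter_upwards [ae_exists_lt_genAt (ν := ν) hr] with z hz
    exact ⟨_, residualRule_stopsAt_iff.2 (numBefore_spec (hz t))⟩
  exact (hf.isRegenerative_final (σ := t) hreg ht h1).preserving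

/-- On the event that there is no packet up to time `w`, the residual packets after time `t ≥ w`
are a fresh copy of the original ones. -/
theorem map_residual_restrict (hr : 0 < r) [IsProbabilityMeasure (markLaw r ν)] {w t : ℝ}
    (hw : 0 ≤ w) (ht : w ≤ t) :
    ((iidLaw (markLaw r ν)).restrict {z | w < (z 0).1}).map (residual t) =
      ENNReal.ofReal (Real.exp (-(r * w))) • iidLaw (markLaw r ν) := by
  have hmr : ∀ u, Measurable (residual u) := fun u =>
    measurable_residual.comp (measurable_const.prodMk measurable_id)
  have hS : MeasurableSet {z : Marks | w < (z 0).1} :=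
    measurableSet_lt measurable_const (by fun_prop)
  ext B hB
  have hBm : Measurable (B.indicator (1 : Marks → ℝ≥0∞)) := measurable_one.indicator hB
  have hI : Measurable fun z => B.indicator (1 : Marks → ℝ≥0∞) (residual (t - w) z) :=
    hBm.comp (hmr _)
  have hJ : ∫⁻ z, B.indicator (1 : Marks → ℝ≥0∞) (residual (t - w) z) ∂(iidLaw (markLaw r ν)) =
      iidLaw (markLaw r ν) B := by
    rw [(map_residual hr (sub_nonneg.2 ht)).lintegral_comp hBm, lintegral_indicator_one hB]
  -- If nothing comes up to time `w`, cutting `w` off the first interarrival time shifts all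
  -- generation times by `w`, so looking from `t` is looking from `t - w` into the shortened
  -- sequence. The shortened sequence is fresh, and `residual (t - w)` preserves its law.
  have hpath : ∀ᵐ z ∂(iidLaw (markLaw r ν)), w < (z 0).1 →
      residual t z = residual (t - w) (seqCons ((z 0).1 - w, (z 0).2) (seqTail z)) := by
    filter_upwards [ae_exists_lt_genAt (ν := ν) hr] with z hz hwz
    set z' := seqCons ((z 0).1 - w, (z 0).2) (seqTail z) with hz'
    have hg : ∀ n, genAt z' n = genAt z n - w := by
      intro n
      induction n with
      | zero => simp [hz']
      | succ n ih => rw [genAt_succ, ih, genAt_succ, hz']; simp; ring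
    by_cases h : (z 0).1 ≤ t
    · have h' : ∃ n, t - w < genAt z' n := by
        obtain ⟨n, hn⟩ := hz t
        exact ⟨n, by rw [hg]; linarith⟩
      rw [residual_of_le (hz t) h, residual_of_le h' (by simpa [hz'] using h)]
      simp [hz']
    · rw [not_le] at h
      rw [residual_of_lt h, residual_of_lt]
      · simp [hz']
      · simpa [hz'] using h
  rw [Measure.map_apply (hmr t) hB, Measure.restrict_apply (hmr t hB), Measure.smul_apply,
    smul_eq_mul, ← hJ, ← lintegral_seqCons _ hI, ← lintegral_markLaw_halt hr hw
      (show Measurable fun a : ℝ × ℝ => ∫⁻ y, B.indicator (1 : Marks → ℝ≥0∞)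
        (residual (t - w) (seqCons a y)) ∂(iidLaw (markLaw r ν)) from
        (hI.comp measurable_seqCons).lintegral_prod_right'),
    ← lintegral_indicator_one ((hmr t hB).inter hS)]
  have hreg := isRegenerative_seqTail (markLaw r ν)
  have hmF : Measurable fun p : (ℝ × ℝ) × Marks => if w < p.1.1 then
      B.indicator (1 : Marks → ℝ≥0∞) (residual (t - w) (seqCons (p.1.1 - w, p.1.2) p.2)) else 0 := by
    refine Measurable.ite (measurableSet_lt measurable_const (by fun_prop)) ?_ measurable_const
    exact hI.comp (measurable_seqCons.comp
      (f := fun p : (ℝ × ℝ) × Marks => ((p.1.1 - w, p.1.2), p.2)) (by fun_prop))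
  have := hreg.lintegral_eq hmF
  rw [map_head_iidLaw] at this
  refine Eq.trans ?_ (this.trans ?_)
  · refine lintegral_congr_ae ?_
    filter_upwards [hpath] with z hz
    by_cases h : w < (z 0).1
    · simp only [if_pos h]
      rw [← hz h]
      by_cases h' : residual t z ∈ B
      · rw [Set.indicator_of_mem (by exact ⟨h', h⟩), Set.indicator_of_mem h']
        rfl
      · rw [Set.indicator_of_notMem (by exact fun h'' => h' h''.1), Set.indicator_of_notMem h']
    · simp only [if_neg h]
      rw [Set.indicator_of_notMem (by exact fun h'' => h h''.2)]
  · refine lintegral_congr fun a => ?_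
    by_cases h : w < a.1
    · simp [h]
    · simp [h]

end

/-! ### The busy period of one source -/

/-- The rule which runs the service of a source until a packet is delivered; the state consists of
the generation time and the service time of the packet in service. -/
def trialRule : StoppingRule (ℝ × ℝ) (ℝ × ℝ) Marks (ℝ × ℝ) :=
  thresholdRule (fun σ => σ.2) (fun p => (p.1.1 + p.2.1, p.2.2)) (fun σ => (σ.1 + σ.2, σ.2))
    (by fun_prop) (by fun_prop) (by fun_prop)

/-- The delivery happens for the packet `trialIndex z`. -/
def trialIndex (z : Marks) : ℕ := trialRule.index (fun z => z 0) seqTail (z 0, seqTail z)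

/-- Delivery time and system time of the first delivered packet and the residual packets, if the
source is alone. -/
def busy (z : Marks) : (ℝ × ℝ) × Marks := trialRule.final (fun z => z 0) seqTail (z 0, seqTail z)

/-- Some packet is delivered if the source is alone. -/
def HasDelivery (z : Marks) : Prop := ∃ n, trialRule.StopsAt (fun z => z 0) seqTail n (z 0, seqTail z)

theorem trialRule_stopsAt_iff {a : ℝ × ℝ} {z : Marks} {n : ℕ} :
    trialRule.StopsAt (fun z => z 0) seqTail n (a, z) ↔
      (∀ k < n, (seqCons a z (k + 1)).1 ≤ (seqCons a z k).2) ∧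
        (seqCons a z n).2 < (seqCons a z (n + 1)).1 := by
  induction n generalizing a z with
  | zero => simp [StoppingRule.StopsAt, trialRule, thresholdRule]
  | succ n ih =>
    have : trialRule.StopsAt (fun z => z 0) seqTail (n + 1) (a, z) ↔
        (z 0).1 ≤ a.2 ∧
          trialRule.StopsAt (fun z => z 0) seqTail n ((a.1 + (z 0).1, (z 0).2), seqTail z) := by
      simp [StoppingRule.StopsAt, trialRule, thresholdRule]
    have h2 : ∀ k, (seqCons (a.1 + (z 0).1, (z 0).2) (seqTail z) k).2 = (z k).2 := fun k => by
      cases k <;> rfl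
    rw [this, ih]
    simp only [h2, seqCons_succ, seqTail_apply]
    constructor
    · rintro ⟨h0, h1, h2⟩
      refine ⟨fun k hk => ?_, h2⟩
      cases k with
      | zero => exact h0
      | succ k => exact h1 k (by omega)
    · rintro ⟨h1, h2⟩
      exact ⟨h1 0 (by omega), fun k hk => h1 (k + 1) (by omega), h2⟩

theorem trialRule_value {a : ℝ × ℝ} {z : Marks} (n : ℕ) :
    trialRule.value (fun z => z 0) seqTail n (a, z) =
      ((genAt (seqCons a z) n + (seqCons a z n).2, (seqCons a z n).2),
        seqCons ((seqCons a z (n + 1)).1 - (seqCons a z n).2, (seqCons a z (n + 1)).2)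
          (fun m => seqCons a z (n + 2 + m))) := by
  induction n generalizing a z with
  | zero =>
    simp only [StoppingRule.value, trialRule, thresholdRule, genAt_zero, seqCons_zero, seqCons_succ]
    congr 2
    funext m
    rw [show 0 + 2 + m = (m + 1) + 1 by ring]
    rfl
  | succ n ih =>
    have : trialRule.value (fun z => z 0) seqTail (n + 1) (a, z) =
        trialRule.value (fun z => z 0) seqTail n ((a.1 + (z 0).1, (z 0).2), seqTail z) := rfl
    have h2 : ∀ k, (seqCons (a.1 + (z 0).1, (z 0).2) (seqTail z) k).2 = (z k).2 := fun k => by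
      cases k <;> rfl
    have hg : ∀ k, genAt (seqCons (a.1 + (z 0).1, (z 0).2) (seqTail z)) k =
        genAt (seqCons a z) (k + 1) := by
      intro k
      induction k with
      | zero => rw [genAt_succ]; simp
      | succ k ih => rw [genAt_succ, ih, genAt_succ _ (k + 1)]; rfl
    rw [this, ih, hg]
    simp only [h2, seqCons_succ, seqTail_apply]
    congr 2
    funext m
    rw [show n + 2 + m = (n + 1 + m) + 1 by ring, show n + 1 + 2 + m = (n + 1 + m) + 1 + 1 by ring]
    rfl

theorem HasDelivery.spec {z : Marks} (h : HasDelivery z) :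
    (∀ k < trialIndex z, (z (k + 1)).1 ≤ (z k).2) ∧
      (z (trialIndex z)).2 < (z (trialIndex z + 1)).1 := by
  obtain ⟨n, hn⟩ := h
  rw [trialIndex, hn.index_eq]
  simpa using trialRule_stopsAt_iff.1 hn

/-- The run starts with packet 0 in service, hence from the state `z 0` reading the tail. The
delivery falls inside the interarrival time which precedes packet `trialIndex z + 1`; what is left
of it becomes the first interarrival time of the residual packets. -/
theorem busy_eq (z : Marks) :
    busy z = ((genAt z (trialIndex z) + (z (trialIndex z)).2, (z (trialIndex z)).2),
        seqCons ((z (trialIndex z + 1)).1 - (z (trialIndex z)).2, (z (trialIndex z + 1)).2)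
          (fun m => z (trialIndex z + 2 + m))) := by
  have := trialRule_value (a := z 0) (z := seqTail z) (trialIndex z)
  simp only [seqCons_seqTail] at this
  exact this

theorem measurable_split : Measurable fun z : Marks => (z 0, seqTail z) :=
  (measurable_pi_apply 0).prodMk measurable_seqTail

theorem measurable_busy : Measurable busy :=
  (StoppingRule.measurable_final (measurable_pi_apply 0) measurable_seqTail).comp measurable_split

theorem measurableSet_hasDelivery : MeasurableSet {z | HasDelivery z} := by
  have : {z | HasDelivery z} = ⋃ n, (fun z : Marks => (z 0, seqTail z)) ⁻¹'
      {p | trialRule.StopsAt (fun z => z 0) seqTail n p} := by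
    ext; simp [HasDelivery]
  rw [this]
  exact .iUnion fun n => measurable_split
    (StoppingRule.measurableSet_stopsAt (measurable_pi_apply 0) measurable_seqTail n)

/-! ### Law of the first delivery of a source which is alone -/

section

variable {r : ℝ} {ν : Measure ℝ} [IsProbabilityMeasure ν]

omit [IsProbabilityMeasure ν] in
theorem ae_service_nonneg (hν : ∀ᵐ y ∂ν, 0 ≤ y) (hr : 0 < r) : ∀ᵐ a ∂(markLaw r ν), 0 ≤ a.2 := by
  have := isProbabilityMeasure_expMeasure hr
  exact Measure.quasiMeasurePreserving_snd.ae hν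

theorem trialRule_isFresh (hν : ∀ᵐ y ∂ν, 0 ≤ y) (hr : 0 < r)
    [IsProbabilityMeasure (markLaw r ν)] :
    trialRule.IsFresh (iidLaw (markLaw r ν)) (markLaw r ν) {σ | 0 ≤ σ.2} :=
  thresholdRule_isFresh hr fun _ _ => (ae_service_nonneg hν hr).mono fun _ ha _ => ha

/-- Laplace weight of a failed service attempt. -/
def failWeight (r : ℝ) (ν : Measure ℝ) (s : ℝ) : ℝ≥0∞ :=
  ∫⁻ y, ∫⁻ x, (if x ≤ y then ENNReal.ofReal (Real.exp (s * x)) else 0) ∂(expMeasure r) ∂ν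

/-- Laplace weight of a successful service attempt. -/
def successWeight (r : ℝ) (ν : Measure ℝ) (s : ℝ) (h : ℝ → ℝ≥0∞) : ℝ≥0∞ :=
  ∫⁻ y, ENNReal.ofReal (Real.exp ((s - r) * y)) * h y ∂ν

/-- Averaging over the service time in progress removes it from the state: a failure advances the
clock by some `x ≤ y` and draws a new service time, so every failure contributes one factor
`failWeight`. The function `h` of the system time enters only at the success, where the system time
is the service time of the surviving packet. -/
theorem lintegral_trialRule_weight (hν : ∀ᵐ y ∂ν, 0 ≤ y) (hr : 0 < r) (s : ℝ) {h : ℝ → ℝ≥0∞}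
    (hh : Measurable h) (n : ℕ) (b : ℝ) :
    ∫⁻ y, trialRule.weight (markLaw r ν) (fun d => ENNReal.ofReal (Real.exp (s * d.1)) * h d.2) n
      (b, y) ∂ν =
      ENNReal.ofReal (Real.exp (s * b)) * (failWeight r ν s ^ n * successWeight r ν s h) := by
  have := isProbabilityMeasure_expMeasure hr
  have hf : Measurable fun d : ℝ × ℝ => ENNReal.ofReal (Real.exp (s * d.1)) * h d.2 := by fun_prop
  induction n generalizing b with
  | zero =>
    rw [pow_zero, one_mul, successWeight, ← lintegral_const_mul _ (by fun_prop)]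
    refine lintegral_congr_ae ?_
    filter_upwards [hν] with y hy
    refine (thresholdRule_weight_zero hr _ hy).trans ?_
    rw [← mul_assoc, ← mul_assoc, ← ENNReal.ofReal_mul (Real.exp_nonneg _),
      ← ENNReal.ofReal_mul (Real.exp_nonneg _), ← Real.exp_add, ← Real.exp_add]
    congr 3
    ring
  | succ n ih =>
    have hw : Measurable (Function.uncurry fun y x : ℝ =>
        if x ≤ y then ENNReal.ofReal (Real.exp (s * x)) else 0) :=
      Measurable.ite (measurableSet_le (by fun_prop) (by fun_prop)) (by fun_prop) measurable_const
    have hw' : ∀ y : ℝ, Measurable fun x : ℝ =>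
        if x ≤ y then ENNReal.ofReal (Real.exp (s * x)) else 0 := fun y =>
      hw.comp (measurable_const.prodMk measurable_id)
    rw [pow_succ', mul_assoc]
    set K := failWeight r ν s ^ n * successWeight r ν s h
    rw [failWeight, mul_comm, ← lintegral_mul_const, ← lintegral_mul_const]
    · refine lintegral_congr fun y => ?_
      refine (thresholdRule_weight_succ hr hf n _).trans ?_
      rw [← lintegral_mul_const _ (hw' y), ← lintegral_mul_const _ ((hw' y).mul_const _)]
      refine lintegral_congr fun x => ?_
      split_ifs with hx
      · refine (ih (b + x)).trans ?_
        rw [mul_add, Real.exp_add, ENNReal.ofReal_mul (Real.exp_nonneg _)]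
        ring
      · simp
    · exact hw.lintegral_prod_right'.mul_const _
    · exact hw.lintegral_prod_right'

/-- The factor `φ (z 0)` is carried along because the race against the other sources will depend on
the first mark only. -/
theorem lintegral_busy_restrict (hν : ∀ᵐ y ∂ν, 0 ≤ y) (hr : 0 < r)
    [IsProbabilityMeasure (markLaw r ν)] {φ : ℝ × ℝ → ℝ≥0∞} (hφ : Measurable φ)
    {f : ℝ × ℝ → ℝ≥0∞} (hf : Measurable f) {B : Set Marks} (hB : MeasurableSet B) :
    ∫⁻ z in {z | HasDelivery z}, φ (z 0) * (f (busy z).1 * B.indicator 1 (busy z).2)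
        ∂(iidLaw (markLaw r ν)) =
      (∫⁻ a, φ a * ∑' n, trialRule.weight (markLaw r ν) f n a ∂(markLaw r ν)) *
        iidLaw (markLaw r ν) B := by
  have hreg := isRegenerative_seqTail (markLaw r ν)
  have hfr : trialRule.IsFresh (iidLaw (markLaw r ν))
      ((iidLaw (markLaw r ν)).map (fun z => z 0)) {σ | 0 ≤ σ.2} := by
    rw [map_head_iidLaw]
    exact trialRule_isFresh hν hr
  have hBm : Measurable (B.indicator (1 : Marks → ℝ≥0∞)) := measurable_one.indicator hB
  have hfin := StoppingRule.measurable_final (R := trialRule) (o := fun z : Marks => z 0)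
    (θ := seqTail) (measurable_pi_apply 0) measurable_seqTail
  have hst : MeasurableSet
      {p : (ℝ × ℝ) × Marks | ∃ n, trialRule.StopsAt (fun z => z 0) seqTail n p} := by
    have : {p : (ℝ × ℝ) × Marks | ∃ n, trialRule.StopsAt (fun z => z 0) seqTail n p} = ⋃ n,
        {p | trialRule.StopsAt (fun z => z 0) seqTail n p} := by ext; simp
    rw [this]
    exact .iUnion fun n =>
      StoppingRule.measurableSet_stopsAt (measurable_pi_apply 0) measurable_seqTail n
  have hF : Measurable fun p : (ℝ × ℝ) × Marks => φ p.1 *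
      {p : (ℝ × ℝ) × Marks | ∃ n, trialRule.StopsAt (fun z => z 0) seqTail n p}.indicator
        (fun p => f (trialRule.final (fun z => z 0) seqTail p).1 *
          B.indicator 1 (trialRule.final (fun z => z 0) seqTail p).2) p :=
    (hφ.comp measurable_fst).mul (((hf.comp (measurable_fst.comp hfin)).mul
      (hBm.comp (measurable_snd.comp hfin))).indicator hst)
  have h1 := hreg.lintegral_eq hF
  rw [map_head_iidLaw] at h1
  rw [← lintegral_indicator measurableSet_hasDelivery, ← lintegral_mul_const' _ _ (by simp)]
  refine Eq.trans ?_ (h1.trans ?_)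
  · refine lintegral_congr fun z => ?_
    by_cases h : HasDelivery z
    · rw [Set.indicator_of_mem (show z ∈ {z | HasDelivery z} from h), Set.indicator_of_mem
        (show (z 0, seqTail z) ∈ {p : (ℝ × ℝ) × Marks | ∃ n,
          trialRule.StopsAt (fun z => z 0) seqTail n p} from h)]
      rfl
    · rw [Set.indicator_of_notMem (show z ∉ {z | HasDelivery z} from h), Set.indicator_of_notMem
        (show (z 0, seqTail z) ∉ {p : (ℝ × ℝ) × Marks | ∃ n,
          trialRule.StopsAt (fun z => z 0) seqTail n p} from h), mul_zero]
  · refine lintegral_congr_ae ?_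
    filter_upwards [ae_service_nonneg hν hr] with a ha
    rw [mul_assoc]
    have h2 := hfr.tsum_weight hreg hf hB (σ := a) ha
    rw [map_head_iidLaw] at h2
    rw [← h2, lintegral_const_mul]
    · congr 1
      rw [← lintegral_indicator]
      · rfl
      · exact (measurable_const.prodMk measurable_id :
          Measurable fun z : Marks => (a, z)) hst
    · exact (((hf.comp (measurable_fst.comp hfin)).mul
        (hBm.comp (measurable_snd.comp hfin))).indicator hst).comp
        (measurable_const.prodMk measurable_id)

/-- Geometric series in the number of preempted packets. For `q` the total rate of the other
sources, `exp (-q x)` is the probability that they are all silent up to time `x`; it only alters the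
exponent of the idle time, and the service contributes `(1 - failWeight)⁻¹ * successWeight`. In
`ℝ≥0∞` this holds for every `s`, the inverse being `∞` when the series diverges. -/
theorem tsum_trialRule_weight (hν : ∀ᵐ y ∂ν, 0 ≤ y) (hr : 0 < r) (q s : ℝ) {h : ℝ → ℝ≥0∞}
    (hh : Measurable h) :
    ∫⁻ a, ENNReal.ofReal (Real.exp (-(q * a.1))) * ∑' n, trialRule.weight (markLaw r ν)
      (fun d => ENNReal.ofReal (Real.exp (s * d.1)) * h d.2) n a ∂(markLaw r ν) =
    (∫⁻ x, ENNReal.ofReal (Real.exp ((s - q) * x)) ∂(expMeasure r)) *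
      ((1 - failWeight r ν s)⁻¹ * successWeight r ν s h) := by
  have := isProbabilityMeasure_expMeasure hr
  have hf : Measurable fun d : ℝ × ℝ => ENNReal.ofReal (Real.exp (s * d.1)) * h d.2 := by fun_prop
  have hw : ∀ n, Measurable fun a : ℝ × ℝ => trialRule.weight (markLaw r ν)
      (fun d => ENNReal.ofReal (Real.exp (s * d.1)) * h d.2) n a := fun n =>
    StoppingRule.measurable_weight hf n
  have hts : Measurable fun a : ℝ × ℝ => ∑' n, trialRule.weight (markLaw r ν)
      (fun d => ENNReal.ofReal (Real.exp (s * d.1)) * h d.2) n a := .tsum hw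
  rw [lintegral_prod _ (by
    exact ((by fun_prop : Measurable fun a : ℝ × ℝ =>
      ENNReal.ofReal (Real.exp (-(q * a.1)))).mul hts).aemeasurable),
    ← lintegral_mul_const _ (by fun_prop)]
  refine lintegral_congr fun b => ?_
  dsimp only
  rw [lintegral_const_mul _ (show Measurable fun y => ∑' n, trialRule.weight (markLaw r ν)
      (fun d => ENNReal.ofReal (Real.exp (s * d.1)) * h d.2) n (b, y) from
      hts.comp (measurable_const.prodMk measurable_id)),
    lintegral_tsum fun n => show AEMeasurable (fun y => trialRule.weight (markLaw r ν)
      (fun d => ENNReal.ofReal (Real.exp (s * d.1)) * h d.2) n (b, y)) ν from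
      ((hw n).comp (measurable_const.prodMk measurable_id)).aemeasurable]
  simp only [lintegral_trialRule_weight hν hr s hh]
  rw [ENNReal.tsum_mul_left, ENNReal.tsum_mul_right, ENNReal.tsum_geometric, ← mul_assoc,
    ← ENNReal.ofReal_mul (Real.exp_nonneg _), ← Real.exp_add]
  congr 3
  ring

/-- At `s = 0` the weights are the probabilities that the next packet of the source does, or does
not, come within the service time. -/
theorem failWeight_zero_add (hν : ∀ᵐ y ∂ν, 0 ≤ y) (hr : 0 < r) :
    failWeight r ν 0 + successWeight r ν 0 (fun _ => 1) = 1 := by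
  have := isProbabilityMeasure_expMeasure hr
  rw [failWeight, successWeight, ← lintegral_add_right _ (by fun_prop)]
  refine (lintegral_congr_ae (g := fun _ => 1) ?_).trans (by simp)
  filter_upwards [hν] with y hy
  have h1 : ∫⁻ x, (if x ≤ y then ENNReal.ofReal (Real.exp (0 * x)) else 0) ∂(expMeasure r) =
      expMeasure r (Set.Iic y) := by
    rw [← lintegral_indicator_one measurableSet_Iic]
    refine lintegral_congr fun x => ?_
    by_cases hx : x ≤ y
    · simp [hx]
    · simp [hx]
  rw [h1, mul_one, zero_sub, neg_mul, ← expMeasure_Ioi hr hy, ← Set.compl_Iic]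
  exact prob_add_prob_compl measurableSet_Iic

/-- A function whose integral against the probability measure `ν` is zero has a zero somewhere, and
this integrand has none. -/
theorem successWeight_pos {s : ℝ} {h : ℝ → ℝ≥0∞} (hh : Measurable h) (h0 : ∀ y, h y ≠ 0) :
    successWeight r ν s h ≠ 0 := by
  rw [successWeight, ne_eq, lintegral_eq_zero_iff (by fun_prop)]
  intro h1
  obtain ⟨y, hy⟩ := h1.exists
  simp only [Pi.zero_apply, mul_eq_zero, ENNReal.ofReal_eq_zero, not_le.2 (Real.exp_pos _),
    false_or] at hy
  exact h0 y hy

theorem failWeight_zero_lt_one (hν : ∀ᵐ y ∂ν, 0 ≤ y) (hr : 0 < r) : failWeight r ν 0 < 1 := by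
  have h1 := failWeight_zero_add hν hr
  have h2 := successWeight_pos (r := r) (ν := ν) (s := 0) (h := fun _ => 1) measurable_const
    (by simp)
  refine lt_of_le_of_ne (h1 ▸ le_self_add) fun h => h2 ?_
  rw [h] at h1
  exact ENNReal.add_right_inj ENNReal.one_ne_top |>.1 (by rw [h1, add_zero])

/-- The total mass of the runs which stop is `(1 - F)⁻¹ * (1 - F)` with `F = failWeight r ν 0 < 1`.
-/
theorem ae_hasDelivery (hν : ∀ᵐ y ∂ν, 0 ≤ y) (hr : 0 < r) [IsProbabilityMeasure (markLaw r ν)] :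
    ∀ᵐ z ∂(iidLaw (markLaw r ν)), HasDelivery z := by
  have := isProbabilityMeasure_expMeasure hr
  have h1 := tsum_trialRule_weight (ν := ν) hν hr 0 0 (h := fun _ => 1) measurable_const
  have h2 := lintegral_busy_restrict (ν := ν) hν hr (φ := fun _ => 1) (f := fun _ => 1)
    measurable_const measurable_const .univ
  have h3 : failWeight r ν 0 ≠ ∞ := (failWeight_zero_lt_one hν hr).ne_top
  have h4 : successWeight r ν 0 (fun _ => 1) = 1 - failWeight r ν 0 :=
    ENNReal.eq_sub_of_add_eq h3 (by rw [add_comm, failWeight_zero_add hν hr])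
  have h5 : 1 - failWeight r ν 0 ≠ 0 := by
    rw [ne_eq, tsub_eq_zero_iff_le, not_le]; exact failWeight_zero_lt_one hν hr
  rw [h4, ENNReal.inv_mul_cancel h5 (by simp)] at h1
  simp only [zero_mul, neg_zero, Real.exp_zero, ENNReal.ofReal_one, mul_one, one_mul, sub_zero,
    lintegral_const, measure_univ] at h1
  simp only [one_mul, h1, Set.indicator_univ, Pi.one_apply, lintegral_const,
    Measure.restrict_apply_univ, measure_univ, mul_one] at h2
  exact (prob_compl_eq_zero_iff measurableSet_hasDelivery).2 h2

theorem lintegral_busy (hν : ∀ᵐ y ∂ν, 0 ≤ y) (hr : 0 < r)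
    [IsProbabilityMeasure (markLaw r ν)] {φ : ℝ × ℝ → ℝ≥0∞} (hφ : Measurable φ)
    {f : ℝ × ℝ → ℝ≥0∞} (hf : Measurable f) {B : Set Marks} (hB : MeasurableSet B) :
    ∫⁻ z, φ (z 0) * (f (busy z).1 * B.indicator 1 (busy z).2) ∂(iidLaw (markLaw r ν)) =
      (∫⁻ a, φ a * ∑' n, trialRule.weight (markLaw r ν) f n a ∂(markLaw r ν)) *
        iidLaw (markLaw r ν) B := by
  have h2 : ∀ᵐ z ∂(iidLaw (markLaw r ν)), z ∈ {z | HasDelivery z} := ae_hasDelivery hν hr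
  rw [← lintegral_busy_restrict hν hr hφ hf hB, Measure.restrict_eq_self_of_ae_mem h2]

end

/-! ### The cycle from an empty system to the first delivery -/

section Cycle

variable {ι : Type*}

/-- Source `j` generates the first packet. -/
def IsFirst (z : ι → Marks) (j : ι) : Prop := ∀ i, i ≠ j → (z j 0).1 < (z i 0).1

theorem IsFirst.unique {z : ι → Marks} {i j : ι} (hi : IsFirst z i) (hj : IsFirst z j) : i = j := by
  by_contra h
  exact lt_asymm (hi j (Ne.symm h)) (hj i h)

open Classical in
/-- The source of the first packet. -/
def firstSource [Nonempty ι] (z : ι → Marks) : ι :=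
  if h : ∃ j, IsFirst z j then h.choose else Classical.arbitrary ι

theorem IsFirst.firstSource_eq [Nonempty ι] {z : ι → Marks} {j : ι} (h : IsFirst z j) : firstSource z = j := by
  have h' : ∃ j, IsFirst z j := ⟨j, h⟩
  rw [firstSource, dif_pos h']
  exact h'.choose_spec.unique h

variable [Fintype ι] [Nonempty ι] [DecidableEq ι]

/-- Source, delivery time and system time of the first delivered packet. -/
def cycleOut (z : ι → Marks) : ι × (ℝ × ℝ) := (firstSource z, (busy (z (firstSource z))).1)

/-- The residual packets at the delivery of the first packet if its source is `j`. -/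
def restOf (j : ι) (z : ι → Marks) : ι → Marks :=
  Function.update (fun i => residual (busy (z j)).1.1 (z i)) j (busy (z j)).2

/-- The residual packets at the delivery of the first packet. -/
def cycleRest (z : ι → Marks) : ι → Marks := restOf (firstSource z) z

omit [Fintype ι] [Nonempty ι] [DecidableEq ι] in
theorem measurableSet_isFirst [Finite ι] (j : ι) : MeasurableSet {z : ι → Marks | IsFirst z j} := by
  have : {z : ι → Marks | IsFirst z j} = ⋂ i, ⋂ (_ : i ≠ j), {z | (z j 0).1 < (z i 0).1} := by
    ext; simp [IsFirst]
  rw [this]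
  refine .iInter fun i => .iInter fun _ => measurableSet_lt (by fun_prop) (by fun_prop)

omit [DecidableEq ι] in
theorem measurable_firstSource [MeasurableSpace ι] :
    Measurable (firstSource : (ι → Marks) → ι) := by
  refine measurable_to_countable' fun j => ?_
  by_cases hj : j = Classical.arbitrary ι
  · have : firstSource ⁻¹' {j} = {z | IsFirst z j} ∪ (⋃ i, {z : ι → Marks | IsFirst z i})ᶜ := by
      ext z
      simp only [Set.mem_preimage, Set.mem_singleton_iff, Set.mem_union, Set.mem_compl_iff,
        Set.mem_iUnion, Set.mem_ofPred_eq]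
      constructor
      · intro h
        by_cases h' : ∃ i, IsFirst z i
        · obtain ⟨i, hi⟩ := h'
          rw [hi.firstSource_eq] at h
          exact Or.inl (h ▸ hi)
        · exact Or.inr h'
      · rintro (h | h)
        · exact h.firstSource_eq
        · rw [firstSource, dif_neg h, hj]
    rw [this]
    exact (measurableSet_isFirst j).union (.compl (.iUnion fun i => measurableSet_isFirst i))
  · have : firstSource ⁻¹' {j} = {z | IsFirst z j} := by
      ext z
      simp only [Set.mem_preimage, Set.mem_singleton_iff, Set.mem_ofPred_eq]
      constructor
      · intro h
        by_cases h' : ∃ i, IsFirst z i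
        · obtain ⟨i, hi⟩ := h'
          rw [hi.firstSource_eq] at h
          exact h ▸ hi
        · rw [firstSource, dif_neg h'] at h
          exact absurd h.symm hj
      · exact fun h => h.firstSource_eq
    rw [this]
    exact measurableSet_isFirst j

omit [Fintype ι] [Nonempty ι] in
theorem measurable_restOf [Countable ι] (j : ι) : Measurable (restOf j : (ι → Marks) → ι → Marks) := by
  have hb : Measurable fun z : ι → Marks => busy (z j) := measurable_busy.comp (measurable_pi_apply j)
  refine measurable_pi_lambda _ fun i => ?_
  by_cases h : i = j
  · subst h
    simp only [restOf, Function.update_self]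
    exact measurable_snd.comp hb
  · simp only [restOf, Function.update_of_ne h]
    exact measurable_residual.comp
      ((measurable_fst.comp (measurable_fst.comp hb)).prodMk (measurable_pi_apply i))

theorem measurable_cycleRest [MeasurableSpace ι] [DiscreteMeasurableSpace ι] :
    Measurable (cycleRest : (ι → Marks) → ι → Marks) := by
  have h1 : Measurable fun p : ι × (ι → Marks) => restOf p.1 p.2 :=
    measurable_from_prod_countable_right fun j => measurable_restOf j
  have h2 : Measurable fun z : ι → Marks => (firstSource z, z) :=
    measurable_firstSource.prodMk measurable_id
  have h3 : (cycleRest : (ι → Marks) → ι → Marks) =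
      (fun p : ι × (ι → Marks) => restOf p.1 p.2) ∘ fun z => (firstSource z, z) := by
    funext z; rfl
  rw [h3]
  exact h1.comp h2

omit [DecidableEq ι] in
theorem measurable_cycleOut [MeasurableSpace ι] [DiscreteMeasurableSpace ι] :
    Measurable (cycleOut : (ι → Marks) → ι × (ℝ × ℝ)) := by
  have : Measurable fun p : ι × (ι → Marks) => (busy (p.2 p.1)).1 :=
    measurable_from_prod_countable_right fun j =>
      measurable_fst.comp (measurable_busy.comp (measurable_pi_apply j))
  exact measurable_firstSource.prodMk (this.comp (measurable_firstSource.prodMk measurable_id))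

/-! ### Law of one cycle -/

variable (lam : ι → ℝ) (ν : Measure ℝ) [IsProbabilityMeasure ν]
  [∀ j, IsProbabilityMeasure (markLaw (lam j) ν)]

/-- The law of the packets of all sources. -/
abbrev systemLaw : Measure (ι → Marks) := Measure.pi fun j => iidLaw (markLaw (lam j) ν)

-- Resampling one coordinate leaves a product law invariant. This serves as conditioning on source
-- `j`: its packets become a separate variable `ζ`, and Fubini may be applied.
omit [Nonempty ι] [IsProbabilityMeasure ν] in
theorem map_update_systemLaw (j : ι) :
    ((systemLaw lam ν).prod (iidLaw (markLaw (lam j) ν))).map (fun p => Function.update p.1 j p.2) =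
      systemLaw lam ν := by
  refine (Measure.pi_eq fun B hB => ?_).symm
  have h : (fun p : (ι → Marks) × Marks => Function.update p.1 j p.2) ⁻¹' Set.univ.pi B =
      Set.univ.pi (Function.update B j Set.univ) ×ˢ B j := by
    ext ⟨z, ζ⟩
    simp only [Set.mem_preimage, Set.mem_pi, Set.mem_univ, true_implies, Set.mem_prod]
    constructor
    · intro h
      refine ⟨fun i => ?_, by simpa using h j⟩
      by_cases hi : i = j
      · subst hi; simp
      · simpa [hi] using h i
    · rintro ⟨h1, h2⟩ i
      by_cases hi : i = j
      · subst hi; simpa using h2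
      · simpa [hi] using h1 i
  rw [Measure.map_apply measurable_update' (.univ_pi hB), h, Measure.prod_prod, Measure.pi_pi,
    ← Finset.prod_erase_mul _ _ (Finset.mem_univ j), ← Finset.prod_erase_mul _ _ (Finset.mem_univ j)]
  simp only [Function.update_self, measure_univ, mul_one]
  congr 1
  refine Finset.prod_congr rfl fun i hi => ?_
  rw [Function.update_of_ne (Finset.ne_of_mem_erase hi)]

omit [Nonempty ι] [IsProbabilityMeasure ν] in
theorem lintegral_update_systemLaw (j : ι) {F : (ι → Marks) → ℝ≥0∞} (hF : Measurable F) :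
    ∫⁻ z, ∫⁻ ζ, F (Function.update z j ζ) ∂(iidLaw (markLaw (lam j) ν)) ∂(systemLaw lam ν) =
      ∫⁻ z, F z ∂(systemLaw lam ν) := by
  conv_rhs => rw [← map_update_systemLaw lam ν j, lintegral_map hF measurable_update']
  exact (lintegral_prod _ (hF.comp measurable_update').aemeasurable).symm

variable {lam ν}

omit [Nonempty ι] in
/-- If no source except `j` generates a packet up to time `w`, then the residual packets of these
sources after time `t ≥ w` are fresh. -/
theorem lintegral_residual_others (hlam : ∀ j, 0 < lam j) (j : ι) {w t : ℝ} (hw : 0 ≤ w)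
    (ht : w ≤ t) {F : (ι → Marks) → ℝ≥0∞} (hF : Measurable F) (ζ : Marks) :
    ∫⁻ z in {z | ∀ i, i ≠ j → w < (z i 0).1},
        F (Function.update (fun i => residual t (z i)) j ζ) ∂(systemLaw lam ν) =
      ENNReal.ofReal (Real.exp (-((∑ i ∈ Finset.univ.erase j, lam i) * w))) *
        ∫⁻ z, F (Function.update z j ζ) ∂(systemLaw lam ν) := by
  -- Coordinate `j` is overwritten by `ζ` in the end, so it gets the identity, no constraint and the
  -- factor 1; every other source `i` contributes the factor `exp (-λ_i w)`.
  let G : ι → Marks → Marks := fun i => if i = j then id else residual t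
  let D : ι → Set Marks := fun i => if i = j then Set.univ else {z | w < (z 0).1}
  let c : ι → ℝ≥0∞ := fun i => if i = j then 1 else ENNReal.ofReal (Real.exp (-(lam i * w)))
  have hG : ∀ i, Measurable (G i) := fun i => by
    by_cases h : i = j
    · simp only [G, h, if_true]; exact measurable_id
    · simp only [G, h, if_false]
      exact measurable_residual.comp (measurable_const.prodMk measurable_id)
  have hmap : ∀ i, ((iidLaw (markLaw (lam i) ν)).restrict (D i)).map (G i) =
      c i • iidLaw (markLaw (lam i) ν) := fun i => by
    by_cases h : i = j
    · simp only [G, D, c, h, if_true, Measure.restrict_univ, Measure.map_id, one_smul]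
    · simp only [G, D, c, h, if_false]
      exact map_residual_restrict (hlam i) hw ht
  have hpi : ((systemLaw lam ν).restrict (Set.univ.pi D)).map (fun z i => G i (z i)) =
      (∏ i, c i) • systemLaw lam ν := by
    rw [Measure.restrict_pi_pi, Measure.pi_map_pi fun i => (hG i).aemeasurable]
    refine Measure.pi_eq fun B hB => ?_
    have h : ∀ i, ((iidLaw (markLaw (lam i) ν)).restrict (D i)).map (G i) (B i) =
        c i * iidLaw (markLaw (lam i) ν) (B i) := fun i => by rw [hmap i]; rfl
    rw [Measure.smul_apply, Measure.pi_pi, smul_eq_mul, ← Finset.prod_mul_distrib]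
    exact Finset.prod_congr rfl fun i _ => (h i).symm
  have hc : ∏ i, c i = ENNReal.ofReal (Real.exp (-((∑ i ∈ Finset.univ.erase j, lam i) * w))) := by
    rw [← Finset.prod_erase_mul _ _ (Finset.mem_univ j), Finset.sum_mul, ← Finset.sum_neg_distrib,
      Real.exp_sum, ENNReal.ofReal_prod_of_nonneg fun _ _ => Real.exp_nonneg _]
    simp only [c, if_true, mul_one]
    exact Finset.prod_congr rfl fun i hi => by rw [if_neg (Finset.ne_of_mem_erase hi)]
  have hD : {z : ι → Marks | ∀ i, i ≠ j → w < (z i 0).1} = Set.univ.pi D := by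
    ext z
    simp only [Set.mem_ofPred_eq, Set.mem_pi, Set.mem_univ, true_implies, D]
    refine forall_congr' fun i => ?_
    by_cases h : i = j <;> simp [h]
  have hFu : Measurable fun z => F (Function.update z j ζ) := hF.comp measurable_update_left
  rw [hD, ← hc, ← smul_eq_mul, ← lintegral_smul_measure, ← hpi,
    lintegral_map hFu (show Measurable fun (z : ι → Marks) i => G i (z i) from
      measurable_pi_lambda _ fun i => (hG i).comp (measurable_pi_apply i))]
  refine lintegral_congr fun z => ?_
  congr 1
  funext i
  by_cases h : i = j
  · subst h; simp
  · simp [h, G]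

variable (lam ν) in
/-- The integral of `f` of delivery and system time of the first delivered packet over the event
that its source is `j`. -/
def cycleWeight (j : ι) (f : ℝ × ℝ → ℝ≥0∞) : ℝ≥0∞ :=
  ∫⁻ a, ENNReal.ofReal (Real.exp (-((∑ i ∈ Finset.univ.erase j, lam i) * a.1))) *
    ∑' n, trialRule.weight (markLaw (lam j) ν) f n a ∂(markLaw (lam j) ν)

omit [IsProbabilityMeasure ν] in
theorem ae_mark_iidLaw {r : ℝ} (hν : ∀ᵐ y ∂ν, 0 ≤ y) (hr : 0 < r)
    [IsProbabilityMeasure (markLaw r ν)] :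
    ∀ᵐ z ∂(iidLaw (markLaw r ν)), ∀ n, 0 < (z n).1 ∧ 0 ≤ (z n).2 := by
  have := isProbabilityMeasure_expMeasure hr
  have h : ∀ᵐ a ∂(markLaw r ν), 0 < a.1 ∧ 0 ≤ a.2 := by
    filter_upwards [ae_service_nonneg hν hr,
      Measure.quasiMeasurePreserving_fst.ae (ae_expMeasure_pos (r := r))] with a h1 h2
    exact ⟨h2, h1⟩
  rw [ae_all_iff]
  intro n
  rw [← Measure.infinitePi_map_eval (fun _ : ℕ => markLaw r ν) n] at h
  exact ae_of_ae_map (measurable_pi_apply n).aemeasurable h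

theorem genAt_mono {z : Marks} (h : ∀ n, 0 < (z n).1) : StrictMono (genAt z) :=
  strictMono_nat_of_lt_succ fun n => by rw [genAt_succ]; linarith [h (n + 1)]

theorem head_le_busy {z : Marks} (h : ∀ n, 0 < (z n).1 ∧ 0 ≤ (z n).2) :
    (z 0).1 ≤ (busy z).1.1 := by
  rw [busy_eq, ← genAt_zero]
  have := (genAt_mono fun n => (h n).1).monotone (Nat.zero_le (trialIndex z))
  dsimp only
  linarith [(h (trialIndex z)).2]

-- Freeze the packets `ζ` of source `j`. Its busy period does not depend on the other sources, so
-- the delivery time is a constant `t`, at least the time `w` of its first packet, and being first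
-- means that the other sources are silent up to `w`. Hence the others are fresh after `t`, at the
-- price of `exp (-w ∑_{i ≠ j} λ_i)`, and this price is the weight `φ` of the first mark in the busy
-- period of `ζ`.
omit [Nonempty ι] in
theorem lintegral_isFirst (hν : ∀ᵐ y ∂ν, 0 ≤ y) (hlam : ∀ j, 0 < lam j) (j : ι)
    {f : ℝ × ℝ → ℝ≥0∞} (hf : Measurable f) {B : Set (ι → Marks)} (hB : MeasurableSet B) :
    ∫⁻ z in {z | IsFirst z j}, f (busy (z j)).1 * B.indicator 1 (restOf j z) ∂(systemLaw lam ν) =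
      cycleWeight lam ν j f * systemLaw lam ν B := by
  set μ := systemLaw lam ν
  set m := iidLaw (markLaw (lam j) ν)
  have hBm : Measurable (B.indicator (1 : (ι → Marks) → ℝ≥0∞)) := measurable_one.indicator hB
  have hfb : Measurable fun z : ι → Marks => f (busy (z j)).1 :=
    hf.comp (measurable_fst.comp (measurable_busy.comp (measurable_pi_apply j)))
  have hF : Measurable ({z | IsFirst z j}.indicator fun z =>
      f (busy (z j)).1 * B.indicator 1 (restOf j z)) :=
    (hfb.mul (hBm.comp (measurable_restOf j))).indicator (measurableSet_isFirst j)
  have hrest : ∀ z ζ, restOf j (Function.update z j ζ) =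
      Function.update (fun i => residual (busy ζ).1.1 (z i)) j (busy ζ).2 := by
    intro z ζ
    funext i
    by_cases h : i = j
    · subst h; simp [restOf]
    · simp [restOf, h]
  have hswap : ∫⁻ z, ∫⁻ ζ, ({z | IsFirst z j}.indicator fun z =>
      f (busy (z j)).1 * B.indicator 1 (restOf j z)) (Function.update z j ζ) ∂m ∂μ =
      ∫⁻ ζ, ∫⁻ z, ({z | IsFirst z j}.indicator fun z =>
      f (busy (z j)).1 * B.indicator 1 (restOf j z)) (Function.update z j ζ) ∂μ ∂m :=
    lintegral_lintegral_swap (hF.comp measurable_update').aemeasurable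
  rw [← lintegral_indicator (measurableSet_isFirst j), ← lintegral_update_systemLaw lam ν j hF, hswap]
  have hinner : ∀ᵐ ζ ∂m, ∫⁻ z, ({z | IsFirst z j}.indicator fun z =>
      f (busy (z j)).1 * B.indicator 1 (restOf j z)) (Function.update z j ζ) ∂μ =
      ∫⁻ z, ENNReal.ofReal (Real.exp (-((∑ i ∈ Finset.univ.erase j, lam i) * (ζ 0).1))) *
        (f (busy ζ).1 * B.indicator 1 (Function.update z j (busy ζ).2)) ∂μ := by
    filter_upwards [ae_mark_iidLaw hν (hlam j)] with ζ hζ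
    have hS : MeasurableSet {z : ι → Marks | ∀ i, i ≠ j → (ζ 0).1 < (z i 0).1} := by
      have : {z : ι → Marks | ∀ i, i ≠ j → (ζ 0).1 < (z i 0).1} =
          ⋂ i, ⋂ (_ : i ≠ j), {z | (ζ 0).1 < (z i 0).1} := by ext; simp
      rw [this]
      exact .iInter fun i => .iInter fun _ => measurableSet_lt measurable_const (by fun_prop)
    have hBu : Measurable fun z => B.indicator (1 : (ι → Marks) → ℝ≥0∞)
        (Function.update z j (busy ζ).2) := hBm.comp measurable_update_left
    have h1 := lintegral_residual_others (ν := ν) hlam j (hζ 0).1.le (head_le_busy hζ) hBm (busy ζ).2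
    rw [lintegral_const_mul _ (hBu.const_mul _), lintegral_const_mul _ hBu, mul_left_comm, ← h1,
      ← lintegral_indicator hS, ← lintegral_const_mul]
    · refine lintegral_congr fun z => ?_
      have hiff : IsFirst (Function.update z j ζ) j ↔ ∀ i, i ≠ j → (ζ 0).1 < (z i 0).1 := by
        refine forall_congr' fun i => forall_congr' fun hi => ?_
        simp [hi]
      by_cases h : ∀ i, i ≠ j → (ζ 0).1 < (z i 0).1
      · rw [Set.indicator_of_mem (show Function.update z j ζ ∈ {z | IsFirst z j} from hiff.2 h),
          Set.indicator_of_mem (show z ∈ {z : ι → Marks | ∀ i, i ≠ j → (ζ 0).1 < (z i 0).1} from h),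
          hrest, Function.update_self]
      · rw [Set.indicator_of_notMem
            (show Function.update z j ζ ∉ {z | IsFirst z j} from fun h' => h (hiff.1 h')),
          Set.indicator_of_notMem
            (show z ∉ {z : ι → Marks | ∀ i, i ≠ j → (ζ 0).1 < (z i 0).1} from h), mul_zero]
    · refine (hBm.comp ?_).indicator hS
      refine measurable_update_left.comp (measurable_pi_lambda _ fun i => ?_)
      exact measurable_residual.comp (measurable_const.prodMk (measurable_pi_apply i))
  -- Fubini in the other direction: with the other sources fixed, the delivery data of `ζ` separate
  -- from its residual packets by `lintegral_busy`.
  rw [lintegral_congr_ae hinner, ← lintegral_lintegral_swap]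
  · have hB2 : ∀ z : ι → Marks, MeasurableSet (Function.update z j ⁻¹' B) := fun z =>
      measurable_update z hB
    have h2 : ∀ z : ι → Marks, ∫⁻ ζ,
        ENNReal.ofReal (Real.exp (-((∑ i ∈ Finset.univ.erase j, lam i) * (ζ 0).1))) *
        (f (busy ζ).1 * B.indicator 1 (Function.update z j (busy ζ).2)) ∂m =
        cycleWeight lam ν j f * m (Function.update z j ⁻¹' B) := fun z => by
      rw [cycleWeight, ← lintegral_busy hν (hlam j) (by fun_prop) hf (hB2 z)]
      rfl
    simp only [h2]
    have h3 : Measurable fun z : ι → Marks => m (Function.update z j ⁻¹' B) :=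
      measurable_measure_prodMk_left (s := (fun p : (ι → Marks) × Marks =>
        Function.update p.1 j p.2) ⁻¹' B) (measurable_update' hB)
    rw [lintegral_const_mul _ h3]
    congr 1
    rw [← lintegral_indicator_one hB, ← lintegral_update_systemLaw lam ν j hBm]
    refine lintegral_congr fun z => ?_
    rw [← lintegral_indicator_one (hB2 z)]
    rfl
  · refine Measurable.aemeasurable ?_
    have e1 : Measurable fun p : (ι → Marks) × Marks =>
        ENNReal.ofReal (Real.exp (-((∑ i ∈ Finset.univ.erase j, lam i) * (p.2 0).1))) := by fun_prop
    have e2 : Measurable fun p : (ι → Marks) × Marks => f (busy p.2).1 :=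
      hf.comp (measurable_fst.comp (measurable_busy.comp measurable_snd))
    have e3 : Measurable fun p : (ι → Marks) × Marks => Function.update p.1 j (busy p.2).2 :=
      measurable_update'.comp (measurable_fst.prodMk
        (measurable_snd.comp (measurable_busy.comp measurable_snd)))
    exact e1.mul (e2.mul (hBm.comp e3))

/-- Given the first mark, a later generation time is a translate of a generation time of the
independent tail, so the absence of atoms is inherited from the exponential law by induction. -/
theorem measure_genAt_eq {r : ℝ} (hr : 0 < r) [IsProbabilityMeasure (markLaw r ν)] (n : ℕ) (c : ℝ) :
    iidLaw (markLaw r ν) {z | genAt z n = c} = 0 := by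
  have := isProbabilityMeasure_expMeasure hr
  have hm : ∀ n c, MeasurableSet {z : Marks | genAt z n = c} := fun n c =>
    measurable_genAt n (measurableSet_singleton c)
  induction n generalizing c with
  | zero =>
    have h : {z : Marks | genAt z 0 = c} = (fun z => z 0) ⁻¹' ({c} ×ˢ Set.univ) := by
      ext z; simp
    rw [h, ← Measure.map_apply (measurable_pi_apply 0) (by measurability), map_head_iidLaw,
      Measure.prod_prod, measure_singleton, zero_mul]
  | succ n ih =>
    have h1 := (isRegenerative_seqTail (markLaw r ν)).lintegral_eq
      (F := {p : (ℝ × ℝ) × Marks | p.1.1 + genAt p.2 n = c}.indicator 1)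
      (measurable_one.indicator (((measurable_fst.comp measurable_fst).add
        ((measurable_genAt n).comp measurable_snd)) (measurableSet_singleton c)))
    rw [← lintegral_indicator_one (hm _ _)]
    refine Eq.trans (lintegral_congr fun z => ?_) (h1.trans ?_)
    · have : genAt z (n + 1) = c ↔ (z 0).1 + genAt (seqTail z) n = c := by rw [genAt_succ_eq]
      by_cases h : genAt z (n + 1) = c
      · rw [Set.indicator_of_mem (by exact h), Set.indicator_of_mem (by exact this.1 h)]; rfl
      · rw [Set.indicator_of_notMem (by exact h), Set.indicator_of_notMem (by exact mt this.2 h)]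
    · refine (lintegral_congr fun a => ?_).trans lintegral_zero
      rw [← ih (c - a.1), ← lintegral_indicator_one (hm _ _)]
      refine lintegral_congr fun z => ?_
      have : a.1 + genAt z n = c ↔ genAt z n = c - a.1 := by constructor <;> intro h <;> linarith
      by_cases h : genAt z n = c - a.1
      · rw [Set.indicator_of_mem (by exact this.2 h), Set.indicator_of_mem (by exact h)]; rfl
      · rw [Set.indicator_of_notMem (by exact mt this.1 h), Set.indicator_of_notMem (by exact h)]

-- Resample source `i`: its generation time would have to hit a value which does not depend on that
-- source, and it has no atoms. With suitable `h` this excludes ties with generation and with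
-- completion times of another source.
omit [Nonempty ι] in
theorem ae_genAt_ne (hlam : ∀ j, 0 < lam j) {i j : ι} (hij : i ≠ j) (n : ℕ) {h : Marks → ℝ}
    (hh : Measurable h) : ∀ᵐ z ∂(systemLaw lam ν), genAt (z i) n ≠ h (z j) := by
  have hm : MeasurableSet {z : ι → Marks | genAt (z i) n = h (z j)} :=
    measurableSet_eq_fun ((measurable_genAt n).comp (measurable_pi_apply i))
      (hh.comp (measurable_pi_apply j))
  rw [ae_iff]
  simp only [ne_eq, not_not]
  rw [← lintegral_indicator_one hm,
    ← lintegral_update_systemLaw lam ν i (measurable_one.indicator hm)]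
  refine (lintegral_congr fun z => ?_).trans lintegral_zero
  rw [← measure_genAt_eq (ν := ν) (hlam i) n (h (z j)),
    ← lintegral_indicator_one (show MeasurableSet {ζ : Marks | genAt ζ n = h (z j)} from
      measurable_genAt n (measurableSet_singleton _))]
  refine lintegral_congr fun ζ => ?_
  have : Function.update z i ζ ∈ {z : ι → Marks | genAt (z i) n = h (z j)} ↔
      genAt ζ n = h (z j) := by
    simp [hij.symm]
  by_cases h' : genAt ζ n = h (z j)
  · rw [Set.indicator_of_mem (this.2 h'), Set.indicator_of_mem (by exact h')]; rfl
  · rw [Set.indicator_of_notMem (mt this.1 h'), Set.indicator_of_notMem (by exact h')]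

theorem ae_exists_isFirst (hlam : ∀ j, 0 < lam j) :
    ∀ᵐ z ∂(systemLaw lam ν), ∃ j, IsFirst z j := by
  have h : ∀ᵐ z ∂(systemLaw lam ν), ∀ i j : ι, i ≠ j → genAt (z i) 0 ≠ genAt (z j) 0 := by
    refine ae_all_iff.2 fun i => ae_all_iff.2 fun j => ?_
    by_cases hij : i = j
    · simp [hij]
    · filter_upwards [ae_genAt_ne (ν := ν) hlam hij 0 (measurable_genAt 0)] with z hz _ using hz
  filter_upwards [h] with z hz
  obtain ⟨j, hj⟩ := Finite.exists_min fun j => (z j 0).1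
  refine ⟨j, fun i hi => lt_of_le_of_ne (hj i) ?_⟩
  have := hz j i (Ne.symm hi)
  simpa using this

theorem lintegral_cycle (hν : ∀ᵐ y ∂ν, 0 ≤ y) (hlam : ∀ j, 0 < lam j) [MeasurableSpace ι]
    [DiscreteMeasurableSpace ι] {f : ι × (ℝ × ℝ) → ℝ≥0∞} (hf : Measurable f)
    {B : Set (ι → Marks)} (hB : MeasurableSet B) :
    ∫⁻ z, f (cycleOut z) * B.indicator 1 (cycleRest z) ∂(systemLaw lam ν) =
      (∑ j, cycleWeight lam ν j fun d => f (j, d)) * systemLaw lam ν B := by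
  have h1 : ∀ᵐ z ∂(systemLaw lam ν), z ∈ ⋃ j, {z | IsFirst z j} := by
    filter_upwards [ae_exists_isFirst (ν := ν) hlam] with z hz
    simpa using hz
  rw [← Measure.restrict_eq_self_of_ae_mem h1, lintegral_iUnion measurableSet_isFirst,
    tsum_fintype, Finset.sum_mul, Measure.restrict_eq_self_of_ae_mem h1]
  · refine Finset.sum_congr rfl fun j _ => ?_
    rw [← lintegral_isFirst hν hlam j (show Measurable fun d => f (j, d) from
      hf.comp (measurable_const.prodMk measurable_id)) hB]
    refine setLIntegral_congr_fun (measurableSet_isFirst j) fun z hz => ?_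
    have hz' : IsFirst z j := hz
    simp only [cycleOut, cycleRest, hz'.firstSource_eq]
  · intro i j hij
    exact Set.disjoint_left.2 fun z hi hj => hij (IsFirst.unique hi hj)

theorem lintegral_cycleOut (hν : ∀ᵐ y ∂ν, 0 ≤ y) (hlam : ∀ j, 0 < lam j) [MeasurableSpace ι]
    [DiscreteMeasurableSpace ι] {f : ι × (ℝ × ℝ) → ℝ≥0∞} (hf : Measurable f) :
    ∫⁻ p, f p ∂((systemLaw lam ν).map cycleOut) = ∑ j, cycleWeight lam ν j fun d => f (j, d) := by
  have := lintegral_cycle (ν := ν) hν hlam hf .univ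
  rw [lintegral_map hf measurable_cycleOut]
  simpa using this

theorem isRegenerative_cycle (hν : ∀ᵐ y ∂ν, 0 ≤ y) (hlam : ∀ j, 0 < lam j) [MeasurableSpace ι]
    [DiscreteMeasurableSpace ι] :
    IsRegenerative (systemLaw lam ν) (cycleOut : (ι → Marks) → ι × (ℝ × ℝ)) cycleRest := by
  refine .of_measure_inter measurable_cycleOut measurable_cycleRest fun A B hA hB => ?_
  have hA' : Measurable (A.indicator (1 : ι × (ℝ × ℝ) → ℝ≥0∞)) := measurable_one.indicator hA
  have h1 := lintegral_cycle (ν := ν) hν hlam hA' hB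
  rw [← lintegral_cycleOut hν hlam hA', lintegral_indicator_one hA,
    Measure.map_apply measurable_cycleOut hA] at h1
  rw [← h1, ← lintegral_indicator_one ((measurable_cycleOut hA).inter (measurable_cycleRest hB)),
    Set.inter_indicator_one]
  rfl

end Cycle

/-! ### Iterating a regenerative step -/

namespace IsRegenerative

variable {Ξ O : Type*} [MeasurableSpace Ξ] [MeasurableSpace O] {μ : Measure Ξ}
  [IsProbabilityMeasure μ] {o : Ξ → O} {θ : Ξ → Ξ}

omit [IsProbabilityMeasure μ] in
theorem measurable_iterate (h : IsRegenerative μ o θ) (n : ℕ) : Measurable fun x => o (θ^[n] x) :=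
  h.measurable_out.comp (h.preserving.measurable.iterate n)

omit [IsProbabilityMeasure μ] in
theorem measure_iterate_preimage (h : IsRegenerative μ o θ) (n : ℕ) {A : Set O}
    (hA : MeasurableSet A) : μ ((fun x => o (θ^[n] x)) ⁻¹' A) = μ (o ⁻¹' A) :=
  (h.preserving.iterate n).measure_preimage (h.measurable_out hA).nullMeasurableSet

/-- Peel off the first output: it is independent of the state after the step, and that state has the
original law. -/
theorem measure_forall_lt (h : IsRegenerative μ o θ) (n : ℕ) {A : ℕ → Set O}
    (hA : ∀ n, MeasurableSet (A n)) :
    μ {x | ∀ k < n, o (θ^[k] x) ∈ A k} = ∏ k ∈ Finset.range n, μ (o ⁻¹' A k) := by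
  induction n generalizing A with
  | zero => simp
  | succ n ih =>
    have hm : MeasurableSet {x | ∀ k < n, o (θ^[k] x) ∈ A (k + 1)} := by
      have : {x | ∀ k < n, o (θ^[k] x) ∈ A (k + 1)} =
          ⋂ k, ⋂ (_ : k < n), (fun x => o (θ^[k] x)) ⁻¹' A (k + 1) := by ext; simp
      rw [this]
      exact .iInter fun k => .iInter fun _ => h.measurable_iterate k (hA _)
    have h1 : {x | ∀ k < n + 1, o (θ^[k] x) ∈ A k} =
        o ⁻¹' A 0 ∩ θ ⁻¹' {x | ∀ k < n, o (θ^[k] x) ∈ A (k + 1)} := by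
      ext x
      simp only [Set.mem_ofPred_eq, Set.mem_inter_iff, Set.mem_preimage]
      constructor
      · intro hx
        exact ⟨hx 0 (by omega), fun k hk => hx (k + 1) (by omega)⟩
      · rintro ⟨h0, h1⟩ k hk
        cases k with
        | zero => exact h0
        | succ k => exact h1 k (by omega)
    rw [h1, h.indep.measure_inter_preimage_eq_mul _ _ (hA 0) hm,
      h.preserving.measure_preimage hm.nullMeasurableSet, ih fun n => hA (n + 1),
      Finset.prod_range_succ', mul_comm]

theorem iIndepFun_iterate (h : IsRegenerative μ o θ) : iIndepFun (fun n x => o (θ^[n] x)) μ := by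
  classical
  rw [iIndepFun_iff_measure_inter_preimage_eq_mul]
  intro s A hA
  obtain ⟨N, hN⟩ : ∃ N, s ⊆ Finset.range N :=
    ⟨s.sup id + 1, fun i hi => Finset.mem_range_succ_iff.2 (Finset.le_sup (f := id) hi)⟩
  let u : ℕ → Set O := fun i => if i ∈ s then A i else Set.univ
  have hu : ∀ i, MeasurableSet (u i) := fun i => by
    by_cases h : i ∈ s
    · simpa [u, h] using hA i h
    · simp [u, h]
  have h1 : (⋂ i ∈ s, (fun x => o (θ^[i] x)) ⁻¹' A i) = {x | ∀ k < N, o (θ^[k] x) ∈ u k} := by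
    ext x
    simp only [Set.mem_iInter, Set.mem_preimage, Set.mem_ofPred_eq]
    refine ⟨fun h k _ => ?_, fun h i hi => ?_⟩
    · by_cases hk : k ∈ s
      · simpa [u, hk] using h k hk
      · simp [u, hk]
    · simpa [u, hi] using h i (Finset.mem_range.1 (hN hi))
  rw [h1, h.measure_forall_lt N hu, ← Finset.prod_subset hN (f := fun i => μ (o ⁻¹' u i))]
  · refine Finset.prod_congr rfl fun i hi => ?_
    rw [h.measure_iterate_preimage i (hA i hi)]
    simp [u, hi]
  · intro i _ hi; simp [u, hi]

omit [IsProbabilityMeasure μ] in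
theorem identDistrib_iterate (h : IsRegenerative μ o θ) (n : ℕ) :
    IdentDistrib (fun x => o (θ^[n] x)) o μ μ := by
  refine ⟨(h.measurable_iterate n).aemeasurable, h.measurable_out.aemeasurable, ?_⟩
  ext A hA
  rw [Measure.map_apply (h.measurable_iterate n) hA, Measure.map_apply h.measurable_out hA,
    h.measure_iterate_preimage n hA]

end IsRegenerative

/-! ### The cycle until the first delivery of a given source -/

section SourceCycle

variable {ι : Type*} [Fintype ι] [Nonempty ι] [DecidableEq ι] [MeasurableSpace ι]
  [DiscreteMeasurableSpace ι]

/-- The rule which runs cycles until a packet of source `c` is delivered, the state being the time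
which has elapsed. -/
def sourceRule (c : ι) : StoppingRule ℝ (ι × (ℝ × ℝ)) (ι → Marks) (ℝ × ℝ) where
  halt := {p | p.2.1 = c}
  next p := p.1 + p.2.2.1
  out p := (p.1 + p.2.2.1, p.2.2.2)
  res p := p.2.2
  measurableSet_halt := (measurable_fst.comp measurable_snd) (measurableSet_singleton c)
  measurable_next := by fun_prop
  measurable_out := by fun_prop
  measurable_res := by fun_prop

/-- Delivery time and system time of the first delivered packet of source `c`, and the residual
packets at its delivery. -/
def sourceCycle (c : ι) (z : ι → Marks) : (ℝ × ℝ) × (ι → Marks) :=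
  (sourceRule c).final cycleOut cycleRest (0, z)

/-- Some packet of source `c` is delivered. -/
def HasSourceDelivery (c : ι) (z : ι → Marks) : Prop :=
  ∃ n, (sourceRule c).StopsAt cycleOut cycleRest n (0, z)

variable {lam : ι → ℝ} {ν : Measure ℝ} [IsProbabilityMeasure ν]
  [∀ j, IsProbabilityMeasure (markLaw (lam j) ν)]

-- A cycle already ends with a fresh system, which is passed on unchanged, so there is no
-- restriction on the states and the law of the output is arbitrary.
omit [Nonempty ι] [DecidableEq ι] [IsProbabilityMeasure ν] in
theorem sourceRule_isFresh (c : ι) (κ : Measure (ι × (ℝ × ℝ))) :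
    (sourceRule c).IsFresh (systemLaw lam ν) κ Set.univ := by
  classical
  refine ⟨fun σ _ f hf B hB => ?_, fun _ _ => .of_forall fun _ _ => trivial⟩
  rw [← lintegral_mul_const' _ _ (by simp)]
  refine lintegral_congr fun a => ?_
  by_cases h : (σ, a) ∈ (sourceRule c).halt
  · simp only [h, if_true]
    rw [lintegral_const_mul _ (show Measurable fun x => B.indicator (1 : (ι → Marks) → ℝ≥0∞)
      ((sourceRule c).res (σ, a, x)) from measurable_one.indicator hB)]
    congr 1
    exact lintegral_indicator_one hB
  · simp [h]

variable (lam ν) in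
/-- Laplace weight of the idle period before a service of source `j`. -/
def idleWeight (j : ι) (s : ℝ) : ℝ≥0∞ :=
  ∫⁻ x, ENNReal.ofReal (Real.exp ((s - ∑ i ∈ Finset.univ.erase j, lam i) * x)) ∂(expMeasure (lam j))

omit [Nonempty ι] [MeasurableSpace ι] [DiscreteMeasurableSpace ι]
  [∀ j, IsProbabilityMeasure (markLaw (lam j) ν)] in
theorem cycleWeight_exp (hν : ∀ᵐ y ∂ν, 0 ≤ y) (hlam : ∀ j, 0 < lam j) (j : ι) (s : ℝ)
    {h : ℝ → ℝ≥0∞} (hh : Measurable h) :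
    cycleWeight lam ν j (fun d => ENNReal.ofReal (Real.exp (s * d.1)) * h d.2) =
      idleWeight lam j s *
        ((1 - failWeight (lam j) ν s)⁻¹ * successWeight (lam j) ν s h) :=
  tsum_trialRule_weight hν (hlam j) _ s hh

omit [Nonempty ι] [MeasurableSpace ι] [DiscreteMeasurableSpace ι] [IsProbabilityMeasure ν]
  [∀ j, IsProbabilityMeasure (markLaw (lam j) ν)] in
theorem cycleWeight_zero_fun (j : ι) : cycleWeight lam ν j (fun _ => 0) = 0 := by
  classical
  have : ∀ n a, trialRule.weight (markLaw (lam j) ν) (fun _ => 0) n a = 0 := by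
    intro n
    induction n with
    | zero => intro a; simp [StoppingRule.weight]
    | succ n ih => intro a; simp [StoppingRule.weight, ih]
  simp [cycleWeight, this]

variable (lam ν) in
/-- Laplace weight of a cycle which ends with the delivery of a packet of another source. -/
def otherWeight (c : ι) (s : ℝ) : ℝ≥0∞ :=
  ∑ j ∈ Finset.univ.erase c, cycleWeight lam ν j fun d => ENNReal.ofReal (Real.exp (s * d.1))

/-- The elapsed time enters only through an exponential factor, so each cycle of another source
multiplies by `otherWeight`. Only the system time of the last packet is an output, hence `h` appears
in the final cycle alone. -/
theorem sourceRule_weight (hν : ∀ᵐ y ∂ν, 0 ≤ y) (hlam : ∀ j, 0 < lam j) (c : ι) (s : ℝ)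
    {h : ℝ → ℝ≥0∞} (hh : Measurable h) (n : ℕ) (b : ℝ) :
    (sourceRule c).weight ((systemLaw lam ν).map cycleOut)
      (fun d => ENNReal.ofReal (Real.exp (s * d.1)) * h d.2) n b =
    ENNReal.ofReal (Real.exp (s * b)) * (otherWeight lam ν c s ^ n *
      cycleWeight lam ν c fun d => ENNReal.ofReal (Real.exp (s * d.1)) * h d.2) := by
  classical
  have hexp : ∀ b d : ℝ, ENNReal.ofReal (Real.exp (s * (b + d))) =
      ENNReal.ofReal (Real.exp (s * b)) * ENNReal.ofReal (Real.exp (s * d)) := fun b d => by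
    rw [← ENNReal.ofReal_mul (Real.exp_nonneg _), ← Real.exp_add, mul_add]
  have hset : MeasurableSet {p : ι × (ℝ × ℝ) | p.1 = c} := measurable_fst (measurableSet_singleton c)
  induction n generalizing b with
  | zero =>
    have hg : Measurable fun p : ι × (ℝ × ℝ) => if p.1 = c then
        ENNReal.ofReal (Real.exp (s * p.2.1)) * h p.2.2 else 0 :=
      Measurable.ite hset (by fun_prop) measurable_const
    have h1 := lintegral_cycleOut (ν := ν) hν hlam hg
    rw [Finset.sum_eq_single c] at h1
    · simp only [if_true] at h1
      rw [pow_zero, one_mul, ← h1, ← lintegral_const_mul _ hg, StoppingRule.weight]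
      refine lintegral_congr fun a => ?_
      by_cases ha : a.1 = c
      · rw [if_pos (by exact ha), if_pos ha, ← mul_assoc, ← hexp]
        rfl
      · rw [if_neg (by exact ha), if_neg ha, mul_zero]
    · intro j _ hj
      simp only [hj, if_false]
      exact cycleWeight_zero_fun j
    · simp
  | succ n ih =>
    have hg : Measurable fun p : ι × (ℝ × ℝ) => if p.1 = c then 0 else
        ENNReal.ofReal (Real.exp (s * p.2.1)) :=
      Measurable.ite hset measurable_const (by fun_prop)
    have h1 := lintegral_cycleOut (ν := ν) hν hlam hg
    rw [← Finset.sum_erase_add _ _ (Finset.mem_univ c)] at h1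
    simp only [if_true, cycleWeight_zero_fun, add_zero] at h1
    have h2 : otherWeight lam ν c s = ∫⁻ p : ι × (ℝ × ℝ), (if p.1 = c then 0 else
        ENNReal.ofReal (Real.exp (s * p.2.1))) ∂((systemLaw lam ν).map cycleOut) := by
      rw [h1, otherWeight]
      refine Finset.sum_congr rfl fun j hj => ?_
      simp only [Finset.ne_of_mem_erase hj, if_false]
    rw [pow_succ', mul_assoc]
    set K := otherWeight lam ν c s ^ n *
      cycleWeight lam ν c fun d => ENNReal.ofReal (Real.exp (s * d.1)) * h d.2
    rw [h2, ← lintegral_mul_const _ hg, ← lintegral_const_mul _ (hg.mul_const _),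
      StoppingRule.weight]
    refine lintegral_congr fun a => ?_
    by_cases ha : a.1 = c
    · rw [if_pos (by exact ha), if_pos ha, zero_mul, mul_zero]
    · rw [if_neg (by exact ha), if_neg ha]
      refine (ih (b + a.2.1)).trans ?_
      rw [hexp, mul_assoc]

omit [Nonempty ι] [MeasurableSpace ι] [DiscreteMeasurableSpace ι] in
theorem idleWeight_ne_zero [Nonempty ι] (hlam : ∀ j, 0 < lam j) (j : ι) (s : ℝ) :
    idleWeight lam j s ≠ 0 := by
  have := isProbabilityMeasure_expMeasure (hlam j)
  rw [idleWeight, ne_eq, lintegral_eq_zero_iff (by fun_prop)]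
  intro h1
  obtain ⟨y, hy⟩ := h1.exists
  simp only [Pi.zero_apply, ENNReal.ofReal_eq_zero, not_le.2 (Real.exp_pos _)] at hy

omit [Nonempty ι] [MeasurableSpace ι] [DiscreteMeasurableSpace ι]
  [∀ j, IsProbabilityMeasure (markLaw (lam j) ν)] in
theorem cycleWeight_ne_zero (hν : ∀ᵐ y ∂ν, 0 ≤ y) (hlam : ∀ j, 0 < lam j) (j : ι) (s : ℝ)
    {h : ℝ → ℝ≥0∞} (hh : Measurable h) (h0 : ∀ y, h y ≠ 0) :
    cycleWeight lam ν j (fun d => ENNReal.ofReal (Real.exp (s * d.1)) * h d.2) ≠ 0 := by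
  have : Nonempty ι := ⟨j⟩
  rw [cycleWeight_exp hν hlam j s hh]
  refine mul_ne_zero (idleWeight_ne_zero hlam j s) (mul_ne_zero ?_ (successWeight_pos hh h0))
  exact ENNReal.inv_ne_zero.2 (ne_top_of_le_ne_top ENNReal.one_ne_top tsub_le_self)

/-- At `s = 0` these are the probabilities that the packet which ends a cycle belongs to another
source, or to `c`. -/
theorem otherWeight_zero_add (hν : ∀ᵐ y ∂ν, 0 ≤ y) (hlam : ∀ j, 0 < lam j) (c : ι) :
    otherWeight lam ν c 0 + cycleWeight lam ν c (fun _ => 1) = 1 := by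
  have := Measure.isProbabilityMeasure_map (μ := systemLaw lam ν) (f := cycleOut)
    measurable_cycleOut.aemeasurable
  have h1 := lintegral_cycleOut (ν := ν) hν hlam (f := fun _ => 1) measurable_const
  rw [lintegral_one, measure_univ, ← Finset.sum_erase_add _ _ (Finset.mem_univ c)] at h1
  simpa [otherWeight] using h1.symm

theorem otherWeight_zero_lt_one (hν : ∀ᵐ y ∂ν, 0 ≤ y) (hlam : ∀ j, 0 < lam j) (c : ι) :
    otherWeight lam ν c 0 < 1 := by
  have h1 := otherWeight_zero_add (ν := ν) hν hlam c
  have h2 := cycleWeight_ne_zero (ν := ν) hν hlam c 0 (h := fun _ => 1) measurable_const (by simp)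
  simp only [zero_mul, Real.exp_zero, ENNReal.ofReal_one, mul_one] at h2
  refine lt_of_le_of_ne (h1 ▸ le_self_add) fun h => h2 ?_
  rw [h] at h1
  exact ENNReal.add_right_inj ENNReal.one_ne_top |>.1 (by rw [h1, add_zero])

theorem ae_hasSourceDelivery (hν : ∀ᵐ y ∂ν, 0 ≤ y) (hlam : ∀ j, 0 < lam j) (c : ι) :
    ∀ᵐ z ∂(systemLaw lam ν), HasSourceDelivery c z := by
  refine (sourceRule_isFresh c _).ae_stops (isRegenerative_cycle hν hlam) (Set.mem_univ _) ?_
  have h1 := fun n => sourceRule_weight (ν := ν) hν hlam c 0 (h := fun _ => 1) measurable_const n 0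
  simp only [zero_mul, Real.exp_zero, ENNReal.ofReal_one, mul_one, one_mul] at h1
  simp only [h1]
  have h2 := otherWeight_zero_lt_one (ν := ν) hν hlam c
  rw [ENNReal.tsum_mul_right, ENNReal.tsum_geometric,
    ENNReal.eq_sub_of_add_eq h2.ne_top ((add_comm _ _).trans (otherWeight_zero_add hν hlam c)),
    ENNReal.inv_mul_cancel _ (by simp)]
  rw [ne_eq, tsub_eq_zero_iff_le, not_le]
  exact h2

theorem isRegenerative_sourceCycle (hν : ∀ᵐ y ∂ν, 0 ≤ y) (hlam : ∀ j, 0 < lam j) (c : ι) :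
    IsRegenerative (systemLaw lam ν) (fun z => (sourceCycle c z).1)
      (fun z => (sourceCycle c z).2) :=
  (sourceRule_isFresh c _).isRegenerative_final (isRegenerative_cycle hν hlam) (Set.mem_univ _)
    (ae_hasSourceDelivery hν hlam c)

/-- Geometric series in the number of cycles of other sources before the first one of `c`, with the
clock started at 0. Both sides may be infinite. -/
theorem lintegral_sourceCycle (hν : ∀ᵐ y ∂ν, 0 ≤ y) (hlam : ∀ j, 0 < lam j) (c : ι) (s : ℝ)
    {h : ℝ → ℝ≥0∞} (hh : Measurable h) :
    ∫⁻ z, ENNReal.ofReal (Real.exp (s * (sourceCycle c z).1.1)) * h (sourceCycle c z).1.2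
        ∂(systemLaw lam ν) =
      (1 - otherWeight lam ν c s)⁻¹ *
        cycleWeight lam ν c fun d => ENNReal.ofReal (Real.exp (s * d.1)) * h d.2 := by
  have h1 := (sourceRule_isFresh (lam := lam) (ν := ν) c _).lintegral_final
    (isRegenerative_cycle hν hlam) (Set.mem_univ (0 : ℝ)) (ae_hasSourceDelivery hν hlam c)
    (f := fun d => ENNReal.ofReal (Real.exp (s * d.1)) * h d.2) (by fun_prop) .univ
  simp only [sourceRule_weight hν hlam c s hh, mul_zero, Real.exp_zero, ENNReal.ofReal_one, one_mul,
    ENNReal.tsum_mul_right, ENNReal.tsum_geometric, Set.indicator_univ, Pi.one_apply, mul_one,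
    measure_univ] at h1
  exact h1

end SourceCycle

/-! ### One realization: decomposition into cycles -/

section Realization

variable {ι : Type*}

/-- A packet with all times delayed by `t`. -/
def Packet.delay (t : ℝ) (p : Packet ι) : Packet ι := ⟨p.source, p.gen + t, p.done + t⟩

theorem Packet.delay_delay (t t' : ℝ) (p : Packet ι) :
    (p.delay t').delay t = p.delay (t + t') := by
  simp only [delay, Packet.mk.injEq, true_and]
  constructor <;> ring

/-- The `k`-th packet of source `j`. -/
def packetOf (z : ι → Marks) (j : ι) (k : ℕ) : Packet ι :=
  ⟨j, genAt (z j) k, genAt (z j) k + (z j k).2⟩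

/-- Interarrival times. -/
abbrev interarrivals (z : ι → Marks) : ι → ℕ → ℝ := fun j n => (z j n).1

/-- Service times. -/
abbrev services (z : ι → Marks) : ι → ℕ → ℝ := fun j n => (z j n).2

/-- The regularity properties which hold for almost every realization. -/
structure IsRegular (z : ι → Marks) : Prop where
  pos : ∀ j n, 0 < (z j n).1 ∧ 0 ≤ (z j n).2
  exists_lt : ∀ j t, ∃ n, t < genAt (z j) n
  hasDelivery : ∀ j, HasDelivery (z j)
  isFirst : ∃ j, IsFirst z j
  gen_ne_gen : ∀ i j, i ≠ j → ∀ n m, genAt (z i) n ≠ genAt (z j) m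
  gen_ne_done : ∀ i j, i ≠ j → ∀ n m, genAt (z i) n ≠ genAt (z j) m + (z j m).2
  next_ne_service : ∀ j n, (z j (n + 1)).1 ≠ (z j n).2

/-- The remainder left by the busy period is what is seen from the delivery time on. So, path by
path, all sources at a delivery are described by the same map `residual`, although only the others
needed it in the computation of the law. -/
theorem busy_snd_eq_residual {ζ : Marks} (hpos : ∀ n, 0 < (ζ n).1 ∧ 0 ≤ (ζ n).2)
    (h : HasDelivery ζ) :
    numBefore (busy ζ).1.1 ζ = trialIndex ζ + 1 ∧ (busy ζ).2 = residual (busy ζ).1.1 ζ := by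
  have hs := h.spec.2
  have hD : (busy ζ).1.1 = genAt ζ (trialIndex ζ) + (ζ (trialIndex ζ)).2 := by rw [busy_eq]
  have h1 : residualRule.StopsAt (fun z => z 0) seqTail (trialIndex ζ + 1) ((busy ζ).1.1, ζ) := by
    refine residualRule_stopsAt_iff.2 ⟨fun k hk => ?_, ?_⟩
    · have := (genAt_mono fun n => (hpos n).1).monotone (Nat.le_of_lt_succ hk)
      rw [hD]; linarith [(hpos (trialIndex ζ)).2]
    · rw [genAt_succ, hD]; linarith
  have hN : numBefore (busy ζ).1.1 ζ = trialIndex ζ + 1 := h1.index_eq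
  refine ⟨hN, ?_⟩
  rw [residual_eq, hN, genAt_succ, hD, busy_eq]
  dsimp only
  congr 2
  ring

theorem genAt_residual (t : ℝ) (ζ : Marks) (n : ℕ) :
    genAt (residual t ζ) n = genAt ζ (numBefore t ζ + n) - t := by
  rw [residual_eq]
  induction n with
  | zero => simp
  | succ n ih =>
    rw [genAt_succ, ih, ← add_assoc, genAt_succ]
    simp only [seqCons_succ]
    rw [show numBefore t ζ + 1 + n = numBefore t ζ + n + 1 by ring]
    ring

theorem residual_snd (t : ℝ) (ζ : Marks) (n : ℕ) :
    (residual t ζ n).2 = (ζ (numBefore t ζ + n)).2 := by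
  rw [residual_eq]
  cases n with
  | zero => rfl
  | succ n => rw [seqCons_succ, show numBefore t ζ + 1 + n = numBefore t ζ + (n + 1) by ring]

variable [DecidableEq ι]

theorem restOf_eq {z : ι → Marks} (h : IsRegular z) (j : ι) :
    restOf j z = fun i => residual (busy (z j)).1.1 (z i) := by
  funext i
  by_cases hi : i = j
  · subst hi
    simp only [restOf, Function.update_self]
    exact (busy_snd_eq_residual (h.pos i) (h.hasDelivery i)).2
  · simp [restOf, hi]

theorem accept_delay (t : ℝ) (p : Option (Packet ι)) (q : Packet ι) :
    accept (p.map (Packet.delay t)) (q.delay t) = (accept p q).map (Packet.delay t) := by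
  cases p with
  | none => rfl
  | some p =>
    simp only [Option.map_some, accept, Packet.delay, add_le_add_iff_right]
    split_ifs <;> rfl

variable [Fintype ι] [Nonempty ι]

omit [DecidableEq ι] in
theorem nextSource_le (x : ι → ℕ → ℝ) (k : ι → ℕ) (i : ι) :
    arrivalTime x (nextSource x k) (k (nextSource x k)) ≤ arrivalTime x i (k i) :=
  Classical.choose_spec (Finite.exists_min fun j => arrivalTime x j (k j)) i

omit [DecidableEq ι] in
theorem nextSource_eq {x : ι → ℕ → ℝ} {k : ι → ℕ} {j : ι}
    (h : ∀ i, i ≠ j → arrivalTime x j (k j) < arrivalTime x i (k i)) : nextSource x k = j := by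
  by_contra hne
  exact not_lt.2 (nextSource_le x k j) (h _ hne)

theorem packet_eq (z : ι → Marks) (n : ℕ) :
    packet (interarrivals z) (services z) n =
      packetOf z (nextSource (interarrivals z) (counts (interarrivals z) n))
        (counts (interarrivals z) n
          (nextSource (interarrivals z) (counts (interarrivals z) n))) := rfl

theorem counts_succ (x : ι → ℕ → ℝ) (n : ℕ) :
    counts x (n + 1) = Function.update (counts x n) (nextSource x (counts x n))
      (counts x n (nextSource x (counts x n)) + 1) := rfl

/-- After the first `M` packets, which are generated up to time `t`, the system evolves like the
system `z'` with all times delayed by `t`. -/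
structure Continues (z : ι → Marks) (M : ℕ) (t : ℝ) (z' : ι → Marks) : Prop where
  packet_eq : ∀ m, packet (interarrivals z) (services z) (M + m) =
    (packet (interarrivals z') (services z') m).delay t
  server_eq : ∀ m, server (interarrivals z) (services z) (M + (m + 1)) =
    (server (interarrivals z') (services z') (m + 1)).map (Packet.delay t)

theorem Continues.trans {z z' z'' : ι → Marks} {M M' : ℕ} {t t' : ℝ} (h : Continues z M t z')
    (h' : Continues z' M' t' z'') : Continues z (M + M') (t + t') z'' := by
  constructor
  · intro m
    rw [add_assoc, h.packet_eq, h'.packet_eq, Packet.delay_delay]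
  · intro m
    rw [show M + M' + (m + 1) = M + (M' + m + 1) by ring, h.server_eq,
      show M' + m + 1 = M' + (m + 1) by ring, h'.server_eq, Option.map_map]
    congr 1
    funext p
    exact Packet.delay_delay _ _ _

/-- Only indices `m + 1` can be compared: just before arrival `M` the server of `z` may remember a
packet already delivered, whereas `z'` starts with none. From the next index on the servers agree up
to the delay. -/
theorem Continues.delivers_iff {z z' : ι → Marks} {M : ℕ} {t : ℝ} (h : Continues z M t z') (c : ι)
    (m : ℕ) : Delivers (interarrivals z) (services z) c (M + (m + 1)) ↔
      Delivers (interarrivals z') (services z') c (m + 1) := by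
  simp only [Delivers, h.server_eq, h.packet_eq, Option.map_eq_some_iff]
  constructor
  · rintro ⟨p, ⟨q, hq, rfl⟩, h1, h2⟩
    exact ⟨q, hq, h1, by simpa [Packet.delay] using h2⟩
  · rintro ⟨q, hq, h1, h2⟩
    exact ⟨_, ⟨q, hq, rfl⟩, h1, by simpa [Packet.delay] using h2⟩

/-- The first delivered packet of source `c` is delivered at time `t` with system time `u`, the
number of packets generated up to then is `M`, and the residual system is `z'`. -/
structure FirstDelivery (z : ι → Marks) (c : ι) (M : ℕ) (t u : ℝ) (z' : ι → Marks) : Prop where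
  continues : Continues z M t z'
  server_eq : server (interarrivals z) (services z) M = some ⟨c, t - u, t⟩
  le_gen : t ≤ (packet (interarrivals z) (services z) M).gen
  not_delivers : ∀ m < M, ¬ Delivers (interarrivals z) (services z) c m

theorem not_delivers_zero (z : ι → Marks) (c : ι) :
    ¬ Delivers (interarrivals z) (services z) c 0 := by
  rintro ⟨p, hp, _⟩
  simp [server] at hp

/-- The merged order puts all packets up to time `t` before all later ones. As long as some source
has an unread packet up to time `t`, the next packet comes up to time `t`, so no count exceeds
`numBefore`; since the counts after `n` packets sum to `n`, they all equal `numBefore` after `∑ i,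
numBefore t (z i)` packets. From then on both systems compare the same times up to the shift by `t`,
and without ties they choose the same source. -/
theorem counts_add_residual {z : ι → Marks} (h : IsRegular z) (t : ℝ) :
    (∀ n ≤ ∑ i, numBefore t (z i), ∀ i, counts (interarrivals z) n i ≤ numBefore t (z i)) ∧
    (∀ n < ∑ i, numBefore t (z i), (packet (interarrivals z) (services z) n).gen ≤ t) ∧
    ∀ m, counts (interarrivals z) (∑ i, numBefore t (z i) + m) = fun i => numBefore t (z i) +
      counts (interarrivals fun i => residual t (z i)) m i := by
  have hsum : ∀ n, ∑ i, counts (interarrivals z) n i = n := by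
    intro n
    induction n with
    | zero => simp [counts]
    | succ n ih =>
      rw [counts_succ, Finset.sum_update_of_mem (Finset.mem_univ _)]
      rw [← Finset.add_sum_erase _ _ (Finset.mem_univ (nextSource (interarrivals z)
        (counts (interarrivals z) n))), Finset.erase_eq] at ih
      omega
  have hspec := fun i => numBefore_spec (h.exists_lt i t)
  have hgen : ∀ n, (∀ i, counts (interarrivals z) n i ≤ numBefore t (z i)) →
      n < ∑ i, numBefore t (z i) → (packet (interarrivals z) (services z) n).gen ≤ t ∧
        ∀ i, counts (interarrivals z) (n + 1) i ≤ numBefore t (z i) := by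
    intro n hle hn
    obtain ⟨i, hi⟩ : ∃ i, counts (interarrivals z) n i < numBefore t (z i) := by
      by_contra! hcon
      have := Finset.sum_le_sum fun i (_ : i ∈ Finset.univ) => hcon i
      rw [hsum] at this
      omega
    have h1 := nextSource_le (interarrivals z) (counts (interarrivals z) n) i
    have h2 : arrivalTime (interarrivals z) i (counts (interarrivals z) n i) ≤ t := (hspec i).1 _ hi
    set j := nextSource (interarrivals z) (counts (interarrivals z) n) with hj
    have h3 : genAt (z j) (counts (interarrivals z) n j) ≤ t := h1.trans h2
    refine ⟨h3, fun i' => ?_⟩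
    rw [counts_succ, ← hj]
    by_cases hi' : i' = j
    · rw [hi', Function.update_self, Nat.succ_le_iff]
      refine lt_of_le_of_ne (hle j) fun heq => ?_
      rw [heq] at h3
      exact not_lt.2 h3 (hspec j).2
    · rw [Function.update_of_ne hi']
      exact hle i'
  have hle : ∀ n ≤ ∑ i, numBefore t (z i), ∀ i, counts (interarrivals z) n i ≤ numBefore t (z i) := by
    intro n
    induction n with
    | zero => intro _ i; simp [counts]
    | succ n ih => intro hn; exact (hgen n (ih (by omega)) (by omega)).2
  refine ⟨hle, fun n hn => (hgen n (hle n hn.le) hn).1, fun m => ?_⟩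
  induction m with
  | zero =>
    have h1 := hle _ le_rfl
    funext i
    simp only [counts, add_zero]
    refine le_antisymm (h1 i) ?_
    by_contra! hlt
    have := Finset.sum_lt_sum (fun i (_ : i ∈ Finset.univ) => h1 i) ⟨i, Finset.mem_univ i, hlt⟩
    rw [hsum] at this
    exact lt_irrefl _ this
  | succ m ih =>
    have hnext : nextSource (interarrivals z) (counts (interarrivals z) (∑ i, numBefore t (z i) + m)) =
        nextSource (interarrivals fun i => residual t (z i))
          (counts (interarrivals fun i => residual t (z i)) m) := by
      refine nextSource_eq fun i hi => ?_
      rw [ih]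
      have h1 := nextSource_le (interarrivals fun i => residual t (z i))
        (counts (interarrivals fun i => residual t (z i)) m) i
      have h2 : ∀ i n, arrivalTime (interarrivals fun i => residual t (z i)) i n =
          genAt (z i) (numBefore t (z i) + n) - t := fun i n => genAt_residual t (z i) n
      rw [h2, h2] at h1
      exact lt_of_le_of_ne (sub_le_sub_iff_right t |>.1 h1) (h.gen_ne_gen _ _ hi.symm _ _)
    rw [← add_assoc, counts_succ, hnext, ih, counts_succ]
    funext i
    by_cases hi : i = nextSource (interarrivals fun i => residual t (z i))
          (counts (interarrivals fun i => residual t (z i)) m)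
    · rw [← hi]; simp [add_assoc]
    · simp [hi]

/-- Let `D` be the time at which the first source `j`, if it were alone, would deliver. Up to `D`
the server always holds the latest packet of `j`: a packet of another source arrives strictly before
the service in progress is complete and is blocked, and a packet of `j` preempts. The packet `M`,
the first one after `D`, finds the server idle, and from there on the system is the residual one
delayed by `D`. -/
theorem IsRegular.firstDelivery {z : ι → Marks} (h : IsRegular z) :
    ∃ M, FirstDelivery z (firstSource z) M (cycleOut z).2.1 (cycleOut z).2.2 (cycleRest z) ∧
      ∀ c, ∀ m < M, ¬ Delivers (interarrivals z) (services z) c m := by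
  obtain ⟨j, hj⟩ := h.isFirst
  have hfs := hj.firstSource_eq
  set D := (busy (z j)).1.1 with hD
  set k := trialIndex (z j) with hk
  have hDk : D = genAt (z j) k + (z j k).2 := by rw [hD, busy_eq]
  have hT : (busy (z j)).1.2 = (z j k).2 := by rw [busy_eq]
  have hNj : numBefore D (z j) = k + 1 := (busy_snd_eq_residual (h.pos j) (h.hasDelivery j)).1
  have hspec := fun i => numBefore_spec (h.exists_lt i D)
  obtain ⟨hle, hgen, hcounts⟩ := counts_add_residual h D
  set M := ∑ i, numBefore D (z i) with hM
  have hM1 : 1 ≤ M := by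
    have := Finset.single_le_sum (fun i _ => Nat.zero_le (numBefore D (z i))) (Finset.mem_univ j)
    omega
  have hcM : counts (interarrivals z) M = fun i => numBefore D (z i) := by
    have := hcounts 0
    simpa [counts] using this
  have hn0 : nextSource (interarrivals z) (counts (interarrivals z) 0) = j := by
    refine nextSource_eq fun i hi => ?_
    have := hj i hi
    simpa [arrivalTime, counts] using this
  -- the generation time of an arriving packet precedes the completion of the packet in service
  have hlt : ∀ n < M, 1 ≤ counts (interarrivals z) n j →
      (packet (interarrivals z) (services z) n).gen <
        (packetOf z j (counts (interarrivals z) n j - 1)).done := by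
    intro n hn hK
    have hg := hgen n hn
    have hle' := hle (n + 1) (by omega)
    have hmin := nextSource_le (interarrivals z) (counts (interarrivals z) n) j
    rw [packet_eq] at hg ⊢
    rw [counts_succ] at hle'
    set K := counts (interarrivals z) n with hKdef
    set i := nextSource (interarrivals z) K
    have hmin' : genAt (z i) (K i) ≤ genAt (z j) (K j) := hmin
    have hg' : genAt (z i) (K i) ≤ D := hg
    change genAt (z i) (K i) < genAt (z j) (K j - 1) + (z j (K j - 1)).2
    have hKj : K j ≤ k + 1 := hNj ▸ hle n hn.le j
    obtain ⟨l, hl⟩ : ∃ l, K j = l + 1 := ⟨K j - 1, by omega⟩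
    rw [hl, Nat.add_sub_cancel]
    -- Strictness matters: a service which ends exactly at an arrival counts as completed, both in
    -- `accept` and in `Delivers`.
    have hfail : l < k → genAt (z j) (l + 1) < genAt (z j) l + (z j l).2 := fun hlk => by
      have h1 := (h.hasDelivery j).spec.1 l hlk
      have h2 := h.next_ne_service j l
      rw [genAt_succ]
      linarith [lt_of_le_of_ne h1 h2]
    by_cases hij : i = j
    · have := hle' j
      rw [hij, Function.update_self, hNj] at this
      rw [hij, hl]
      exact hfail (by omega)
    · rcases Nat.lt_or_ge l k with hlk | hlk
      · rw [hl] at hmin'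
        exact hmin'.trans_lt (hfail hlk)
      · have : l = k := by omega
        rw [this, ← hDk]
        refine lt_of_le_of_ne hg' ?_
        rw [hDk]
        exact h.gen_ne_done _ _ hij _ _
  have hserver : ∀ n, n + 1 ≤ M → 1 ≤ counts (interarrivals z) (n + 1) j ∧
      server (interarrivals z) (services z) (n + 1) =
        some (packetOf z j (counts (interarrivals z) (n + 1) j - 1)) := by
    intro n
    induction n with
    | zero =>
      intro _
      have h1 : counts (interarrivals z) (0 + 1) j = 1 := by
        rw [counts_succ, hn0]; simp [counts]
      refine ⟨h1.ge, ?_⟩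
      rw [h1]
      have : packet (interarrivals z) (services z) 0 = packetOf z j 0 := by
        rw [packet_eq, hn0]; simp [counts]
      rw [server, this]
      rfl
    | succ n ih =>
      intro hn
      obtain ⟨h1, h2⟩ := ih (by omega)
      have h3 := hlt (n + 1) (by omega) h1
      rw [server, h2]
      simp only [accept]
      rw [counts_succ (n := n + 1)]
      by_cases hij : nextSource (interarrivals z) (counts (interarrivals z) (n + 1)) = j
      · rw [hij, Function.update_self]
        refine ⟨by omega, ?_⟩
        rw [packet_eq, hij, Nat.add_sub_cancel]
        exact if_pos (Or.inr rfl)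
      · rw [Function.update_of_ne (Ne.symm hij)]
        refine ⟨h1, ?_⟩
        rw [if_neg]
        rw [not_or, not_le]
        exact ⟨h3, fun h' => hij h'.symm⟩
  have hnot : ∀ c, ∀ m < M, ¬ Delivers (interarrivals z) (services z) c m := by
    intro c m hm
    cases m with
    | zero => exact not_delivers_zero z c
    | succ m =>
      rintro ⟨p, hp, _, hp2⟩
      obtain ⟨h1, h2⟩ := hserver m hm.le
      rw [h2, Option.some_inj] at hp
      rw [← hp] at hp2
      exact not_lt.2 hp2 (hlt _ hm h1)
  have hsM : server (interarrivals z) (services z) M = some (packetOf z j k) := by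
    obtain ⟨M', hM'⟩ : ∃ M', M = M' + 1 := ⟨M - 1, by omega⟩
    have := (hserver M' hM'.ge).2
    rw [← hM', hcM] at this
    simpa [hNj] using this
  have hrest : cycleRest z = fun i => residual D (z i) := by
    rw [cycleRest, hfs, restOf_eq h j]
  have hpacket : ∀ m, packet (interarrivals z) (services z) (M + m) =
      (packet (interarrivals (cycleRest z)) (services (cycleRest z)) m).delay D := by
    intro m
    have h2 : ∀ i n, packetOf z i (numBefore D (z i) + n) =
        (packetOf (fun i => residual D (z i)) i n).delay D := fun i n => by
      simp only [packetOf, Packet.delay, genAt_residual, residual_snd, Packet.mk.injEq, true_and]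
      constructor <;> ring
    have hnext : nextSource (interarrivals z) (counts (interarrivals z) (M + m)) =
        nextSource (interarrivals fun i => residual D (z i))
          (counts (interarrivals fun i => residual D (z i)) m) := by
      -- The next source can be read off from the count which increases: if the two choices
      -- differed, the formulas for the counts after `m` and `m + 1` packets would contradict each
      -- other.
      by_contra hne
      have h3 := hcounts m
      have h4 := hcounts (m + 1)
      rw [← add_assoc, counts_succ, h3, counts_succ] at h4
      have h5 := congrFun h4 (nextSource (interarrivals fun i => residual D (z i))
          (counts (interarrivals fun i => residual D (z i)) m))
      rw [h3] at hne
      rw [Function.update_of_ne (Ne.symm hne), Function.update_self] at h5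
      omega
    rw [packet_eq, hnext, hcounts, hrest, packet_eq, h2]
  have hleM : D ≤ (packet (interarrivals z) (services z) M).gen := by
    rw [packet_eq, hcM]
    exact (hspec _).2.le
  refine ⟨M, ⟨⟨?_, ?_⟩, ?_, ?_, hnot _⟩, hnot⟩
  · simp only [cycleOut, hfs]
    exact hpacket
  · simp only [cycleOut, hfs]
    intro m
    induction m with
    | zero =>
      have h1 := hpacket 0
      -- Packet `M` is accepted because the service is over, just as the first packet of the
      -- residual system is accepted by a server which has never been used; this makes the servers
      -- agree from here on.
      have h2 : accept (some (packetOf z j k)) (packet (interarrivals z) (services z) M) =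
          some (packet (interarrivals z) (services z) M) := by
        rw [accept, if_pos]
        left
        change genAt (z j) k + (z j k).2 ≤ _
        rw [← hDk]
        exact hleM
      change accept (server (interarrivals z) (services z) M) _ = _
      rw [hsM, h2, ← add_zero M, h1]
      rfl
    | succ m ih =>
      change accept (server (interarrivals z) (services z) (M + (m + 1)))
        (packet (interarrivals z) (services z) (M + (m + 1))) = _
      rw [ih, hpacket, accept_delay]
      rfl
  · simp only [cycleOut, hfs]
    rw [hsM, ← hD, hT, hDk, packetOf]
    congr 2
    ring
  · simp only [cycleOut, hfs]
    exact hleM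

end Realization

/-! ### One realization: the deliveries of one source -/

section Deliveries

variable {ι : Type*} [Fintype ι] [Nonempty ι] [DecidableEq ι] [MeasurableSpace ι]
  [DiscreteMeasurableSpace ι]

/-- Concatenation of cycles: each cycle before the last shifts the clock by its length, and its only
delivery is that of another source. -/
theorem firstDelivery_of_stopsAt {c : ι} {n : ℕ} {b : ℝ} {z : ι → Marks}
    (hz : ∀ k, IsRegular (cycleRest^[k] z))
    (hn : (sourceRule c).StopsAt cycleOut cycleRest n (b, z)) :
    ∃ M t u, 0 < t ∧ (sourceRule c).value cycleOut cycleRest n (b, z) =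
      ((b + t, u), cycleRest^[n + 1] z) ∧ FirstDelivery z c M t u (cycleRest^[n + 1] z) := by
  have hpos : 0 < (cycleOut z).2.1 :=
    ((hz 0).pos (firstSource z) 0).1.trans_le (head_le_busy ((hz 0).pos _))
  induction n generalizing b z with
  | zero =>
    obtain ⟨M, hM, -⟩ := (hz 0).firstDelivery
    have hc : firstSource z = c := hn
    have hM' : FirstDelivery z (firstSource z) M (cycleOut z).2.1 (cycleOut z).2.2 (cycleRest z) := hM
    rw [hc] at hM'
    exact ⟨M, _, _, hpos, rfl, hM'⟩
  | succ n ih =>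
    obtain ⟨M, hM, hnot⟩ := (hz 0).firstDelivery
    replace hM : FirstDelivery z (firstSource z) M (cycleOut z).2.1 (cycleOut z).2.2
      (cycleRest z) := hM
    have hc : firstSource z ≠ c := hn.1
    obtain ⟨M', t', u, ht', hval, hM'⟩ := ih (b := b + (cycleOut z).2.1) (z := cycleRest z)
      (fun k => hz (k + 1)) hn.2
      (((hz 1).pos (firstSource (cycleRest z)) 0).1.trans_le (head_le_busy ((hz 1).pos _)))
    obtain ⟨m, rfl⟩ : ∃ m, M' = m + 1 := by
      refine Nat.exists_eq_succ_of_ne_zero fun h0 => ?_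
      have := hM'.server_eq
      rw [h0] at this
      simp [server] at this
    refine ⟨M + (m + 1), (cycleOut z).2.1 + t', u, add_pos hpos ht', ?_, hM.continues.trans hM'.continues, ?_, ?_, ?_⟩
    · refine hval.trans ?_
      rw [add_assoc]
      rfl
    · rw [hM.continues.server_eq, hM'.server_eq]
      simp only [Option.map_some, Packet.delay, Option.some_inj, Packet.mk.injEq, true_and]
      constructor <;> ring
    · rw [hM.continues.packet_eq]
      have := hM'.le_gen
      simp only [Packet.delay]
      linarith
    · intro k hk
      rcases Nat.lt_or_ge k M with h1 | h1
      · exact hnot c k h1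
      · obtain ⟨l, rfl⟩ := Nat.exists_eq_add_of_le h1
        cases l with
        | zero =>
          -- Index `M` records the delivery which ends the first cycle, and its source is not `c`.
          rintro ⟨p, hp, hp1, -⟩
          rw [add_zero, hM.server_eq, Option.some_inj] at hp
          rw [← hp] at hp1
          exact hc hp1
        | succ l =>
          rw [hM.continues.delivers_iff]
          exact hM'.not_delivers _ (by omega)

/-- The residual system at the first delivery of source `c`. -/
def sourceRest (c : ι) (z : ι → Marks) : ι → Marks := (sourceCycle c z).2

/-- Delivery time and system time of the first delivered packet of source `c`. -/
def sourceOut (c : ι) (z : ι → Marks) : ℝ × ℝ := (sourceCycle c z).1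

theorem exists_firstDelivery {c : ι} {z : ι → Marks} (hz : ∀ k, IsRegular (cycleRest^[k] z))
    (h : HasSourceDelivery c z) :
    0 < (sourceOut c z).1 ∧
      ∃ M, FirstDelivery z c M (sourceOut c z).1 (sourceOut c z).2 (sourceRest c z) := by
  obtain ⟨n, hn⟩ := h
  obtain ⟨M, t, u, ht, hval, hM⟩ := firstDelivery_of_stopsAt hz hn
  have : sourceCycle c z = ((0 + t, u), cycleRest^[n + 1] z) := hn.final_eq.trans hval
  rw [sourceOut, sourceRest, this, zero_add]
  exact ⟨ht, M, hM⟩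

-- Since delivered packets are enumerated by `Nat.nth`, one needs for each `i` a delivery index
-- preceded by exactly `i` deliveries. The induction replaces `z` by the system `θ z` left at its
-- first delivery, with the times delayed by `d z`.
omit [MeasurableSpace ι] [DiscreteMeasurableSpace ι] in
open Classical in
theorem exists_delivers_count {c : ι} {θ : (ι → Marks) → ι → Marks} {d u : (ι → Marks) → ℝ}
    (i : ℕ) {z : ι → Marks}
    (h : ∀ l, ∃ M, FirstDelivery (θ^[l] z) c M (d (θ^[l] z)) (u (θ^[l] z)) (θ (θ^[l] z))) :
    ∃ n, Delivers (interarrivals z) (services z) c n ∧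
      Nat.count (Delivers (interarrivals z) (services z) c) n = i ∧
      server (interarrivals z) (services z) n =
        some ⟨c, ∑ l ∈ Finset.range (i + 1), d (θ^[l] z) - u (θ^[i] z),
          ∑ l ∈ Finset.range (i + 1), d (θ^[l] z)⟩ := by
  obtain ⟨M, hM⟩ := h 0
  simp only [Function.iterate_zero, id] at hM
  have hdel : Delivers (interarrivals z) (services z) c M := ⟨_, hM.server_eq, rfl, hM.le_gen⟩
  have hcount : Nat.count (Delivers (interarrivals z) (services z) c) M = 0 :=
    Nat.count_iff_forall_not.2 hM.not_delivers
  induction i generalizing z M with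
  | zero => exact ⟨M, hdel, hcount, by simpa using hM.server_eq⟩
  | succ i ih =>
    have h' : ∀ l, ∃ M, FirstDelivery (θ^[l] (θ z)) c M (d (θ^[l] (θ z))) (u (θ^[l] (θ z)))
        (θ (θ^[l] (θ z))) := fun l => h (l + 1)
    obtain ⟨M', hM'⟩ := h' 0
    simp only [Function.iterate_zero, id] at hM'
    obtain ⟨n', h1, h2, h3⟩ := ih h' M' hM' ⟨_, hM'.server_eq, rfl, hM'.le_gen⟩
      (Nat.count_iff_forall_not.2 hM'.not_delivers)
    obtain ⟨m, rfl⟩ : ∃ m, n' = m + 1 := by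
      refine Nat.exists_eq_succ_of_ne_zero fun h0 => ?_
      rw [h0] at h1
      exact not_delivers_zero _ _ h1
    refine ⟨M + (m + 1), (hM.continues.delivers_iff c m).2 h1, ?_, ?_⟩
    -- There is no delivery before index `M`, and one at `M`; index 0 of the residual system is
    -- never a delivery, which compensates the shift between `m` and `m + 1`.
    · rw [Nat.count_add, hcount, zero_add, Nat.count_succ']
      rw [Nat.count_succ', if_neg (not_delivers_zero _ _), add_zero] at h2
      simp only [add_zero, hdel, if_true]
      simp only [hM.continues.delivers_iff, h2]
    · rw [hM.continues.server_eq, h3, Finset.sum_range_succ' _ (i + 1)]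
      simp only [Option.map_some, Packet.delay, Option.some_inj, Packet.mk.injEq, true_and,
        Function.iterate_succ_apply, Function.iterate_zero, id, and_true]
      ring

/-- Time from the `i - 1`-st to the `i`-th delivery of source `c` (for `i = 0`, the time of the first
delivery). -/
def gap (c : ι) (i : ℕ) (z : ι → Marks) : ℝ := (sourceOut c ((sourceRest c)^[i] z)).1

/-- System time of the `i`-th delivered packet of source `c`. -/
def sojourn (c : ι) (i : ℕ) (z : ι → Marks) : ℝ := (sourceOut c ((sourceRest c)^[i] z)).2

/-- All the cycles of the realization are regular. -/
def IsRegularOrbit (c : ι) (z : ι → Marks) : Prop :=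
  ∀ l, HasSourceDelivery c ((sourceRest c)^[l] z) ∧
    ∀ k, IsRegular (cycleRest^[k] ((sourceRest c)^[l] z))

theorem IsRegularOrbit.deliveredPacket_eq {c : ι} {z : ι → Marks} (h : IsRegularOrbit c z) (i : ℕ) :
    deliveredPacket (interarrivals z) (services z) c i =
      some ⟨c, ∑ l ∈ Finset.range (i + 1), gap c l z - sojourn c i z,
        ∑ l ∈ Finset.range (i + 1), gap c l z⟩ := by
  classical
  obtain ⟨n, h1, h2, h3⟩ := exists_delivers_count (c := c) (θ := sourceRest c)
    (d := fun z => (sourceOut c z).1) (u := fun z => (sourceOut c z).2) i (z := z)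
    (fun l => (exists_firstDelivery (h l).2 (h l).1).2)
  rw [deliveredPacket, ← h2, Nat.nth_count h1, h3, h2]
  rfl

theorem IsRegularOrbit.gap_pos {c : ι} {z : ι → Marks} (h : IsRegularOrbit c z) (i : ℕ) :
    0 < gap c i z := (exists_firstDelivery (h i).2 (h i).1).1

theorem IsRegularOrbit.deliveryTime_eq {c : ι} {z : ι → Marks} (h : IsRegularOrbit c z) (i : ℕ) :
    deliveryTime (interarrivals z) (services z) c i = ∑ l ∈ Finset.range (i + 1), gap c l z := by
  rw [deliveryTime, h.deliveredPacket_eq]; rfl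

theorem IsRegularOrbit.genTime_eq {c : ι} {z : ι → Marks} (h : IsRegularOrbit c z) (i : ℕ) :
    genTime (interarrivals z) (services z) c i =
      ∑ l ∈ Finset.range (i + 1), gap c l z - sojourn c i z := by
  rw [genTime, h.deliveredPacket_eq]; rfl

theorem IsRegularOrbit.interdepartureTime_eq {c : ι} {z : ι → Marks} (h : IsRegularOrbit c z)
    (i : ℕ) : interdepartureTime (interarrivals z) (services z) c i = gap c (i + 1) z := by
  rw [interdepartureTime, h.deliveryTime_eq, h.deliveryTime_eq, Finset.sum_range_succ _ (i + 1)]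
  ring

theorem IsRegularOrbit.peakAoI_eq {c : ι} {z : ι → Marks} (h : IsRegularOrbit c z)
    (i : ℕ) : peakAoI (interarrivals z) (services z) c i = gap c (i + 1) z + sojourn c i z := by
  rw [peakAoI, h.interdepartureTime_eq, systemTime, h.deliveryTime_eq, h.genTime_eq]
  ring

end Deliveries

/-! ### Almost every realization is regular -/

section AlmostSure

variable {ι : Type*} [Fintype ι] [Nonempty ι] [DecidableEq ι]
  {lam : ι → ℝ} {ν : Measure ℝ} [IsProbabilityMeasure ν]
  [∀ j, IsProbabilityMeasure (markLaw (lam j) ν)]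

/-- For `n = 0`, the service time is independent of the interarrival time after it, which has no
atoms; the tail has the same law, which gives the other indices. This turns each preemption into a
strict inequality. -/
theorem ae_next_ne_service {r : ℝ} (hr : 0 < r) [IsProbabilityMeasure (markLaw r ν)] (n : ℕ) :
    ∀ᵐ z ∂(iidLaw (markLaw r ν)), (z (n + 1)).1 ≠ (z n).2 := by
  have hreg := isRegenerative_seqTail (markLaw r ν)
  induction n with
  | zero =>
    have hm : MeasurableSet {z : Marks | (z (0 + 1)).1 = (z 0).2} :=
      measurableSet_eq_fun (by fun_prop) (by fun_prop)
    rw [ae_iff]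
    simp only [ne_eq, not_not]
    have h1 := hreg.lintegral_eq (F := {p : (ℝ × ℝ) × Marks | (p.2 0).1 = p.1.2}.indicator 1)
      (measurable_one.indicator (measurableSet_eq_fun (by fun_prop) (by fun_prop)))
    rw [← lintegral_indicator_one hm]
    refine Eq.trans ?_ (h1.trans ?_)
    · rfl
    · refine (lintegral_congr fun a => ?_).trans lintegral_zero
      rw [← measure_genAt_eq (ν := ν) hr 0 a.2,
        ← lintegral_indicator_one (show MeasurableSet {ζ : Marks | genAt ζ 0 = a.2} from
          measurable_genAt 0 (measurableSet_singleton _))]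
      refine lintegral_congr fun z => ?_
      by_cases h : (z 0).1 = a.2
      · rw [Set.indicator_of_mem (by exact h),
          Set.indicator_of_mem (show z ∈ {ζ : Marks | genAt ζ 0 = a.2} by simpa using h)]
        rfl
      · rw [Set.indicator_of_notMem (by exact h),
          Set.indicator_of_notMem (show z ∉ {ζ : Marks | genAt ζ 0 = a.2} by simpa using h)]
  | succ n ih => exact hreg.preserving.quasiMeasurePreserving.ae ih

theorem ae_isRegular (hν : ∀ᵐ y ∂ν, 0 ≤ y) (hlam : ∀ j, 0 < lam j) :
    ∀ᵐ z ∂(systemLaw lam ν), IsRegular z := by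
  have hsource : ∀ j, ∀ p : Marks → Prop, (∀ᵐ z ∂(iidLaw (markLaw (lam j) ν)), p z) →
      ∀ᵐ z ∂(systemLaw lam ν), p (z j) := fun j p h =>
    (measurePreserving_eval (fun j => iidLaw (markLaw (lam j) ν)) j).quasiMeasurePreserving.ae h
  have h1 := ae_all_iff.2 fun j => hsource j _ (ae_mark_iidLaw (ν := ν) hν (hlam j))
  have h2 := ae_all_iff.2 fun j => hsource j _ (ae_exists_lt_genAt (ν := ν) (hlam j))
  have h3 := ae_all_iff.2 fun j => hsource j _ (ae_hasDelivery (ν := ν) hν (hlam j))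
  have h4 := ae_exists_isFirst (ν := ν) hlam
  have h5 : ∀ᵐ z ∂(systemLaw lam ν), ∀ i j, i ≠ j → ∀ n m, genAt (z i) n ≠ genAt (z j) m := by
    refine ae_all_iff.2 fun i => ae_all_iff.2 fun j => ?_
    by_cases hij : i = j
    · exact .of_forall fun _ h => absurd hij h
    · have := ae_all_iff.2 fun n => ae_all_iff.2 fun m =>
        ae_genAt_ne (ν := ν) hlam hij n (measurable_genAt m)
      filter_upwards [this] with z hz _ using hz
  have h6 : ∀ᵐ z ∂(systemLaw lam ν), ∀ i j, i ≠ j → ∀ n m,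
      genAt (z i) n ≠ genAt (z j) m + (z j m).2 := by
    refine ae_all_iff.2 fun i => ae_all_iff.2 fun j => ?_
    by_cases hij : i = j
    · exact .of_forall fun _ h => absurd hij h
    · have := ae_all_iff.2 fun n => ae_all_iff.2 fun m =>
        ae_genAt_ne (ν := ν) hlam hij n (h := fun ζ => genAt ζ m + (ζ m).2)
          ((measurable_genAt m).add (by fun_prop))
      filter_upwards [this] with z hz _ using hz
  have h7 := ae_all_iff.2 fun j => hsource j _
    (ae_all_iff.2 fun n => ae_next_ne_service (ν := ν) (hlam j) n)
  filter_upwards [h1, h2, h3, h4, h5, h6, h7] with z h1 h2 h3 h4 h5 h6 h7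
  exact ⟨h1, h2, h3, h4, h5, h6, h7⟩

theorem ae_isRegularOrbit [MeasurableSpace ι] [DiscreteMeasurableSpace ι]
    (hν : ∀ᵐ y ∂ν, 0 ≤ y) (hlam : ∀ j, 0 < lam j) (c : ι) :
    ∀ᵐ z ∂(systemLaw lam ν), IsRegularOrbit c z := by
  refine ae_all_iff.2 fun l => ?_
  have h1 : ∀ᵐ z ∂(systemLaw lam ν), HasSourceDelivery c z ∧ ∀ k, IsRegular (cycleRest^[k] z) := by
    refine (ae_hasSourceDelivery hν hlam c).and (ae_all_iff.2 fun k => ?_)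
    exact ((isRegenerative_cycle hν hlam).preserving.iterate k).quasiMeasurePreserving.ae
      (ae_isRegular hν hlam)
  exact ((isRegenerative_sourceCycle hν hlam c).preserving.iterate l).quasiMeasurePreserving.ae h1

end AlmostSure

/-! ### Averages -/

theorem tendsto_natDiv_div (a : ℕ) :
    Tendsto (fun n : ℕ => (((n + a) / 2 : ℕ) : ℝ) / n) atTop (𝓝 (1 / 2)) := by
  have h1 : Tendsto (fun n : ℕ => ((a : ℝ) + 1) / n) atTop (𝓝 0) :=
    tendsto_const_div_atTop_nhds_zero_nat _
  rw [tendsto_iff_dist_tendsto_zero]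
  refine squeeze_zero' (.of_forall fun _ => dist_nonneg) ?_ h1
  filter_upwards [eventually_gt_atTop 0] with n hn
  have hn' : (0 : ℝ) < n := by exact_mod_cast hn
  have h2 : ((2 * ((n + a) / 2) : ℕ) : ℝ) ≤ (n + a : ℕ) := by exact_mod_cast Nat.mul_div_le _ _
  have h3 : ((n + a : ℕ) : ℝ) ≤ (2 * ((n + a) / 2) + 1 : ℕ) := by
    have := Nat.div_add_mod (n + a) 2
    have := Nat.mod_lt (n + a) two_pos
    exact_mod_cast (by omega)
  push_cast at h2 h3
  have h4 : (((n + a) / 2 : ℕ) : ℝ) / n - 1 / 2 = ((((n + a) / 2 : ℕ) : ℝ) - n / 2) / n := by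
    field_simp
  rw [Real.dist_eq, h4, abs_div, abs_of_pos hn']
  refine div_le_div_of_nonneg_right ?_ hn'.le
  have ha : (0 : ℝ) ≤ a := Nat.cast_nonneg a
  rw [abs_le]
  constructor <;> linarith

theorem sum_range_eq_even_add_odd (x : ℕ → ℝ) (n : ℕ) :
    ∑ i ∈ Finset.range n, x i = ∑ k ∈ Finset.range ((n + 1) / 2), x (2 * k) +
      ∑ k ∈ Finset.range ((n + 0) / 2), x (2 * k + 1) := by
  induction n with
  | zero => simp
  | succ n ih =>
    rw [Finset.sum_range_succ, ih]
    rcases Nat.even_or_odd' n with ⟨k, rfl | rfl⟩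
    · rw [show (2 * k + 1 + 1) / 2 = k + 1 by omega, show (2 * k + 1) / 2 = k by omega,
        show (2 * k + 0) / 2 = k by omega, Finset.sum_range_succ _ k]
      ring
    · rw [show (2 * k + 1 + 1 + 1) / 2 = k + 1 by omega, show (2 * k + 1 + 1) / 2 = k + 1 by omega,
        show (2 * k + 1 + 0) / 2 = k by omega, Finset.sum_range_succ (fun k => x (2 * k + 1)) k]
      ring

/-- Among the first `n` indices there are `(n + 1) / 2` even and `n / 2` odd ones, so each parity
class has asymptotic weight `1 / 2`. -/
theorem tendsto_average_of_even_odd {x : ℕ → ℝ} {L : ℝ}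
    (he : Tendsto (fun n : ℕ => (∑ k ∈ Finset.range n, x (2 * k)) / n) atTop (𝓝 L))
    (ho : Tendsto (fun n : ℕ => (∑ k ∈ Finset.range n, x (2 * k + 1)) / n) atTop (𝓝 L)) :
    Tendsto (fun n : ℕ => (∑ k ∈ Finset.range n, x k) / n) atTop (𝓝 L) := by
  have hdiv : ∀ a : ℕ, Tendsto (fun n : ℕ => (n + a) / 2) atTop atTop := fun a =>
    tendsto_atTop_atTop.2 fun b => ⟨2 * b, fun n hn => by omega⟩
  have h1 := (he.comp (hdiv 1)).mul (tendsto_natDiv_div 1)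
  have h2 := (ho.comp (hdiv 0)).mul (tendsto_natDiv_div 0)
  have h3 := h1.add h2
  rw [show L * (1 / 2) + L * (1 / 2) = L by ring] at h3
  refine h3.congr' ?_
  filter_upwards [eventually_gt_atTop 1] with n hn
  have e1 : (((n + 1) / 2 : ℕ) : ℝ) ≠ 0 := by
    have : (n + 1) / 2 ≠ 0 := by omega
    exact_mod_cast this
  have e0 : (((n + 0) / 2 : ℕ) : ℝ) ≠ 0 := by
    have : (n + 0) / 2 ≠ 0 := by omega
    exact_mod_cast this
  simp only [Function.comp_apply]
  rw [div_mul_div_cancel₀ e1, div_mul_div_cancel₀ e0, ← add_div, ← sum_range_eq_even_add_odd]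

/-- The strong law of large numbers for a function of two consecutive independent and identically
distributed variables. -/
theorem strong_law_consecutive {Ω E : Type*} [MeasurableSpace Ω] [MeasurableSpace E]
    {P : Measure Ω} [IsProbabilityMeasure P] {U : ℕ → Ω → E} (hU : ∀ n, Measurable (U n))
    (hindep : iIndepFun U P) (hident : ∀ n, IdentDistrib (U n) (U 0) P P) {r : E × E → ℝ}
    (hr : Measurable r) (hint : Integrable (fun ω => r (U 0 ω, U 1 ω)) P) :
    ∀ᵐ ω ∂P, Tendsto (fun n : ℕ => (∑ i ∈ Finset.range n, r (U i ω, U (i + 1) ω)) / n) atTop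
      (𝓝 (∫ ω, r (U 0 ω, U 1 ω) ∂P)) := by
  have hpair : ∀ n, IdentDistrib (fun ω => r (U n ω, U (n + 1) ω)) (fun ω => r (U 0 ω, U 1 ω)) P P := by
    intro n
    have h1 : IdentDistrib (fun ω => (U n ω, U (n + 1) ω)) (fun ω => (U 0 ω, U 1 ω)) P P := by
      refine ⟨((hU n).prodMk (hU _)).aemeasurable, ((hU 0).prodMk (hU _)).aemeasurable, ?_⟩
      rw [(indepFun_iff_map_prod_eq_prod_map_map (hU _).aemeasurable (hU _).aemeasurable).1
        (hindep.indepFun (Nat.succ_ne_self n).symm),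
        (indepFun_iff_map_prod_eq_prod_map_map (hU _).aemeasurable (hU _).aemeasurable).1
        (hindep.indepFun zero_ne_one), (hident n).map_eq, (hident (n + 1)).map_eq,
        (hident 1).map_eq]
    exact h1.comp hr
  -- Consecutive pairs overlap, but those starting at indices of one parity are disjoint, hence
  -- independent; the classical strong law applies to each parity class.
  have hsub : ∀ a, ∀ᵐ ω ∂P, Tendsto (fun n : ℕ =>
      (∑ k ∈ Finset.range n, r (U (2 * k + a) ω, U (2 * k + a + 1) ω)) / n) atTop
      (𝓝 (∫ ω, r (U 0 ω, U 1 ω) ∂P)) := by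
    intro a
    have h1 := strong_law_ae_real (μ := P) (fun k ω => r (U (2 * k + a) ω, U (2 * k + a + 1) ω))
      ((hpair _).integrable_iff.2 hint) ?_ ?_
    · filter_upwards [h1] with ω hω
      rwa [(hpair _).integral_eq] at hω
    · intro k l hkl
      exact (hindep.indepFun_prodMk_prodMk hU (2 * k + a) (2 * k + a + 1) (2 * l + a) (2 * l + a + 1)
        (by omega) (by omega) (by omega) (by omega)).comp hr hr
    · exact fun k => (hpair _).trans (hpair _).symm
  filter_upwards [hsub 0, hsub 1] with ω h0 h1
  exact tendsto_average_of_even_odd h0 h1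

/-- The long-run fraction of time which a process spends in `B`, if it starts from `u i` at the times
`t i` and increases at unit rate in between. -/
theorem tendsto_fraction_of_time {δ : ℝ → ℝ} {g u : ℕ → ℝ} {B : Set ℝ} (hB : MeasurableSet B)
    (hg : ∀ i, 0 < g i)
    (hδ : ∀ i t, ∑ l ∈ Finset.range (i + 1), g l ≤ t → t < ∑ l ∈ Finset.range (i + 2), g l →
      δ t = t - (∑ l ∈ Finset.range (i + 1), g l - u i)) {m ρ : ℝ} (hm : 0 < m)
    (hgm : Tendsto (fun n : ℕ => (∑ i ∈ Finset.range n, g i) / n) atTop (𝓝 m))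
    (hρ : Tendsto (fun n : ℕ => (∑ i ∈ Finset.range n,
      volume.real {v | v ∈ Set.Ico 0 (g (i + 1)) ∧ u i + v ∈ B}) / n) atTop (𝓝 ρ)) :
    Tendsto (fun τ : ℝ => volume.real {t : ℝ | t ∈ Set.Icc 0 τ ∧ δ t ∈ B} / τ) atTop
      (𝓝 (ρ / m)) := by
  set G : ℕ → ℝ := fun n => ∑ l ∈ Finset.range n, g l with hG
  have hGs : ∀ n, G (n + 1) = G n + g n := fun n => Finset.sum_range_succ _ _
  have hGmono : StrictMono G := strictMono_nat_of_lt_succ fun n => by rw [hGs]; linarith [hg n]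
  have hG0 : G 0 = 0 := by simp [hG]
  set R : ℕ → ℝ := fun i => volume.real {v | v ∈ Set.Ico 0 (g (i + 1)) ∧ u i + v ∈ B} with hR
  set C : ℕ → Set ℝ := fun n => {t | t ∈ Set.Ico (G 1) (G (n + 1)) ∧ δ t ∈ B} with hC
  -- After the delivery at time `G (n + 1)` the process is `u n + v` with `v` the time since then,
  -- so the time spent in `B` is measured after a translation.
  have hpiece : ∀ n, {t | t ∈ Set.Ico (G (n + 1)) (G (n + 2)) ∧ δ t ∈ B} =
      (fun t => t - G (n + 1)) ⁻¹' {v | v ∈ Set.Ico 0 (g (n + 1)) ∧ u n + v ∈ B} := by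
    intro n
    ext t
    simp only [Set.mem_ofPred_eq, Set.mem_Ico, Set.mem_preimage, hGs (n + 1)]
    constructor
    · rintro ⟨⟨h1, h2⟩, h3⟩
      rw [hδ n t h1 (show t < G (n + 2) by rw [hGs (n + 1)]; exact h2)] at h3
      refine ⟨⟨by linarith, by linarith⟩, ?_⟩
      convert! h3 using 1
      simp only [hG]
      ring
    · rintro ⟨⟨h1, h2⟩, h3⟩
      have h4 : G (n + 1) ≤ t := by linarith
      have h5 : t < G (n + 1) + g (n + 1) := by linarith
      refine ⟨⟨h4, h5⟩, ?_⟩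
      rw [hδ n t h4 (show t < G (n + 2) by rw [hGs (n + 1)]; exact h5)]
      convert! h3 using 1
      simp only [hG]
      ring
  have hpm : ∀ n, MeasurableSet {t | t ∈ Set.Ico (G (n + 1)) (G (n + 2)) ∧ δ t ∈ B} := by
    intro n
    rw [hpiece]
    have : MeasurableSet {v | v ∈ Set.Ico 0 (g (n + 1)) ∧ u n + v ∈ B} :=
      measurableSet_Ico.inter ((measurable_const_add (u n)) hB)
    exact (measurable_sub_const _) this
  have hpv : ∀ n, volume.real {t | t ∈ Set.Ico (G (n + 1)) (G (n + 2)) ∧ δ t ∈ B} = R n := by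
    intro n
    rw [hpiece]
    simp only [hR, measureReal_def]
    congr 1
    simp only [sub_eq_add_neg]
    exact measure_preimage_add_right _ _ _
  have hfin : ∀ a b : ℝ, ∀ p : ℝ → Prop, volume {t | t ∈ Set.Ico a b ∧ p t} ≠ ∞ := fun a b p =>
    ((measure_mono fun t ht => ht.1).trans_lt measure_Ico_lt_top).ne
  have hCR : ∀ n, volume.real (C n) = ∑ i ∈ Finset.range n, R i := by
    intro n
    induction n with
    | zero =>
      have : C 0 = ∅ := Set.eq_empty_of_forall_notMem fun t ht => not_lt.2 ht.1.1 ht.1.2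
      simp [this]
    | succ n ih =>
      have h1 : C (n + 1) = C n ∪ {t | t ∈ Set.Ico (G (n + 1)) (G (n + 2)) ∧ δ t ∈ B} := by
        ext t
        simp only [hC, Set.mem_ofPred_eq, Set.mem_Ico, Set.mem_union]
        have h2 : G 1 ≤ G (n + 1) := hGmono.monotone (by omega)
        have h3 : G (n + 1) ≤ G (n + 2) := hGmono.monotone (by omega)
        constructor
        · rintro ⟨⟨h4, h5⟩, h6⟩
          rcases lt_or_ge t (G (n + 1)) with h7 | h7
          · exact Or.inl ⟨⟨h4, h7⟩, h6⟩
          · exact Or.inr ⟨⟨h7, h5⟩, h6⟩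
        · rintro (⟨⟨h4, h5⟩, h6⟩ | ⟨⟨h4, h5⟩, h6⟩)
          · exact ⟨⟨h4, h5.trans_le h3⟩, h6⟩
          · exact ⟨⟨h2.trans h4, h5⟩, h6⟩
      rw [h1, measureReal_union _ (hpm n) (hfin _ _ _) (hfin _ _ _), ih, hpv, Finset.sum_range_succ]
      exact Set.disjoint_left.2 fun t h4 h5 => not_lt.2 h5.1.1 h4.1.2
  -- the number of deliveries up to time `τ`
  have hGtop : Tendsto G atTop atTop := by
    have h1 : Tendsto (fun n : ℕ => (∑ i ∈ Finset.range n, g i) / n * n) atTop atTop :=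
      hgm.pos_mul_atTop hm tendsto_natCast_atTop_atTop
    refine h1.congr' ?_
    filter_upwards [eventually_gt_atTop 0] with n hn
    have : (n : ℝ) ≠ 0 := by exact_mod_cast hn.ne'
    rw [div_mul_cancel₀ _ this]
  have hex : ∀ τ : ℝ, ∃ n, τ < G (n + 1) := fun τ => by
    obtain ⟨n, hn⟩ := (hGtop.eventually_gt_atTop τ).exists
    exact ⟨n, hn.trans (hGmono (Nat.lt_succ_self n))⟩
  classical
  let N : ℝ → ℕ := fun τ => Nat.find (hex τ)
  have hN1 : ∀ τ, τ < G (N τ + 1) := fun τ => Nat.find_spec (hex τ)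
  have hN2 : ∀ τ, 0 ≤ τ → G (N τ) ≤ τ := fun τ hτ => by
    rcases h0 : N τ with _ | k
    · rw [hG0]; exact hτ
    · exact not_lt.1 (Nat.find_min (hex τ) (show k < N τ by omega))
  have hNtop : Tendsto N atTop atTop := by
    refine tendsto_atTop.2 fun k => ?_
    filter_upwards [eventually_ge_atTop (G k)] with τ hτ
    by_contra! hlt
    have : G (N τ + 1) ≤ G k := hGmono.monotone hlt
    linarith [hN1 τ]
  have hRnn : ∀ i, 0 ≤ R i := fun i => measureReal_nonneg
  -- Sandwich between complete cycles: by time `τ` at least `N τ - 1` cycles are over, and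
  -- everything up to `τ` is covered by `N τ` cycles and the initial stretch before `G 1`, on which
  -- nothing is known about `δ`. For `N τ = 0` the truncated subtraction gives an empty sum.
  have hlow : ∀ τ, 0 ≤ τ → ∑ i ∈ Finset.range (N τ - 1), R i ≤
      volume.real {t : ℝ | t ∈ Set.Icc 0 τ ∧ δ t ∈ B} := by
    intro τ hτ
    rw [← hCR]
    refine measureReal_mono ?_ ?_
    · rintro t ⟨⟨h1, h2⟩, h3⟩
      have hG1 : 0 ≤ G 1 := hG0 ▸ hGmono.monotone zero_le_one
      rcases Nat.eq_zero_or_pos (N τ) with h0 | h0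
      · rw [h0] at h2
        exact absurd h1 (not_le.2 h2)
      · rw [Nat.sub_add_cancel h0] at h2
        exact ⟨⟨hG1.trans h1, h2.le.trans (hN2 τ hτ)⟩, h3⟩
    · exact ((measure_mono fun t ht => ht.1).trans_lt measure_Icc_lt_top).ne
  have hup : ∀ τ, 0 ≤ τ → volume.real {t : ℝ | t ∈ Set.Icc 0 τ ∧ δ t ∈ B} ≤
      G 1 + ∑ i ∈ Finset.range (N τ), R i := by
    intro τ hτ
    have hG1 : 0 ≤ G 1 := hG0 ▸ hGmono.monotone zero_le_one
    have h1 : {t : ℝ | t ∈ Set.Icc 0 τ ∧ δ t ∈ B} ⊆ Set.Ico 0 (G 1) ∪ C (N τ) := by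
      rintro t ⟨⟨h1, h2⟩, h3⟩
      rcases lt_or_ge t (G 1) with h4 | h4
      · exact Or.inl ⟨h1, h4⟩
      · exact Or.inr ⟨⟨h4, h2.trans_lt (hN1 τ)⟩, h3⟩
    refine (measureReal_mono h1 ?_).trans ((measureReal_union_le _ _).trans ?_)
    · exact (measure_union_lt_top measure_Ico_lt_top (hfin _ _ _).lt_top).ne
    · rw [hCR, Real.volume_real_Ico_of_le hG1, sub_zero]
  have hn0 : Tendsto (fun n : ℕ => ((n : ℝ))⁻¹) atTop (𝓝 0) := tendsto_inv_atTop_nhds_zero_nat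
  have hup' : Tendsto (fun n : ℕ => (G 1 + ∑ i ∈ Finset.range n, R i) / G n) atTop (𝓝 (ρ / m)) := by
    have h1 := ((hn0.const_mul (G 1)).add hρ).div hgm hm.ne'
    rw [mul_zero, zero_add] at h1
    refine h1.congr' ?_
    filter_upwards [eventually_gt_atTop 0] with n hn
    have : (n : ℝ) ≠ 0 := by exact_mod_cast hn.ne'
    simp only [Pi.div_apply]
    rw [← div_eq_mul_inv, ← add_div, div_div_div_cancel_right₀ this]
  have hlow' : Tendsto (fun n : ℕ => (∑ i ∈ Finset.range (n - 1), R i) / G (n + 1)) atTop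
      (𝓝 (ρ / m)) := by
    have e1 : Tendsto (fun n : ℕ => ((n : ℝ) - 1) / (n + 1)) atTop (𝓝 1) := by
      have := tendsto_natCast_div_add_atTop (1 : ℝ)
      have h2 := this.sub ((tendsto_const_nhds (x := (1 : ℝ))).div_atTop
        (tendsto_natCast_atTop_atTop.atTop_add (tendsto_const_nhds (x := (1 : ℝ)))))
      rw [sub_zero] at h2
      refine h2.congr fun n => ?_
      rw [sub_div]
    have h1 := ((hρ.comp (tendsto_sub_atTop_nat 1)).mul e1).div
      (hgm.comp (tendsto_add_atTop_nat 1)) hm.ne'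
    rw [mul_one] at h1
    refine h1.congr' ?_
    filter_upwards [eventually_gt_atTop 1] with n hn
    have h2 : ((n - 1 : ℕ) : ℝ) = n - 1 := by rw [Nat.cast_sub hn.le]; simp
    have h3 : (n : ℝ) - 1 ≠ 0 := by
      have : (1 : ℝ) < n := by exact_mod_cast hn
      linarith
    have h4 : (n : ℝ) + 1 ≠ 0 := by positivity
    simp only [Pi.div_apply, Function.comp_apply, h2]
    rw [div_mul_div_cancel₀ h3, Nat.cast_add, Nat.cast_one, div_div_div_cancel_right₀ h4]
  refine tendsto_of_tendsto_of_tendsto_of_le_of_le' (hlow'.comp hNtop) (hup'.comp hNtop) ?_ ?_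
  · filter_upwards [eventually_gt_atTop 0] with τ hτ
    exact div_le_div₀ measureReal_nonneg (hlow τ hτ.le) hτ (hN1 τ).le
  · filter_upwards [eventually_gt_atTop 0, hNtop.eventually_gt_atTop 0] with τ hτ hNτ
    have h1 : 0 < G (N τ) := hG0 ▸ hGmono hNτ
    refine div_le_div₀ ?_ (hup τ hτ.le) h1 (hN2 τ hτ.le)
    exact add_nonneg (hG0 ▸ hGmono.monotone zero_le_one) (Finset.sum_nonneg fun i _ => hRnn i)

/-! ### The age law of a sequence of independent cycles -/

section AgeLaw

/-- The stationary age when the pairs of cycle length and initial age in the next cycle are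
independent with law `κ`. -/
def ageLaw (κ : Measure (ℝ × ℝ)) : Measure ℝ :=
  (∫⁻ p, ENNReal.ofReal p.1 ∂κ)⁻¹ •
    (((κ.prod κ).prod volume).restrict {q | q.2 ∈ Set.Ico 0 q.1.2.1}).map fun q => q.1.1.2 + q.2

theorem measurableSet_ageRegion :
    MeasurableSet {q : ((ℝ × ℝ) × (ℝ × ℝ)) × ℝ | q.2 ∈ Set.Ico 0 q.1.2.1} :=
  (measurableSet_le measurable_const measurable_snd).inter
    (measurableSet_lt measurable_snd (by fun_prop))

theorem lintegral_ageLaw (κ : Measure (ℝ × ℝ)) [SFinite κ] {f : ℝ → ℝ≥0∞} (hf : Measurable f) :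
    ∫⁻ x, f x ∂(ageLaw κ) = (∫⁻ p, ENNReal.ofReal p.1 ∂κ)⁻¹ *
      ∫⁻ q : (ℝ × ℝ) × (ℝ × ℝ), (∫⁻ v in Set.Ico 0 q.2.1, f (q.1.2 + v)) ∂(κ.prod κ) := by
  rw [ageLaw, lintegral_smul_measure, smul_eq_mul, lintegral_map hf (by fun_prop),
    ← lintegral_indicator measurableSet_ageRegion, lintegral_prod]
  · congr 1
    refine lintegral_congr fun q => ?_
    rw [← lintegral_indicator measurableSet_Ico]
    rfl
  · refine (Measurable.indicator ?_ measurableSet_ageRegion).aemeasurable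
    fun_prop

theorem lintegral_ofReal_fst_ne {κ : Measure (ℝ × ℝ)} [IsProbabilityMeasure κ]
    (hpos : ∀ᵐ p ∂κ, 0 < p.1) (hint : Integrable Prod.fst κ) :
    ∫⁻ p, ENNReal.ofReal p.1 ∂κ = ENNReal.ofReal (∫ p, p.1 ∂κ) ∧ 0 < ∫ p, p.1 ∂κ := by
  have h0 : 0 ≤ᵐ[κ] fun p => p.1 := hpos.mono fun p h => h.le
  refine ⟨(ofReal_integral_eq_lintegral_ofReal hint h0).symm, ?_⟩
  rw [integral_pos_iff_support_of_nonneg_ae h0 hint, pos_iff_ne_zero]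
  intro h
  have h1 : ∀ᵐ p ∂κ, p ∉ Function.support fun p : ℝ × ℝ => p.1 := measure_eq_zero_iff_ae_notMem.1 h
  obtain ⟨p, h2, h3⟩ := (h1.and hpos).exists
  exact h2 h3.ne'

theorem isProbabilityMeasure_ageLaw {κ : Measure (ℝ × ℝ)} [IsProbabilityMeasure κ]
    (hpos : ∀ᵐ p ∂κ, 0 < p.1) (hint : Integrable Prod.fst κ) :
    IsProbabilityMeasure (ageLaw κ) := by
  refine ⟨?_⟩
  obtain ⟨h1, h2⟩ := lintegral_ofReal_fst_ne hpos hint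
  rw [← lintegral_one, lintegral_ageLaw κ measurable_const]
  have h3 : ∫⁻ q : (ℝ × ℝ) × (ℝ × ℝ), (∫⁻ _v in Set.Ico 0 q.2.1, 1) ∂(κ.prod κ) =
      ∫⁻ p, ENNReal.ofReal p.1 ∂κ := by
    simp only [lintegral_one, Measure.restrict_apply_univ, Real.volume_Ico, sub_zero]
    rw [lintegral_prod _ (by fun_prop)]
    simp
  rw [h3, h1, ENNReal.inv_mul_cancel (ENNReal.ofReal_pos.2 h2).ne' ENNReal.ofReal_ne_top]

theorem lintegral_exp_Ico {s : ℝ} (hs : s ≠ 0) (u : ℝ) {d : ℝ} (hd : 0 ≤ d) :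
    ∫⁻ v in Set.Ico 0 d, ENNReal.ofReal (Real.exp (s * (u + v))) =
      ENNReal.ofReal (Real.exp (s * u)) * ENNReal.ofReal ((Real.exp (s * d) - 1) / s) := by
  have h1 : ∫ v in Set.Ico 0 d, Real.exp (s * v) = (Real.exp (s * d) - 1) / s := by
    rw [integral_Ico_eq_integral_Ioc, ← intervalIntegral.integral_of_le hd]
    rw [intervalIntegral.integral_comp_mul_left (fun x => Real.exp x) hs, integral_exp]
    simp only [mul_zero, Real.exp_zero, smul_eq_mul]
    field_simp
  have h2 : IntegrableOn (fun v => Real.exp (s * v)) (Set.Ico 0 d) :=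
    ((by fun_prop : Continuous fun v => Real.exp (s * v)).continuousOn.integrableOn_Icc
      (a := 0) (b := d)).mono_set Set.Ico_subset_Icc_self
  rw [← h1, ofReal_integral_eq_lintegral_ofReal h2 (.of_forall fun _ => Real.exp_nonneg _),
    ← lintegral_const_mul _ (by fun_prop)]
  refine lintegral_congr fun v => ?_
  rw [← ENNReal.ofReal_mul (Real.exp_nonneg _), ← Real.exp_add, mul_add]

/-- The initial age and the cycle length come from different, independent pairs, so the integral of
`exp (s (u + v))` over the cycle factors into the transforms of the two. -/
theorem lintegral_exp_ageLaw {κ : Measure (ℝ × ℝ)} [IsProbabilityMeasure κ]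
    (hpos : ∀ᵐ p ∂κ, 0 < p.1) {s : ℝ} (hs : s ≠ 0) :
    ∫⁻ x, ENNReal.ofReal (Real.exp (s * x)) ∂(ageLaw κ) = (∫⁻ p, ENNReal.ofReal p.1 ∂κ)⁻¹ *
      ((∫⁻ p, ENNReal.ofReal (Real.exp (s * p.2)) ∂κ) *
        ∫⁻ p, ENNReal.ofReal ((Real.exp (s * p.1) - 1) / s) ∂κ) := by
  rw [lintegral_ageLaw κ (by fun_prop),
    ← lintegral_prod_mul (by fun_prop) (by fun_prop)]
  congr 1
  have h1 : ∀ᵐ q ∂(κ.prod κ), 0 < q.2.1 := Measure.quasiMeasurePreserving_snd.ae hpos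
  refine lintegral_congr_ae ?_
  filter_upwards [h1] with q hq
  exact lintegral_exp_Ico hs _ hq.le

/-- Time which a cycle of length `q.2.1` with initial age `q.1.2` spends in `B`. -/
def timeIn (B : Set ℝ) (q : (ℝ × ℝ) × (ℝ × ℝ)) : ℝ :=
  volume.real {v | v ∈ Set.Ico 0 q.2.1 ∧ q.1.2 + v ∈ B}

theorem measurable_timeIn {B : Set ℝ} (hB : MeasurableSet B) : Measurable (timeIn B) := by
  have : MeasurableSet {q : ((ℝ × ℝ) × (ℝ × ℝ)) × ℝ | q.2 ∈ Set.Ico 0 q.1.2.1 ∧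
      q.1.1.2 + q.2 ∈ B} :=
    measurableSet_ageRegion.inter
      ((by fun_prop : Measurable fun q : ((ℝ × ℝ) × (ℝ × ℝ)) × ℝ => q.1.1.2 + q.2) hB)
  exact (measurable_measure_prodMk_left this).ennreal_toReal

theorem timeIn_le {B : Set ℝ} {q : (ℝ × ℝ) × (ℝ × ℝ)} (hq : 0 ≤ q.2.1) : timeIn B q ≤ q.2.1 := by
  have h1 : timeIn B q ≤ volume.real (Set.Ico 0 q.2.1) :=
    measureReal_mono (fun v hv => hv.1) measure_Ico_lt_top.ne
  rwa [Real.volume_real_Ico_of_le hq, sub_zero] at h1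

theorem integrable_timeIn {κ : Measure (ℝ × ℝ)} [IsProbabilityMeasure κ]
    (hpos : ∀ᵐ p ∂κ, 0 < p.1) (hint : Integrable Prod.fst κ) {B : Set ℝ} (hB : MeasurableSet B) :
    Integrable (timeIn B) (κ.prod κ) := by
  have h1 : ∀ᵐ q ∂(κ.prod κ), 0 < q.2.1 := Measure.quasiMeasurePreserving_snd.ae hpos
  have h2 : Integrable (fun q : (ℝ × ℝ) × (ℝ × ℝ) => q.2.1) (κ.prod κ) := hint.comp_snd κ
  refine h2.mono' (measurable_timeIn hB).aestronglyMeasurable ?_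
  filter_upwards [h1] with q hq
  rw [Real.norm_of_nonneg (show 0 ≤ timeIn B q from measureReal_nonneg)]
  exact timeIn_le hq.le

/-- Renewal-reward form: mean time in `B` per cycle over mean cycle length, which is the limit
delivered by `tendsto_fraction_of_time` and the strong law. -/
theorem ageLaw_real {κ : Measure (ℝ × ℝ)} [IsProbabilityMeasure κ]
    (hpos : ∀ᵐ p ∂κ, 0 < p.1) (hint : Integrable Prod.fst κ) {B : Set ℝ} (hB : MeasurableSet B) :
    (ageLaw κ).real B = (∫ q, timeIn B q ∂(κ.prod κ)) / ∫ p, p.1 ∂κ := by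
  obtain ⟨h1, h2⟩ := lintegral_ofReal_fst_ne hpos hint
  have h3 : ageLaw κ B = (ENNReal.ofReal (∫ p, p.1 ∂κ))⁻¹ *
      ENNReal.ofReal (∫ q, timeIn B q ∂(κ.prod κ)) := by
    rw [← lintegral_indicator_one hB, lintegral_ageLaw κ (measurable_one.indicator hB), h1,
      ofReal_integral_eq_lintegral_ofReal (integrable_timeIn hpos hint hB)
        (.of_forall fun _ => measureReal_nonneg)]
    congr 1
    refine lintegral_congr fun q => ?_
    have h4 : MeasurableSet {v : ℝ | q.1.2 + v ∈ B} := measurable_const_add _ hB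
    have h5 : ∀ v, B.indicator (1 : ℝ → ℝ≥0∞) (q.1.2 + v) =
        {v : ℝ | q.1.2 + v ∈ B}.indicator 1 v := fun v => rfl
    simp only [h5]
    rw [lintegral_indicator_one h4, Measure.restrict_apply h4, timeIn, measureReal_def,
      ENNReal.ofReal_toReal, Set.inter_comm]
    · rfl
    · exact ((measure_mono fun v hv => hv.1).trans_lt measure_Ico_lt_top).ne
  rw [measureReal_def, h3, ENNReal.toReal_mul, ENNReal.toReal_inv, ENNReal.toReal_ofReal h2.le,
    ENNReal.toReal_ofReal (integral_nonneg fun q => show 0 ≤ timeIn B q from measureReal_nonneg), div_eq_inv_mul]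

end AgeLaw

/-! ### The age of information as a sequence of independent cycles -/

section AoI

variable {ι : Type*} [Fintype ι] [Nonempty ι] [DecidableEq ι] [MeasurableSpace ι]
  [DiscreteMeasurableSpace ι]

/-- The delivery times are strictly increasing, so the deliveries up to time `t` are exactly those
with index at most `i`, and the supremum in `timeStamp` is `i`. -/
theorem IsRegularOrbit.aoi_eq {c : ι} {z : ι → Marks} (h : IsRegularOrbit c z) (i : ℕ) {t : ℝ}
    (h1 : ∑ l ∈ Finset.range (i + 1), gap c l z ≤ t)
    (h2 : t < ∑ l ∈ Finset.range (i + 2), gap c l z) :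
    aoi (interarrivals z) (services z) c t =
      t - (∑ l ∈ Finset.range (i + 1), gap c l z - sojourn c i z) := by
  have hmono : StrictMono fun n => ∑ l ∈ Finset.range n, gap c l z :=
    strictMono_nat_of_lt_succ fun n => by
      rw [Finset.sum_range_succ]
      exact lt_add_of_pos_right _ (h.gap_pos n)
  have hset : {k | deliveryTime (interarrivals z) (services z) c k ≤ t} = Set.Iic i := by
    ext k
    simp only [Set.mem_ofPred_eq, Set.mem_Iic, h.deliveryTime_eq]
    constructor
    · intro hk
      have : k + 1 < i + 2 := hmono.lt_iff_lt.1 (hk.trans_lt h2)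
      omega
    · intro hk
      exact (hmono.monotone (show k + 1 ≤ i + 1 by omega)).trans h1
  rw [aoi, timeStamp, hset, if_pos Set.nonempty_Iic, csSup_Iic, h.genTime_eq]

variable {lam : ι → ℝ} {ν : Measure ℝ} [IsProbabilityMeasure ν]
  [∀ j, IsProbabilityMeasure (markLaw (lam j) ν)]

variable (lam ν) in
/-- The joint law of an interdeparture time of source `c` and the system time at its end. -/
def cycleLaw (c : ι) : Measure (ℝ × ℝ) := (systemLaw lam ν).map (sourceOut c)

theorem isRegenerative_source (hν : ∀ᵐ y ∂ν, 0 ≤ y) (hlam : ∀ j, 0 < lam j) (c : ι) :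
    IsRegenerative (systemLaw lam ν) (sourceOut c) (sourceRest c) :=
  isRegenerative_sourceCycle hν hlam c

theorem isProbabilityMeasure_cycleLaw (hν : ∀ᵐ y ∂ν, 0 ≤ y) (hlam : ∀ j, 0 < lam j) (c : ι) :
    IsProbabilityMeasure (cycleLaw lam ν c) :=
  Measure.isProbabilityMeasure_map (isRegenerative_source hν hlam c).measurable_out.aemeasurable

theorem ae_cycleLaw_pos (hν : ∀ᵐ y ∂ν, 0 ≤ y) (hlam : ∀ j, 0 < lam j) (c : ι) :
    ∀ᵐ p ∂(cycleLaw lam ν c), 0 < p.1 := by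
  rw [cycleLaw, ae_map_iff (isRegenerative_source hν hlam c).measurable_out.aemeasurable
    (measurableSet_lt measurable_const measurable_fst)]
  filter_upwards [ae_isRegularOrbit (ν := ν) hν hlam c] with z hz using hz.gap_pos 0

/-- The long-run distribution of the age of information. -/
theorem ae_tendsto_fraction_aoi (hν : ∀ᵐ y ∂ν, 0 ≤ y) (hlam : ∀ j, 0 < lam j) (c : ι)
    (hint : Integrable Prod.fst (cycleLaw lam ν c)) {B : Set ℝ} (hB : MeasurableSet B) :
    ∀ᵐ z ∂(systemLaw lam ν), Tendsto (fun τ : ℝ => volume.real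
      {t : ℝ | t ∈ Set.Icc 0 τ ∧ aoi (interarrivals z) (services z) c t ∈ B} / τ) atTop
      (𝓝 ((ageLaw (cycleLaw lam ν c)).real B)) := by
  have hreg := isRegenerative_source (ν := ν) hν hlam c
  have := isProbabilityMeasure_cycleLaw (ν := ν) hν hlam c
  have hpos := ae_cycleLaw_pos (ν := ν) hν hlam c
  have hmeas := hreg.measurable_out
  have hU : ∀ n, Measurable fun z => sourceOut c ((sourceRest c)^[n] z) := hreg.measurable_iterate
  have hind := hreg.iIndepFun_iterate
  have hpair : (systemLaw lam ν).map
      (fun z => (sourceOut c ((sourceRest c)^[0] z), sourceOut c ((sourceRest c)^[1] z))) =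
      (cycleLaw lam ν c).prod (cycleLaw lam ν c) := by
    rw [(indepFun_iff_map_prod_eq_prod_map_map (hU 0).aemeasurable (hU 1).aemeasurable).1
      (hind.indepFun zero_ne_one), (hreg.identDistrib_iterate 1).map_eq]
    rfl
  have htime := integrable_timeIn hpos hint hB
  have h1 := strong_law_consecutive hU hind
    (fun n => (hreg.identDistrib_iterate n).trans (hreg.identDistrib_iterate 0).symm)
    (measurable_timeIn hB) (by
      rw [← hpair] at htime
      exact htime.comp_measurable ((hU 0).prodMk (hU 1)))
  have hgap : Integrable (fun z => (sourceOut c z).1) (systemLaw lam ν) :=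
    hint.comp_measurable hmeas
  have h2 := strong_law_ae_real (μ := systemLaw lam ν) (fun n z => gap c n z) hgap
    (fun k l hkl => (hind.indepFun hkl).comp measurable_fst measurable_fst)
    (fun n => (hreg.identDistrib_iterate n).comp measurable_fst)
  have e1 : ∫ z, timeIn B (sourceOut c ((sourceRest c)^[0] z), sourceOut c ((sourceRest c)^[1] z))
      ∂(systemLaw lam ν) = ∫ q, timeIn B q ∂((cycleLaw lam ν c).prod (cycleLaw lam ν c)) := by
    rw [← hpair, integral_map ((hU 0).prodMk (hU 1)).aemeasurable
      (measurable_timeIn hB).aestronglyMeasurable]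
  have e2 : ∫ z, gap c 0 z ∂(systemLaw lam ν) = ∫ p, p.1 ∂(cycleLaw lam ν c) := by
    rw [cycleLaw, integral_map hmeas.aemeasurable measurable_fst.aestronglyMeasurable]
    rfl
  rw [e1] at h1
  rw [e2] at h2
  rw [ageLaw_real hpos hint hB]
  filter_upwards [h1, h2, ae_isRegularOrbit (ν := ν) hν hlam c] with z h1 h2 h3
  exact tendsto_fraction_of_time hB h3.gap_pos (fun i t => h3.aoi_eq i)
    (lintegral_ofReal_fst_ne hpos hint).2 h2 h1

end AoI

/-! ### Moment generating functions as lower integrals -/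

section Mgf

variable {Ω : Type*} [MeasurableSpace Ω] {μ : Measure Ω} {X : Ω → ℝ} {s : ℝ}

/-- With this, one computation in `ℝ≥0∞` settles both the finiteness and the value of an MGF. -/
theorem mem_integrableExpSet_iff (hX : AEMeasurable X μ) :
    s ∈ integrableExpSet X μ ↔ ∫⁻ ω, ENNReal.ofReal (Real.exp (s * X ω)) ∂μ ≠ ∞ :=
  (lintegral_ofReal_ne_top_iff_integrable (by fun_prop)
    (.of_forall fun _ => Real.exp_nonneg _)).symm

theorem ofReal_mgf (h : s ∈ integrableExpSet X μ) :
    ∫⁻ ω, ENNReal.ofReal (Real.exp (s * X ω)) ∂μ = ENNReal.ofReal (mgf X μ s) :=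
  (ofReal_integral_eq_lintegral_ofReal h (.of_forall fun _ => Real.exp_nonneg _)).symm

theorem mgf_eq_toReal (hX : AEMeasurable X μ) :
    mgf X μ s = (∫⁻ ω, ENNReal.ofReal (Real.exp (s * X ω)) ∂μ).toReal :=
  integral_eq_lintegral_of_nonneg_ae (.of_forall fun _ => Real.exp_nonneg _) (by fun_prop)

/-- Numerator and denominator have the same sign, so negative `s` needs no separate treatment when
passing to `ℝ≥0∞`. -/
theorem exp_mul_sub_one_div_nonneg (s : ℝ) {x : ℝ} (hx : 0 ≤ x) : 0 ≤ (Real.exp (s * x) - 1) / s := by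
  rcases le_or_gt 0 s with hs | hs
  · exact div_nonneg (sub_nonneg.2 (Real.one_le_exp (mul_nonneg hs hx))) hs
  · exact div_nonneg_of_nonpos
      (sub_nonpos.2 (Real.exp_le_one_iff.2 (mul_nonpos_of_nonpos_of_nonneg hs.le hx))) hs.le

theorem lintegral_exp_sub_one_div [IsProbabilityMeasure μ] (h : s ∈ integrableExpSet X μ)
    (hX : ∀ᵐ ω ∂μ, 0 ≤ X ω) :
    ∫⁻ ω, ENNReal.ofReal ((Real.exp (s * X ω) - 1) / s) ∂μ = ENNReal.ofReal ((mgf X μ s - 1) / s) ∧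
      0 ≤ (mgf X μ s - 1) / s := by
  have h1 : Integrable (fun ω => (Real.exp (s * X ω) - 1) / s) μ :=
    (Integrable.sub h (integrable_const 1)).div_const s
  have h2 : 0 ≤ᵐ[μ] fun ω => (Real.exp (s * X ω) - 1) / s :=
    hX.mono fun ω hω => exp_mul_sub_one_div_nonneg s hω
  have h3 : ∫ ω, (Real.exp (s * X ω) - 1) / s ∂μ = (mgf X μ s - 1) / s := by
    rw [integral_div, integral_sub h (integrable_const 1)]
    simp [mgf]
  rw [← h3]
  exact ⟨(ofReal_integral_eq_lintegral_ofReal h1 h2).symm, integral_nonneg_of_ae h2⟩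

theorem integrableExpSet_congr_identDistrib {Ω' : Type*} [MeasurableSpace Ω'] {μ' : Measure Ω'}
    {X' : Ω' → ℝ} (h : IdentDistrib X X' μ μ') : integrableExpSet X μ = integrableExpSet X' μ' := by
  ext s
  exact (h.comp (u := fun x => Real.exp (s * x)) (by fun_prop)).integrable_iff

theorem Iic_zero_subset_integrableExpSet [IsFiniteMeasure μ] (hm : AEMeasurable X μ)
    (hX : ∀ᵐ ω ∂μ, 0 ≤ X ω) : Set.Iic 0 ⊆ integrableExpSet X μ := by
  intro s hs
  refine Integrable.mono' (integrable_const (1 : ℝ)) (by fun_prop) ?_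
  filter_upwards [hX] with ω hω
  rw [Real.norm_of_nonneg (Real.exp_nonneg _)]
  exact Real.exp_le_one_iff.2 (mul_nonpos_of_nonpos_of_nonneg hs hω)

end Mgf

/-! ### Closed forms of the weights -/

section ClosedForms

variable {r s : ℝ} {ν : Measure ℝ} [IsProbabilityMeasure ν]

omit [IsProbabilityMeasure ν] in
theorem successWeight_one : successWeight r ν s (fun _ => 1) =
    ∫⁻ y, ENNReal.ofReal (Real.exp ((s - r) * id y)) ∂ν := by
  simp [successWeight]

omit [IsProbabilityMeasure ν] in
theorem successWeight_ne_top_iff :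
    successWeight r ν s (fun _ => 1) ≠ ∞ ↔ s - r ∈ integrableExpSet id ν := by
  rw [successWeight_one, mem_integrableExpSet_iff aemeasurable_id]

omit [IsProbabilityMeasure ν] in
theorem successWeight_eq (h : s - r ∈ integrableExpSet id ν) :
    successWeight r ν s (fun _ => 1) = ENNReal.ofReal (MS ν (s - r)) := by
  rw [successWeight_one, ofReal_mgf h]
  rfl

/-- The integral of `r exp ((s - r) x)` over `[0, y]` is `r (exp ((s - r) y) - 1) / (s - r)`, and
averaging over `y` gives `a'_j`. This is where `s = λ_j` has to be excluded. -/
theorem failWeight_eq (hν : ∀ᵐ y ∂ν, 0 ≤ y) (hr : 0 < r) (hs : s ≠ r)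
    (h : s - r ∈ integrableExpSet id ν) :
    failWeight r ν s = ENNReal.ofReal (r * (1 - MS ν (s - r)) / (r - s)) ∧
      0 ≤ r * (1 - MS ν (s - r)) / (r - s) := by
  have hsr : s - r ≠ 0 := sub_ne_zero.2 hs
  obtain ⟨h1, h2⟩ := lintegral_exp_sub_one_div h hν
  have h3 : r * (1 - MS ν (s - r)) / (r - s) = r * ((mgf id ν (s - r) - 1) / (s - r)) := by
    have : MS ν (s - r) = mgf id ν (s - r) := rfl
    rw [this]
    have : r - s ≠ 0 := sub_ne_zero.2 hs.symm
    field_simp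
    ring
  rw [h3, ENNReal.ofReal_mul hr.le, ← h1, ← lintegral_const_mul _ (by fun_prop)]
  refine ⟨lintegral_congr_ae ?_, mul_nonneg hr.le h2⟩
  filter_upwards [hν] with y hy
  have h4 : ∀ x, ENNReal.ofReal (r * Real.exp (-(r * x))) *
      (if x ≤ y then ENNReal.ofReal (Real.exp (s * x)) else 0) =
      (Set.Iic y).indicator (fun x => ENNReal.ofReal r *
        ENNReal.ofReal (Real.exp ((s - r) * (0 + x)))) x := by
    intro x
    by_cases hx : x ≤ y
    · rw [if_pos hx, Set.indicator_of_mem (by exact hx), ENNReal.ofReal_mul hr.le, mul_assoc,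
        ← ENNReal.ofReal_mul (Real.exp_nonneg _), ← Real.exp_add]
      congr 3
      ring
    · rw [if_neg hx, Set.indicator_of_notMem (by exact hx), mul_zero]
  rw [lintegral_expMeasure (Measurable.ite measurableSet_Iic (by fun_prop) measurable_const)]
  simp only [h4]
  rw [lintegral_indicator measurableSet_Iic, Measure.restrict_restrict measurableSet_Iic,
    Set.inter_comm, Set.Ici_inter_Iic, ← restrict_Ico_eq_restrict_Icc,
    lintegral_const_mul _ (by fun_prop), lintegral_exp_Ico hsr 0 hy]
  simp

variable {ι : Type*} [Fintype ι] [DecidableEq ι] {lam : ι → ℝ} {j : ι}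

theorem idleWeight_integrand (hlam : 0 < lam j) (x : ℝ) :
    ENNReal.ofReal (lam j * Real.exp (-(lam j * x))) *
      ENNReal.ofReal (Real.exp ((s - ∑ i ∈ Finset.univ.erase j, lam i) * x)) =
    ENNReal.ofReal (lam j) * ENNReal.ofReal (Real.exp ((s - ∑ i, lam i) * x)) := by
  rw [ENNReal.ofReal_mul hlam.le, mul_assoc, ← ENNReal.ofReal_mul (Real.exp_nonneg _),
    ← Real.exp_add, ← Finset.sum_erase_add _ _ (Finset.mem_univ j)]
  congr 3
  ring

/-- With `λ` the total rate, the integrand `λ_j exp ((s - λ) x)` is `λ_j / (λ - s)` times the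
density of the exponential law of rate `λ - s`, whose total mass is known to be 1. -/
theorem idleWeight_eq (hlam : 0 < lam j) (hs : s < ∑ i, lam i) :
    idleWeight lam j s = ENNReal.ofReal (coefA lam j s) ∧ 0 < coefA lam j s := by
  set a := ∑ i, lam i - s with ha
  have ha0 : 0 < a := sub_pos.2 hs
  refine ⟨?_, div_pos hlam ha0⟩
  have := isProbabilityMeasure_expMeasure ha0
  have h1 : ∫⁻ _x, 1 ∂(expMeasure a) = 1 := by simp
  rw [lintegral_expMeasure measurable_const] at h1
  rw [idleWeight, lintegral_expMeasure (by fun_prop)]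
  simp only [idleWeight_integrand hlam]
  rw [← mul_one (ENNReal.ofReal (coefA lam j s)), ← h1, ← lintegral_const_mul _ (by fun_prop)]
  refine lintegral_congr fun x => ?_
  rw [mul_one, ← ENNReal.ofReal_mul hlam.le, coefA, ← ha,
    ← ENNReal.ofReal_mul (div_pos hlam ha0).le, ← mul_assoc, div_mul_cancel₀ _ ha0.ne']
  congr 3
  rw [ha]
  ring

/-- From the total rate on, the integrand is bounded below by `λ_j` on a half-line. -/
theorem idleWeight_eq_top (hlam : 0 < lam j) (hs : ∑ i, lam i ≤ s) : idleWeight lam j s = ∞ := by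
  rw [idleWeight, lintegral_expMeasure (by fun_prop)]
  simp only [idleWeight_integrand hlam]
  refine top_unique ?_
  calc (∞ : ℝ≥0∞) = ∫⁻ _x in Set.Ici (0 : ℝ), ENNReal.ofReal (lam j) := by
        rw [lintegral_const, Measure.restrict_apply_univ, Real.volume_Ici,
          ENNReal.mul_top (ENNReal.ofReal_pos.2 hlam).ne']
    _ ≤ _ := by
        refine setLIntegral_mono (by fun_prop) fun x hx => ?_
        refine le_mul_of_one_le_right zero_le ?_
        rw [ENNReal.one_le_ofReal]
        exact Real.one_le_exp (mul_nonneg (sub_nonneg.2 hs) hx)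

/-- The MGF of the contribution of a cycle of source `j`. -/
def coefCycle (lam : ι → ℝ) (ν : Measure ℝ) (j : ι) (s : ℝ) : ℝ :=
  coefA lam j s * MS ν (s - lam j) / (1 - coefA' lam ν j s)

theorem MS_nonneg (ν : Measure ℝ) (u : ℝ) : 0 ≤ MS ν u := integral_nonneg fun _ => Real.exp_nonneg _

theorem cycleWeight_eq (hν : ∀ᵐ y ∂ν, 0 ≤ y) (hlam : ∀ j, 0 < lam j) (hs : s < ∑ i, lam i)
    (hsj : s ≠ lam j) (h : s - lam j ∈ integrableExpSet id ν) (h1 : coefA' lam ν j s < 1) :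
    cycleWeight lam ν j (fun d => ENNReal.ofReal (Real.exp (s * d.1))) =
      ENNReal.ofReal (coefCycle lam ν j s) ∧ 0 ≤ coefCycle lam ν j s := by
  obtain ⟨h2, h3⟩ := failWeight_eq hν (hlam j) hsj h
  replace h3 : 0 ≤ coefA' lam ν j s := h3
  obtain ⟨h4, h5⟩ := idleWeight_eq (hlam j) hs
  have h6 : 0 < 1 - coefA' lam ν j s := sub_pos.2 h1
  refine ⟨?_, div_nonneg (mul_nonneg h5.le (MS_nonneg _ _)) h6.le⟩
  have h7 := cycleWeight_exp hν hlam j s (h := fun _ => 1) measurable_const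
  simp only [mul_one] at h7
  rw [h7, successWeight_eq h, h2, h4]
  change _ * ((1 - ENNReal.ofReal (coefA' lam ν j s))⁻¹ * _) = _
  rw [← ENNReal.ofReal_one, ← ENNReal.ofReal_sub _ h3, ← ENNReal.ofReal_inv_of_pos h6,
    ← ENNReal.ofReal_mul (inv_nonneg.2 h6.le), ← ENNReal.ofReal_mul h5.le, coefCycle]
  congr 1
  field_simp

/-- A product of nonzero factors in `ℝ≥0∞` is finite only if each factor is. The idle factor then
gives `s < λ`, the success factor the finiteness of `M_S(s - λ_j)`, and the geometric factor `a'_j <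
1`. -/
theorem of_cycleWeight_ne_top (hν : ∀ᵐ y ∂ν, 0 ≤ y) (hlam : ∀ j, 0 < lam j) (hsj : s ≠ lam j)
    (h : cycleWeight lam ν j (fun d => ENNReal.ofReal (Real.exp (s * d.1))) ≠ ∞) :
    s < ∑ i, lam i ∧ s - lam j ∈ integrableExpSet id ν ∧ coefA' lam ν j s < 1 := by
  have : Nonempty ι := ⟨j⟩
  have h7 := cycleWeight_exp hν hlam j s (h := fun _ => 1) measurable_const
  simp only [mul_one] at h7
  rw [h7] at h
  have hi := idleWeight_ne_zero hlam j s
  have hS : successWeight (lam j) ν s (fun _ => 1) ≠ 0 := successWeight_pos measurable_const (by simp)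
  have hF : (1 - failWeight (lam j) ν s)⁻¹ ≠ 0 :=
    ENNReal.inv_ne_zero.2 (ne_top_of_le_ne_top ENNReal.one_ne_top tsub_le_self)
  have h1 : idleWeight lam j s ≠ ∞ := fun h0 => h (by rw [h0, ENNReal.top_mul (mul_ne_zero hF hS)])
  have h2 := fun h0 : (1 - failWeight (lam j) ν s)⁻¹ * successWeight (lam j) ν s (fun _ => 1) = ∞ =>
    h (by rw [h0, ENNReal.mul_top hi])
  have h3 : successWeight (lam j) ν s (fun _ => 1) ≠ ∞ := fun h0 =>
    h2 (by rw [h0, ENNReal.mul_top hF])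
  have h4 : (1 - failWeight (lam j) ν s)⁻¹ ≠ ∞ := fun h0 => h2 (by rw [h0, ENNReal.top_mul hS])
  have h5 := successWeight_ne_top_iff.1 h3
  refine ⟨?_, h5, ?_⟩
  · by_contra! h0
    exact h1 (idleWeight_eq_top (hlam j) h0)
  · rw [ne_eq, ENNReal.inv_eq_top, tsub_eq_zero_iff_le, not_le,
      (failWeight_eq hν (hlam j) hsj h5).1, ENNReal.ofReal_lt_one] at h4
    exact h4

theorem otherWeight_eq (hν : ∀ᵐ y ∂ν, 0 ≤ y) (hlam : ∀ j, 0 < lam j) (c : ι)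
    (h : ∀ j ≠ c, s < ∑ i, lam i ∧ s ≠ lam j ∧ s - lam j ∈ integrableExpSet id ν ∧
      coefA' lam ν j s < 1) :
    otherWeight lam ν c s = ENNReal.ofReal (∑ j ∈ Finset.univ.erase c, coefCycle lam ν j s) ∧
      0 ≤ ∑ j ∈ Finset.univ.erase c, coefCycle lam ν j s := by
  have h1 : ∀ j ∈ Finset.univ.erase c,
      cycleWeight lam ν j (fun d => ENNReal.ofReal (Real.exp (s * d.1))) =
      ENNReal.ofReal (coefCycle lam ν j s) ∧ 0 ≤ coefCycle lam ν j s := fun j hj => by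
    obtain ⟨h2, h3, h4, h5⟩ := h j (Finset.ne_of_mem_erase hj)
    exact cycleWeight_eq hν hlam h2 h3 h4 h5
  refine ⟨?_, Finset.sum_nonneg fun j hj => (h1 j hj).2⟩
  rw [otherWeight, ENNReal.ofReal_sum_of_nonneg fun j hj => (h1 j hj).2]
  exact Finset.sum_congr rfl fun j hj => (h1 j hj).1

omit [IsProbabilityMeasure ν] in
theorem MY_eq_coefCycle (c : ι) : MY lam ν c s = coefCycle lam ν c s /
    (1 - ∑ j ∈ Finset.univ.erase c, coefCycle lam ν j s) := by
  rw [MY, coefCycle, div_div]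
  rfl

/-- The interdeparture time weight, finite exactly where the MGF is. -/
theorem inv_otherWeight_mul_eq (hν : ∀ᵐ y ∂ν, 0 ≤ y) (hlam : ∀ j, 0 < lam j) (c : ι)
    (h : ∀ j, s < ∑ i, lam i ∧ s ≠ lam j ∧ s - lam j ∈ integrableExpSet id ν ∧
      coefA' lam ν j s < 1) (h1 : ∑ j ∈ Finset.univ.erase c, coefCycle lam ν j s < 1) :
    (1 - otherWeight lam ν c s)⁻¹ *
      cycleWeight lam ν c (fun d => ENNReal.ofReal (Real.exp (s * d.1))) =
      ENNReal.ofReal (MY lam ν c s) ∧ 0 ≤ MY lam ν c s := by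
  obtain ⟨h2, h3⟩ := otherWeight_eq hν hlam c fun j _ => h j
  obtain ⟨h4, h5, h6, h7⟩ := h c
  obtain ⟨h8, h9⟩ := cycleWeight_eq hν hlam h4 h5 h6 h7
  have h10 := sub_pos.2 h1
  rw [h2, h8, MY_eq_coefCycle, ← ENNReal.ofReal_one, ← ENNReal.ofReal_sub _ h3,
    ← ENNReal.ofReal_inv_of_pos h10, ← ENNReal.ofReal_mul (inv_nonneg.2 h10.le), inv_mul_eq_div]
  exact ⟨rfl, div_nonneg h9 h10.le⟩

/-- Converse to `inv_otherWeight_mul_eq`: a finite outer geometric series forces `otherWeight < 1`,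
so every cycle weight is finite and `of_cycleWeight_ne_top` applies to each source. Hence, away from
the points `λ_j`, finiteness of the MGF of `Y` is the only assumption needed for the closed form. -/
theorem of_inv_otherWeight_mul_ne_top [∀ j, IsProbabilityMeasure (markLaw (lam j) ν)]
    (hν : ∀ᵐ y ∂ν, 0 ≤ y) (hlam : ∀ j, 0 < lam j) (c : ι) (hs : ∀ j, s ≠ lam j)
    (h : (1 - otherWeight lam ν c s)⁻¹ *
      cycleWeight lam ν c (fun d => ENNReal.ofReal (Real.exp (s * d.1))) ≠ ∞) :
    (∀ j, s < ∑ i, lam i ∧ s ≠ lam j ∧ s - lam j ∈ integrableExpSet id ν ∧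
      coefA' lam ν j s < 1) ∧ ∑ j ∈ Finset.univ.erase c, coefCycle lam ν j s < 1 := by
  have hC := cycleWeight_ne_zero hν hlam c s (h := fun _ => 1) measurable_const (by simp)
  simp only [mul_one] at hC
  have h1 : (1 - otherWeight lam ν c s)⁻¹ ≠ 0 :=
    ENNReal.inv_ne_zero.2 (ne_top_of_le_ne_top ENNReal.one_ne_top tsub_le_self)
  have h2 : cycleWeight lam ν c (fun d => ENNReal.ofReal (Real.exp (s * d.1))) ≠ ∞ := fun h0 =>
    h (by rw [h0, ENNReal.mul_top h1])
  have h3 : (1 - otherWeight lam ν c s)⁻¹ ≠ ∞ := fun h0 => h (by rw [h0, ENNReal.top_mul hC])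
  rw [ne_eq, ENNReal.inv_eq_top, tsub_eq_zero_iff_le, not_le] at h3
  have h4 : ∀ j, s < ∑ i, lam i ∧ s ≠ lam j ∧ s - lam j ∈ integrableExpSet id ν ∧
      coefA' lam ν j s < 1 := by
    intro j
    have h5 : cycleWeight lam ν j (fun d => ENNReal.ofReal (Real.exp (s * d.1))) ≠ ∞ := by
      by_cases hj : j = c
      · rwa [hj]
      · refine ne_top_of_le_ne_top h3.ne_top ?_
        exact Finset.single_le_sum (f := fun j => cycleWeight lam ν j
          fun d => ENNReal.ofReal (Real.exp (s * d.1))) (fun _ _ => zero_le)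
          (Finset.mem_erase.2 ⟨hj, Finset.mem_univ j⟩)
    obtain ⟨h6, h7, h8⟩ := of_cycleWeight_ne_top hν hlam (hs j) h5
    exact ⟨h6, hs j, h7, h8⟩
  refine ⟨h4, ?_⟩
  rwa [(otherWeight_eq hν hlam c fun j _ => h4 j).1, ENNReal.ofReal_lt_one] at h3

/-- The interdeparture time weight is finite near `0`. -/
theorem eventually_inv_otherWeight_mul_ne_top [∀ j, IsProbabilityMeasure (markLaw (lam j) ν)]
    [Nonempty ι] [MeasurableSpace ι] [DiscreteMeasurableSpace ι]
    (hν : ∀ᵐ y ∂ν, 0 ≤ y) (hlam : ∀ j, 0 < lam j) (c : ι) :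
    ∀ᶠ s in 𝓝 (0 : ℝ), (1 - otherWeight lam ν c s)⁻¹ *
      cycleWeight lam ν c (fun d => ENNReal.ofReal (Real.exp (s * d.1))) ≠ ∞ := by
  -- Since `S ≥ 0`, its MGF is finite, hence analytic, on the negative half-line, and `s - λ_j` lies
  -- there for `s` near 0.
  have hexp : ∀ u < 0, u ∈ interior (integrableExpSet id ν) := fun u hu =>
    interior_mono (Iic_zero_subset_integrableExpSet aemeasurable_id hν)
      (by rw [interior_Iic]; exact hu)
  have hMS : ∀ j, ContinuousAt (fun s => MS ν (s - lam j)) 0 := fun j => by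
    have h1 : ContinuousAt (mgf id ν) (0 - lam j) :=
      (analyticAt_mgf (hexp _ (by rw [zero_sub]; exact neg_lt_zero.2 (hlam j)))).continuousAt
    exact ContinuousAt.comp (f := fun s => s - lam j) h1 (by fun_prop)
  have hsum : 0 < ∑ i, lam i := Finset.sum_pos (fun i _ => hlam i) ⟨c, Finset.mem_univ c⟩
  have hA : ∀ j, ContinuousAt (coefA lam j) 0 := fun j =>
    continuousAt_const.div (by fun_prop) (by rw [sub_zero]; exact hsum.ne')
  have hA' : ∀ j, ContinuousAt (coefA' lam ν j) 0 := fun j =>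
    (continuousAt_const.mul (continuousAt_const.sub (hMS j))).div (by fun_prop)
      (by rw [sub_zero]; exact (hlam j).ne')
  have hint : ∀ j, ∀ s < lam j, s - lam j ∈ integrableExpSet id ν := fun j s hs =>
    interior_subset (hexp _ (sub_neg.2 hs))
  have hle : ∀ j, lam j ≤ ∑ i, lam i := fun j =>
    Finset.single_le_sum (fun i _ => (hlam i).le) (Finset.mem_univ j)
  -- At 0 this coefficient is the probability of a preemption, and the sum in `hC1` is the
  -- probability that a cycle ends with another source; both are less than 1, and the strict
  -- inequalities persist near 0 by continuity.
  have hA1 : ∀ j, coefA' lam ν j 0 < 1 := fun j => by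
    have h1 := failWeight_zero_lt_one hν (hlam j)
    rwa [(failWeight_eq hν (hlam j) (hlam j).ne (hint j 0 (hlam j))).1, ENNReal.ofReal_lt_one] at h1
  have hC : ContinuousAt (fun s => ∑ j ∈ Finset.univ.erase c, coefCycle lam ν j s) 0 :=
    tendsto_finsetSum _ fun j _ => ((hA j).mul (hMS j)).div (continuousAt_const.sub (hA' j))
      (sub_pos.2 (hA1 j)).ne'
  have hC1 : ∑ j ∈ Finset.univ.erase c, coefCycle lam ν j 0 < 1 := by
    have h1 := otherWeight_zero_lt_one (ν := ν) hν hlam c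
    rwa [(otherWeight_eq hν hlam c fun j _ =>
      ⟨hsum, (hlam j).ne, hint j 0 (hlam j), hA1 j⟩).1, ENNReal.ofReal_lt_one] at h1
  have e1 : ∀ᶠ s in 𝓝 (0 : ℝ), ∀ j, s < lam j ∧ coefA' lam ν j s < 1 :=
    eventually_all.2 fun j => (eventually_lt_nhds (hlam j)).and ((hA' j).eventually_lt_const (hA1 j))
  filter_upwards [e1, hC.eventually_lt_const hC1] with s h1 h2
  rw [(inv_otherWeight_mul_eq hν hlam c (fun j =>
    ⟨(h1 j).1.trans_le (hle j), (h1 j).1.ne, hint j s (h1 j).1, (h1 j).2⟩) h2).1]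
  exact ENNReal.ofReal_ne_top

end ClosedForms

/-! ### Moment generating functions of one cycle -/

section CycleLaw

variable {ι : Type*} [Fintype ι] [Nonempty ι] [DecidableEq ι] [MeasurableSpace ι]
  [DiscreteMeasurableSpace ι] {lam : ι → ℝ} {ν : Measure ℝ} [IsProbabilityMeasure ν]
  [∀ j, IsProbabilityMeasure (markLaw (lam j) ν)] {s : ℝ}

theorem lintegral_cycleLaw (hν : ∀ᵐ y ∂ν, 0 ≤ y) (hlam : ∀ j, 0 < lam j) (c : ι) (s : ℝ)
    {h : ℝ → ℝ≥0∞} (hh : Measurable h) :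
    ∫⁻ p, ENNReal.ofReal (Real.exp (s * p.1)) * h p.2 ∂(cycleLaw lam ν c) =
      (1 - otherWeight lam ν c s)⁻¹ *
        cycleWeight lam ν c fun d => ENNReal.ofReal (Real.exp (s * d.1)) * h d.2 := by
  rw [cycleLaw, lintegral_map (by fun_prop) (isRegenerative_source hν hlam c).measurable_out]
  exact lintegral_sourceCycle hν hlam c s hh

theorem lintegral_exp_fst_cycleLaw (hν : ∀ᵐ y ∂ν, 0 ≤ y) (hlam : ∀ j, 0 < lam j) (c : ι) (s : ℝ) :
    ∫⁻ p, ENNReal.ofReal (Real.exp (s * p.1)) ∂(cycleLaw lam ν c) =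
      (1 - otherWeight lam ν c s)⁻¹ *
        cycleWeight lam ν c fun d => ENNReal.ofReal (Real.exp (s * d.1)) := by
  have h1 := lintegral_cycleLaw (ν := ν) hν hlam c s (h := fun _ => 1) measurable_const
  simpa only [mul_one] using h1

theorem zero_mem_interior_cycleLaw (hν : ∀ᵐ y ∂ν, 0 ≤ y) (hlam : ∀ j, 0 < lam j) (c : ι) :
    (0 : ℝ) ∈ interior (integrableExpSet Prod.fst (cycleLaw lam ν c)) := by
  rw [mem_interior_iff_mem_nhds]
  filter_upwards [eventually_inv_otherWeight_mul_ne_top (ν := ν) hν hlam c] with s hs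
  rw [mem_integrableExpSet_iff measurable_fst.aemeasurable, lintegral_exp_fst_cycleLaw hν hlam]
  exact hs

theorem mgf_fst_cycleLaw (hν : ∀ᵐ y ∂ν, 0 ≤ y) (hlam : ∀ j, 0 < lam j) (c : ι)
    (hs : s ∈ integrableExpSet Prod.fst (cycleLaw lam ν c)) (hsl : ∀ j, s ≠ lam j) :
    s - lam c ∈ integrableExpSet id ν ∧ mgf Prod.fst (cycleLaw lam ν c) s = MY lam ν c s := by
  rw [mem_integrableExpSet_iff measurable_fst.aemeasurable,
    lintegral_exp_fst_cycleLaw hν hlam] at hs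
  obtain ⟨h1, h2⟩ := of_inv_otherWeight_mul_ne_top hν hlam c hsl hs
  obtain ⟨h3, h4⟩ := inv_otherWeight_mul_eq hν hlam c h1 h2
  refine ⟨(h1 c).2.2.1, ?_⟩
  rw [mgf_eq_toReal measurable_fst.aemeasurable, lintegral_exp_fst_cycleLaw hν hlam, h3,
    ENNReal.toReal_ofReal h4]

/-- Near 0 the closed form is the MGF itself, so its derivative at 0 is the mean interdeparture
time; this is how the derivative enters the formula for the age. -/
theorem hasDerivAt_MY (hν : ∀ᵐ y ∂ν, 0 ≤ y) (hlam : ∀ j, 0 < lam j) (c : ι) :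
    HasDerivAt (MY lam ν c) (∫ p, p.1 ∂(cycleLaw lam ν c)) 0 := by
  have h1 := zero_mem_interior_cycleLaw (ν := ν) hν hlam c
  have h2 := hasDerivAt_mgf h1
  simp only [zero_mul, Real.exp_zero, mul_one] at h2
  refine h2.congr_of_eventuallyEq ?_
  have h3 : ∀ᶠ s in 𝓝 (0 : ℝ), ∀ j, s ≠ lam j :=
    eventually_all.2 fun j => eventually_ne_nhds (hlam j).ne
  filter_upwards [mem_interior_iff_mem_nhds.1 h1, h3] with s hs hsl
  exact (mgf_fst_cycleLaw hν hlam c hs hsl).2.symm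

theorem integrable_fst_cycleLaw (hν : ∀ᵐ y ∂ν, 0 ≤ y) (hlam : ∀ j, 0 < lam j) (c : ι) :
    Integrable Prod.fst (cycleLaw lam ν c) := by
  simpa using integrable_pow_of_mem_interior_integrableExpSet
    (zero_mem_interior_cycleLaw (ν := ν) hν hlam c) 1

/-- With exponent 0 for the delivery time, only the last, successful service depends on the system
time, so its transform is a constant times the integral of `exp ((s - λ_c) y)`: the law of `S`
reweighted by the probability of surviving preemption. The constant need not be computed; `s = 0`
determines it as the inverse of `L`. -/
theorem mgf_snd_cycleLaw (hν : ∀ᵐ y ∂ν, 0 ≤ y) (hlam : ∀ j, 0 < lam j) (c : ι)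
    (hs : s - lam c ∈ integrableExpSet id ν) :
    s ∈ integrableExpSet Prod.snd (cycleLaw lam ν c) ∧
      mgf Prod.snd (cycleLaw lam ν c) s = MS ν (s - lam c) / LS ν (lam c) := by
  have := isProbabilityMeasure_cycleLaw (ν := ν) hν hlam c
  have h0 : 0 - lam c ∈ integrableExpSet id ν :=
    Iic_zero_subset_integrableExpSet aemeasurable_id hν (by simpa using (hlam c).le)
  have hLS : LS ν (lam c) = MS ν (0 - lam c) := by simp [LS, MS]
  have hpos : 0 < MS ν (0 - lam c) := mgf_pos h0
  set K := (1 - otherWeight lam ν c 0)⁻¹ * (idleWeight lam c 0 * (1 - failWeight (lam c) ν 0)⁻¹) with hK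
  have key : ∀ s, ∫⁻ p, ENNReal.ofReal (Real.exp (s * p.2)) ∂(cycleLaw lam ν c) =
      K * successWeight (lam c) ν s (fun _ => 1) := by
    intro s
    have h1 := lintegral_cycleLaw (ν := ν) hν hlam c 0
      (h := fun y => ENNReal.ofReal (Real.exp (s * y))) (by fun_prop)
    rw [cycleWeight_exp hν hlam c 0 (h := fun y => ENNReal.ofReal (Real.exp (s * y)))
      (by fun_prop)] at h1
    simp only [zero_mul, Real.exp_zero, ENNReal.ofReal_one, one_mul] at h1
    rw [h1, hK, mul_assoc, mul_assoc]
    congr 3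
    rw [successWeight, successWeight]
    refine lintegral_congr fun y => ?_
    rw [← ENNReal.ofReal_mul (Real.exp_nonneg _), ← Real.exp_add, mul_one]
    congr 2
    ring
  have h2 := key 0
  simp only [zero_mul, Real.exp_zero, ENNReal.ofReal_one, lintegral_one, measure_univ] at h2
  rw [successWeight_eq h0] at h2
  have h3 : K = ENNReal.ofReal (MS ν (0 - lam c))⁻¹ := by
    rw [ENNReal.ofReal_inv_of_pos hpos]
    exact ENNReal.eq_inv_of_mul_eq_one_left h2.symm
  have h4 : ∫⁻ p, ENNReal.ofReal (Real.exp (s * p.2)) ∂(cycleLaw lam ν c) =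
      ENNReal.ofReal (MS ν (s - lam c) / LS ν (lam c)) := by
    rw [key, h3, successWeight_eq hs, ← ENNReal.ofReal_mul (inv_nonneg.2 hpos.le), hLS,
      inv_mul_eq_div]
  constructor
  · rw [mem_integrableExpSet_iff measurable_snd.aemeasurable, h4]
    exact ENNReal.ofReal_ne_top
  · rw [mgf_eq_toReal measurable_snd.aemeasurable, h4, ENNReal.toReal_ofReal]
    rw [hLS]
    exact div_nonneg (MS_nonneg _ _) hpos.le

/-- The MGF of an interdeparture time plus the system time at its beginning. -/
theorem mgf_peak_cycleLaw (hν : ∀ᵐ y ∂ν, 0 ≤ y) (hlam : ∀ j, 0 < lam j) (c : ι)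
    (hs : s ∈ integrableExpSet Prod.fst (cycleLaw lam ν c)) (hsl : ∀ j, s ≠ lam j) :
    s ∈ integrableExpSet (fun q : (ℝ × ℝ) × (ℝ × ℝ) => q.2.1 + q.1.2)
        ((cycleLaw lam ν c).prod (cycleLaw lam ν c)) ∧
      mgf (fun q : (ℝ × ℝ) × (ℝ × ℝ) => q.2.1 + q.1.2)
        ((cycleLaw lam ν c).prod (cycleLaw lam ν c)) s =
        MS ν (s - lam c) * MY lam ν c s / LS ν (lam c) := by
  have := isProbabilityMeasure_cycleLaw (ν := ν) hν hlam c
  obtain ⟨h1, h2⟩ := mgf_fst_cycleLaw hν hlam c hs hsl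
  obtain ⟨h3, h4⟩ := mgf_snd_cycleLaw hν hlam c h1
  have h5 : ∀ q : (ℝ × ℝ) × (ℝ × ℝ), Real.exp (s * (q.2.1 + q.1.2)) =
      Real.exp (s * q.1.2) * Real.exp (s * q.2.1) := fun q => by
    rw [← Real.exp_add]; congr 1; ring
  constructor
  · simp only [integrableExpSet, Set.mem_ofPred_eq, h5]
    exact Integrable.mul_prod (f := fun p : ℝ × ℝ => Real.exp (s * p.2)) h3 hs
  · simp only [mgf, h5]
    rw [integral_prod_mul (fun p : ℝ × ℝ => Real.exp (s * p.2)) fun p : ℝ × ℝ => Real.exp (s * p.1)]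
    change mgf Prod.snd _ s * mgf Prod.fst _ s = _
    rw [h2, h4]
    ring

/-- The factors of `lintegral_exp_ageLaw` are the inverse mean cycle length, the transform of the
system time and `(M_Y(s) - 1) / s`. Their nonnegativity allows the identity to be read in `ℝ≥0∞`. -/
theorem mgf_ageLaw_cycleLaw (hν : ∀ᵐ y ∂ν, 0 ≤ y) (hlam : ∀ j, 0 < lam j) (c : ι)
    (hs : s ∈ integrableExpSet Prod.fst (cycleLaw lam ν c)) (hsl : ∀ j, s ≠ lam j) (hs0 : s ≠ 0) :
    s ∈ integrableExpSet id (ageLaw (cycleLaw lam ν c)) ∧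
      mgf id (ageLaw (cycleLaw lam ν c)) s = MS ν (s - lam c) * (MY lam ν c s - 1) /
        (s * LS ν (lam c) * deriv (MY lam ν c) 0) := by
  have := isProbabilityMeasure_cycleLaw (ν := ν) hν hlam c
  have hpos := ae_cycleLaw_pos (ν := ν) hν hlam c
  obtain ⟨h1, h2⟩ := mgf_fst_cycleLaw hν hlam c hs hsl
  obtain ⟨h3, h4⟩ := mgf_snd_cycleLaw hν hlam c h1
  obtain ⟨h5, h6⟩ := lintegral_ofReal_fst_ne hpos (integrable_fst_cycleLaw hν hlam c)
  obtain ⟨h7, h8⟩ := lintegral_exp_sub_one_div hs (hpos.mono fun p hp => hp.le)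
  have h9 : ∫⁻ x, ENNReal.ofReal (Real.exp (s * id x)) ∂(ageLaw (cycleLaw lam ν c)) =
      ENNReal.ofReal (MS ν (s - lam c) * (MY lam ν c s - 1) /
        (s * LS ν (lam c) * deriv (MY lam ν c) 0)) ∧
      0 ≤ MS ν (s - lam c) * (MY lam ν c s - 1) / (s * LS ν (lam c) * deriv (MY lam ν c) 0) := by
    have e : MS ν (s - lam c) * (MY lam ν c s - 1) / (s * LS ν (lam c) * deriv (MY lam ν c) 0) =
        (∫ p, p.1 ∂(cycleLaw lam ν c))⁻¹ * (MS ν (s - lam c) / LS ν (lam c) *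
          ((MY lam ν c s - 1) / s)) := by
      rw [(hasDerivAt_MY hν hlam c).deriv]
      ring
    have h10 : 0 ≤ MS ν (s - lam c) / LS ν (lam c) := h4 ▸ mgf_nonneg
    rw [h2] at h7 h8
    rw [e]
    refine ⟨?_, mul_nonneg (inv_nonneg.2 h6.le) (mul_nonneg h10 h8)⟩
    refine (lintegral_exp_ageLaw hpos hs0).trans ?_
    rw [h5, h7, ofReal_mgf h3, h4, ← ENNReal.ofReal_mul h10, ← ENNReal.ofReal_inv_of_pos h6,
      ← ENNReal.ofReal_mul (inv_nonneg.2 h6.le)]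
  constructor
  · rw [mem_integrableExpSet_iff aemeasurable_id, h9.1]
    exact ENNReal.ofReal_ne_top
  · rw [mgf_eq_toReal aemeasurable_id, h9.1, ENNReal.toReal_ofReal h9.2]

end CycleLaw

/-! ### The law of the input -/

section Input

variable {ι Ω : Type*} [Fintype ι] [MeasurableSpace Ω] {P : Measure Ω}
  [IsProbabilityMeasure P] {lam : ι → ℝ} {ν : Measure ℝ} [IsProbabilityMeasure ν]
  {X S : ι → ℕ → Ω → ℝ}

-- The sum of two copies of the index set is its product with `Bool`. Currying the infinite product
-- law turns independence of all variables into independence of the blocks `{X j n, S j n}`.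
omit [Fintype ι] [IsProbabilityMeasure ν] in
theorem IsInput.iIndepFun_marks (hin : IsInput P lam ν X S) :
    iIndepFun (fun (p : ι × ℕ) ω => (X p.1 p.2 ω, S p.1 p.2 ω)) P := by
  set V : (ι × ℕ) × Bool → Ω → ℝ := fun q => bif q.2 then X q.1.1 q.1.2 else S q.1.1 q.1.2 with hV
  have hm : ∀ q, Measurable (V q) := by
    rintro ⟨p, _ | _⟩
    · exact hin.measurable_S _ _
    · exact hin.measurable_X _ _
  have hind : iIndepFun V P := by
    have hg : Function.Injective fun q : (ι × ℕ) × Bool =>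
        (bif q.2 then Sum.inl q.1 else Sum.inr q.1 : (ι × ℕ) ⊕ (ι × ℕ)) := by
      rintro ⟨p, _ | _⟩ ⟨q, _ | _⟩ h <;> simp_all
    convert! hin.indep.precomp hg using 1
    ext ⟨p, _ | _⟩ <;> rfl
  have hblock : iIndepFun (fun (p : ι × ℕ) ω b => V (p, b) ω) P := by
    have hpm : ∀ q, IsProbabilityMeasure (P.map (V q)) := fun q =>
      Measure.isProbabilityMeasure_map (hm q).aemeasurable
    rw [iIndepFun_iff_map_fun_eq_infinitePi_map fun p => measurable_pi_lambda _ fun b => hm (p, b)]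
    have h1 : ∀ p : ι × ℕ, P.map (fun ω b => V (p, b) ω) =
        Measure.infinitePi fun b => P.map (V (p, b)) := fun p =>
      (hind.precomp (Prod.mk_right_injective p)).map_fun_eq_infinitePi_map fun b => hm (p, b)
    have h2 := Measure.infinitePi_map_curry fun (p : ι × ℕ) (b : Bool) => P.map (V (p, b))
    rw [← show P.map (fun ω q => V q ω) = Measure.infinitePi fun q : (ι × ℕ) × Bool =>
        P.map (V (q.1, q.2)) from hind.map_fun_eq_infinitePi_map hm,
      Measure.map_map (by fun_prop) (measurable_pi_lambda _ hm)] at h2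
    refine h2.trans ?_
    congr 1
    funext p
    exact (h1 p).symm
  exact hblock.comp (fun _ v => (v true, v false)) fun _ => by fun_prop

omit [Fintype ι] [IsProbabilityMeasure ν] in
theorem IsInput.map_mark (hin : IsInput P lam ν X S) (j : ι) (n : ℕ) :
    P.map (fun ω => (X j n ω, S j n ω)) = markLaw (lam j) ν := by
  have h1 : IndepFun (X j n) (S j n) P :=
    hin.indep.indepFun (i := Sum.inl (j, n)) (j := Sum.inr (j, n)) (by simp)
  rw [(indepFun_iff_map_prod_eq_prod_map_map (hin.measurable_X j n).aemeasurable
    (hin.measurable_S j n).aemeasurable).1 h1, hin.law_X, hin.law_S]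

-- Currying the index `(j, n)` turns the law of the independent marks into a product over sources of
-- laws of i.i.d. sequences.
omit [IsProbabilityMeasure ν] in
theorem IsInput.map_eq [∀ j, IsProbabilityMeasure (markLaw (lam j) ν)]
    (hin : IsInput P lam ν X S) :
    P.map (fun ω j n => (X j n ω, S j n ω)) = systemLaw lam ν := by
  have hm : ∀ p : ι × ℕ, Measurable fun ω => (X p.1 p.2 ω, S p.1 p.2 ω) := fun p =>
    (hin.measurable_X _ _).prodMk (hin.measurable_S _ _)
  have h1 := hin.iIndepFun_marks.map_fun_eq_infinitePi_map hm
  simp only [hin.map_mark] at h1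
  have h2 := Measure.infinitePi_map_curry fun (j : ι) (_ : ℕ) => markLaw (lam j) ν
  rw [← h1, Measure.map_map (by fun_prop) (measurable_pi_lambda _ hm)] at h2
  rw [systemLaw, ← Measure.infinitePi_eq_pi]
  exact h2

end Input
end MG11

end

/-! ### The theorem -/

theorem theorem1 {ι : Type*} [Fintype ι] [Nonempty ι] [DecidableEq ι]
    {Ω : Type*} [MeasurableSpace Ω] (P : Measure Ω) [IsProbabilityMeasure P]
    (lam : ι → ℝ) (ν : Measure ℝ) [IsProbabilityMeasure ν] (X S : ι → ℕ → Ω → ℝ)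
    (hin : MG11.IsInput P lam ν X S) (c : ι)
    (Y A : ℕ → Ω → ℝ) (δ : ℝ → Ω → ℝ)
    (hY : ∀ i ω, Y i ω = MG11.interdepartureTime (fun j n => X j n ω) (fun j n => S j n ω) c i)
    (hA : ∀ i ω, A i ω = MG11.peakAoI (fun j n => X j n ω) (fun j n => S j n ω) c i)
    (hδ : ∀ t ω, δ t ω = MG11.aoi (fun j n => X j n ω) (fun j n => S j n ω) c t) :
    ∃ law : Measure ℝ, IsProbabilityMeasure law ∧ MG11.IsStationaryLaw P δ law ∧
      DifferentiableAt ℝ (MG11.MY lam ν c) 0 ∧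
      ∀ i : ℕ,
        (0 : ℝ) ∈ interior (integrableExpSet (Y i) P) ∧
        ∀ s ∈ integrableExpSet (Y i) P, (∀ j, s ≠ lam j) →
          mgf (Y i) P s = MG11.MY lam ν c s ∧
          (s ∈ integrableExpSet (A i) P ∧
            mgf (A i) P s = MG11.MS ν (s - lam c) * MG11.MY lam ν c s / MG11.LS ν (lam c)) ∧
          (s ≠ 0 → s ∈ integrableExpSet id law ∧
            mgf id law s = MG11.MS ν (s - lam c) * (MG11.MY lam ν c s - 1) /
              (s * MG11.LS ν (lam c) * deriv (MG11.MY lam ν c) 0)) := by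
  open MG11 in
  -- The source of a delivered packet is part of the output of a cycle, so the set of sources needs
  -- a σ-algebra.
  let _ : MeasurableSpace ι := ⊤
  have : DiscreteMeasurableSpace ι := ⟨fun _ => trivial⟩
  have hlam := hin.rate_pos
  have hν := hin.service_nonneg
  have : ∀ j, IsProbabilityMeasure (markLaw (lam j) ν) := fun j =>
    isProbabilityMeasure_markLaw (hlam j)
  have := isProbabilityMeasure_cycleLaw (ν := ν) hν hlam c
  have hpos := ae_cycleLaw_pos (ν := ν) hν hlam c
  have hint := integrable_fst_cycleLaw (ν := ν) hν hlam c
  set Z : Ω → ι → Marks := fun ω j n => (X j n ω, S j n ω) with hZ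
  have hZm : Measurable Z := measurable_pi_lambda _ fun j => measurable_pi_lambda _ fun n =>
    (hin.measurable_X j n).prodMk (hin.measurable_S j n)
  have hmap : P.map Z = systemLaw lam ν := hin.map_eq
  have hreg := isRegenerative_source (ν := ν) hν hlam c
  have hpull : ∀ {p : (ι → Marks) → Prop}, (∀ᵐ z ∂(systemLaw lam ν), p z) → ∀ᵐ ω ∂P, p (Z ω) :=
    fun h => ae_of_ae_map hZm.aemeasurable (hmap ▸ h)
  have horbit := hpull (ae_isRegularOrbit (ν := ν) hν hlam c)
  -- The cycles `i` and `i + 1` are independent with the same law; `Y i` and `A i` are functions of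
  -- this pair, the system time being taken from the first and the length from the second.
  have hpair : ∀ i, IdentDistrib
      (fun ω => (sourceOut c ((sourceRest c)^[i] (Z ω)), sourceOut c ((sourceRest c)^[i + 1] (Z ω))))
      id P ((cycleLaw lam ν c).prod (cycleLaw lam ν c)) := by
    intro i
    have hU : ∀ n, Measurable fun z => sourceOut c ((sourceRest c)^[n] z) := hreg.measurable_iterate
    refine ⟨(((hU i).prodMk (hU (i + 1))).comp hZm).aemeasurable, aemeasurable_id, ?_⟩
    rw [Measure.map_id, ← (show _ = cycleLaw lam ν c from (hreg.identDistrib_iterate i).map_eq)]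
    nth_rewrite 2 [(show _ = _ from (hreg.identDistrib_iterate i).map_eq.trans
      (hreg.identDistrib_iterate (i + 1)).map_eq.symm)]
    rw [← (indepFun_iff_map_prod_eq_prod_map_map (hU i).aemeasurable (hU (i + 1)).aemeasurable).1
      (hreg.iIndepFun_iterate.indepFun (Nat.succ_ne_self i).symm), ← hmap,
      Measure.map_map ((hU i).prodMk (hU (i + 1))) hZm]
    rfl
  have hYd : ∀ i, IdentDistrib (Y i) Prod.fst P (cycleLaw lam ν c) := by
    intro i
    have h1 : IdentDistrib (fun ω => gap c (i + 1) (Z ω)) (fun q : (ℝ × ℝ) × (ℝ × ℝ) => q.2.1) P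
        ((cycleLaw lam ν c).prod (cycleLaw lam ν c)) :=
      (hpair i).comp (u := fun q : (ℝ × ℝ) × (ℝ × ℝ) => q.2.1) (by fun_prop)
    have h2 : IdentDistrib (fun q : (ℝ × ℝ) × (ℝ × ℝ) => q.2.1) Prod.fst
        ((cycleLaw lam ν c).prod (cycleLaw lam ν c)) (cycleLaw lam ν c) := by
      have h3 : IdentDistrib (Prod.snd : (ℝ × ℝ) × (ℝ × ℝ) → ℝ × ℝ) id
          ((cycleLaw lam ν c).prod (cycleLaw lam ν c)) (cycleLaw lam ν c) :=
        ⟨measurable_snd.aemeasurable, aemeasurable_id, by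
          rw [Measure.map_snd_prod, measure_univ, one_smul, Measure.map_id]⟩
      exact h3.comp measurable_fst
    -- The shift by one: `gap c 0` is the time up to the first delivery, not an interdeparture time,
    -- although it has the same law because the system starts empty.
    have h4 : Y i =ᵐ[P] fun ω => gap c (i + 1) (Z ω) := by
      filter_upwards [horbit] with ω hω
      rw [hY]
      exact hω.interdepartureTime_eq i
    exact (IdentDistrib.of_ae_eq (h1.aemeasurable_fst.congr h4.symm) h4).trans (h1.trans h2)
  have hAd : ∀ i, IdentDistrib (A i) (fun q : (ℝ × ℝ) × (ℝ × ℝ) => q.2.1 + q.1.2) P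
      ((cycleLaw lam ν c).prod (cycleLaw lam ν c)) := by
    intro i
    have h1 : IdentDistrib (fun ω => gap c (i + 1) (Z ω) + sojourn c i (Z ω))
        (fun q : (ℝ × ℝ) × (ℝ × ℝ) => q.2.1 + q.1.2) P
        ((cycleLaw lam ν c).prod (cycleLaw lam ν c)) :=
      (hpair i).comp (u := fun q : (ℝ × ℝ) × (ℝ × ℝ) => q.2.1 + q.1.2) (by fun_prop)
    have h4 : A i =ᵐ[P] fun ω => gap c (i + 1) (Z ω) + sojourn c i (Z ω) := by
      filter_upwards [horbit] with ω hω
      rw [hA]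
      exact hω.peakAoI_eq i
    exact (IdentDistrib.of_ae_eq (h1.aemeasurable_fst.congr h4.symm) h4).trans h1
  refine ⟨ageLaw (cycleLaw lam ν c), isProbabilityMeasure_ageLaw hpos hint, ?_,
    (hasDerivAt_MY hν hlam c).differentiableAt, fun i => ?_⟩
  · intro B hB
    filter_upwards [hpull (ae_tendsto_fraction_aoi (ν := ν) hν hlam c hint hB)] with ω hω
    simp only [hδ]
    exact hω
  · rw [integrableExpSet_congr_identDistrib (hYd i), integrableExpSet_congr_identDistrib (hAd i),
      mgf_congr_identDistrib (hYd i), mgf_congr_identDistrib (hAd i)]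
    exact ⟨zero_mem_interior_cycleLaw hν hlam c, fun s hs hsl =>
      ⟨(mgf_fst_cycleLaw hν hlam c hs hsl).2, mgf_peak_cycleLaw hν hlam c hs hsl,
        mgf_ageLaw_cycleLaw hν hlam c hs hsl⟩⟩
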